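/- **Theorem (Soundness of the discrete-distribution semantics of the type theory COMET).** *Syntax.* Fix a set of type constants. Types are $A ::= \mathbf C \mid 0 \mid 1 \mid A+B \mid A\otimes B$, with $\mathbf C$ a type constant. Put $0\cdot A=0$, $1\cdot A=A$, $(n+1)\cdot A=n\cdot A+A$ for $n\ge1$, $\mathbf n=n\cdot 1$ and $\mathbf 2=1+1$. Terms, up to renaming of bound variables, are $$t ::= x \mid * \mid s\otimes t \mid \mathsf{let}\ x\otimes y=s\ \mathsf{in}\ t \mid \mathsf{magic}\,t \mid \mathsf{inl}\,t \mid \mathsf{inr}\,t \mid (\mathsf{case}\ r\ \mathsf{of}\ \mathsf{inl}\,x\mapsto s\mid\mathsf{inr}\,y\mapsto t) \mid \langle\!\langle s,t\rangle\!\rangle \mid \mathsf{left}\,t \mid \mathsf{instr}_{\lambda x t}(s) \mid 1/n \mid b_{mn} \mid \mathsf{norm}\,t \mid s\ovee t.$$ *Abbreviations.* $\top=\mathsf{return}(*)$, where $\mathsf{return}\,t=\mathsf{inl}\,t$; $\bot=\mathsf{fail}=\mathsf{inr}\,*$; $\mathsf{do}\ x\leftarrow s;t$ is $\mathsf{case}\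 s\ \mathsf{of}\ \mathsf{inl}\,x\mapsto t\mid\mathsf{inr}\,\_\mapsto\mathsf{fail}$; $t{\downarrow}=\mathsf{case}\ t\ \mathsf{of}\ \mathsf{inl}\,\_\mapsto\top\mid\mathsf{inr}\,\_\mapsto\bot$; $t{\uparrow}=\mathsf{case}\ t\ \mathsf{of}\ \mathsf{inl}\,\_\mapsto\bot\mid\mathsf{inr}\,\_\mapsto\top$; $\rhd_1(t)=\mathsf{case}\ t\ \mathsf{of}\ \mathsf{inl}\,x\mapsto\mathsf{return}\,x\mid\mathsf{inr}\,\_\mapsto\mathsf{fail}$; $\rhd_2(t)=\mathsf{case}\ t\ \mathsf{of}\ \mathsf{inl}\,\_\mapsto\mathsf{fail}\mid\mathsf{inr}\,y\mapsto\mathsf{return}\,y$; $b\gg\!\!=\rhd_i$ is $\mathsf{do}\ x\leftarrow b;\rhd_i(x)$. For $t:n\cdot A$, with injections $\mathsf{in}_i^n$ and the evident $n$-fold $\mathsf{case}$ (which is $\mathsf{magic}\,t$ for $n=0$), $\nabla(t)$ maps $\mathsf{in}_i^n x$ to $x$ and $\mathsf{ind}(t):\mathbf n$ maps $\mathsf{in}_i^n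 x$ to $\mathsf{in}_i^n *$. $\mathsf{assert}_{\lambda xp}(t)=\rhd_1(\mathsf{instr}_{\lambda xp}(t))$; $0\cdot t=\mathsf{fail}$, $1\cdot t=t$, $(n+1)\cdot t=n\cdot t\ovee t$. *Derivability.* Judgements are $\Gamma\vdash t:A$, $\Gamma\vdash s=t:A$ and $\Gamma\vdash s\le t:A+1$, where $\Gamma$ is a list of typed variables. They are generated by the following rules, in which $n\ge2$ for $1/n$ and $b_{mn}$, and $1\le m<n$ for $b_{mn}$. 1. Exchange of two adjacent variables of the context (for all judgements); $\Gamma\vdash x:A$ if $x:A\in\Gamma$; equality at each type is reflexive on typed terms, symmetric and transitive. 2. $\Gamma\vdash *:1$, and $\Gamma\vdash t=*:1$ if $\Gamma\vdash t:1$. 3. From $\Gamma\vdash s:A$, $\Delta\vdash t:B$: $\Gamma,\Delta\vdash s\otimes t:A\otimes B$. From $\Gamma\vdash s:A\otimes B$ and $\Delta,x:A,y:B\vdash t:C$: $\Gamma,\Delta\vdash \mathsf{let}\ x\otimes y=s\ \mathsf{in}\ t:C$. The congruence rules for both. $\mathsf{let}\ x\otimes y=r\otimes s\ \mathsf{in}\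 t=t[x:=r,y:=s]$; $(\mathsf{let}\ x\otimes y=t\ \mathsf{in}\ x\otimes y)=t$; $\mathsf{let}\ x\otimes y=r\ \mathsf{in}\ (\mathsf{let}\ z\otimes w=s\ \mathsf{in}\ t)=\mathsf{let}\ z\otimes w=(\mathsf{let}\ x\otimes y=r\ \mathsf{in}\ s)\ \mathsf{in}\ t$; $(\mathsf{let}\ x\otimes y=r\ \mathsf{in}\ s)\otimes t=\mathsf{let}\ x\otimes y=r\ \mathsf{in}\ (s\otimes t)$. Here and in 5 different subterms draw their free variables from disjoint contexts (the branches of one $\mathsf{case}$ share theirs), which are concatenated in the conclusion. 4. From $\Gamma\vdash t:0$: $\Gamma\vdash\mathsf{magic}\,t:A$, and $\Gamma\vdash \mathsf{magic}\,t=s:A$ whenever $\Gamma\vdash s:A$. 5. The typing and congruence rules of $\mathsf{inl}$, $\mathsf{inr}$; from $\Gamma\vdash r:A+B$, $\Delta,x:A\vdash s:C$, $\Delta,y:B\vdash t:C$: $\Gamma,\Delta\vdash(\mathsf{case}\ r\ \mathsf{of}\ \mathsf{inl}\,x\mapsto s\mid\mathsf{inr}\,y\mapsto t):C$, with its congruence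 rule; $\mathsf{case}\ \mathsf{inl}\,r\ \mathsf{of}\ \mathsf{inl}\,x\mapsto s\mid\mathsf{inr}\,y\mapsto t=s[x:=r]$ and $\mathsf{case}\ \mathsf{inr}\,r\ \mathsf{of}\ \mathsf{inl}\,x\mapsto s\mid\mathsf{inr}\,y\mapsto t=t[y:=r]$; $(\mathsf{case}\ t\ \mathsf{of}\ \mathsf{inl}\,x\mapsto\mathsf{inl}\,x\mid\mathsf{inr}\,y\mapsto\mathsf{inr}\,y)=t$; and the conversions that move a $\mathsf{case}$ out of the scrutinee of a $\mathsf{case}$, out of the left factor of a $\otimes$, and out of the scrutinee of a $\mathsf{let}$. 6. From $\Gamma\vdash s:A+1$, $\Gamma\vdash t:B+1$, $\Gamma\vdash s{\downarrow}=t{\uparrow}:\mathbf 2$: $\Gamma\vdash\langle\!\langle s,t\rangle\!\rangle:A+B$, $\rhd_1\langle\!\langle s,t\rangle\!\rangle=s$, $\rhd_2\langle\!\langle s,t\rangle\!\rangle=t$; congruence; and $\langle\!\langle\rhd_1(t),\rhd_2(t)\rangle\!\rangle=t$ for $\Gamma\vdash t:A+B$. 7. From $\Gamma\vdash t:A+B$,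 $\Gamma\vdash t{\downarrow}=\top:\mathbf 2$: $\Gamma\vdash\mathsf{left}\,t:A$ and $\mathsf{inl}(\mathsf{left}\,t)=t$; congruence; and $\mathsf{left}(\mathsf{inl}\,t)=t$ for $\Gamma\vdash t:A$. 8. If $\Gamma\vdash s,t:(A+A)+1$, $s\gg\!\!=\rhd_1=t\gg\!\!=\rhd_1$ and $s\gg\!\!=\rhd_2=t\gg\!\!=\rhd_2$, then $s=t$. 9. For $\Gamma\vdash s,t:A+1$ and $\Gamma\vdash b:(A+A)+1$ with $b\gg\!\!=\rhd_1=s$: if $(\mathsf{do}\ x\leftarrow b;\mathsf{return}\,\nabla(x))=t$ then $\Gamma\vdash s\le t:A+1$; if $b\gg\!\!=\rhd_2=t$ then $\Gamma\vdash s\ovee t:A+1$ and $s\ovee t=\mathsf{do}\ x\leftarrow b;\mathsf{return}\,\nabla(x)$. 10. From $x:A\vdash t:\mathbf n$ ($n\ge0$), $\Gamma\vdash s:A$: $\Gamma\vdash\mathsf{instr}_{\lambda xt}(s):n\cdot A$, $\nabla(\mathsf{instr}_{\lambda xt}(s))=s$, $\mathsf{ind}(\mathsf{instr}_{\lambda xt}(s))=t[x:=s]$;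 congruence; if $x:A\vdash t:n\cdot A$, $x:A\vdash\nabla(t)=x:A$ and $\Gamma\vdash s:A$, then $\mathsf{instr}_{\lambda x\,\mathsf{ind}(t)}(s)=t[x:=s]$; and for $x:A\vdash p,q:\mathbf 2$, $\Gamma\vdash t:A$, $(\mathsf{do}\ x\leftarrow\mathsf{assert}_{\lambda xp}(t);\mathsf{assert}_{\lambda xq}(x))=(\mathsf{do}\ x\leftarrow\mathsf{assert}_{\lambda xq}(t);\mathsf{assert}_{\lambda xp}(x))$. 11. $\Gamma\vdash1/n:\mathbf 2$; $n\cdot(1/n)=\top$; if $\Gamma\vdash t:\mathbf 2$ and $n\cdot t=\top$ then $t=1/n$; $\Gamma\vdash b_{mn}:\mathbf 3$, $b_{mn}\gg\!\!=\rhd_1=m\cdot(1/n)$, $b_{mn}\gg\!\!=\rhd_2=1/n$. 12. If $\vdash t:A+1$ and $\vdash1/n\le t{\downarrow}:\mathbf 2$ (empty context), then $\Gamma\vdash\mathsf{norm}\,t:A$ and $\Gamma\vdash(\mathsf{do}\ \_\leftarrow t;\mathsf{return}(\mathsf{norm}\,t))=t:A+1$; if moreover $\Gamma\vdash\rho:A$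 and $\Gamma\vdash t=(\mathsf{do}\ \_\leftarrow t;\mathsf{return}\,\rho):A+1$, then $\Gamma\vdash\rho=\mathsf{norm}\,t:A$. *Semantics.* Fix a set $[\![\mathbf C]\!]$ for each type constant and put $[\![0]\!]=\emptyset$, $[\![1]\!]=\{*\}$, $[\![A+B]\!]=\{a_1:a\in[\![A]\!]\}\uplus\{b_2:b\in[\![B]\!]\}$, $[\![A\otimes B]\!]=[\![A]\!]\times[\![B]\!]$ and $[\![x_1:A_1,\dots,x_n:A_n]\!]=[\![A_1]\!]\times\dots\times[\![A_n]\!]$. For an input $\vec g$, define $P(t(\vec g)=v)$ by recursion on $t$ as follows (every value that is not listed has probability $0$): - $P(x_i(\vec g)=g_i)=1$; $P(*(\vec g)=*)=1$; $P((s\otimes t)(\vec g)=(a,b))=P(s(\vec g)=a)\,P(t(\vec g)=b)$; - $P((\mathsf{let}\ x\otimes y=s\ \mathsf{in}\ t)(\vec g)=c)=\sum_a\sum_bP(s(\vec g)=(a,b))\,P(t(\vec g,a,b)=c)$; - $P(\mathsf{magic}\,t(\vec g)=a)=0$; $P(\mathsf{inl}\,t(\vec g)=a_1)=P(t(\vec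 g)=a)$; $P(\mathsf{inr}\,t(\vec g)=b_2)=P(t(\vec g)=b)$; - $P((\mathsf{case}\ r\ \mathsf{of}\ \mathsf{inl}\,x\mapsto s\mid\mathsf{inr}\,y\mapsto t)(\vec g)=c)=\sum_aP(r(\vec g)=a_1)P(s(\vec g,a)=c)+\sum_bP(r(\vec g)=b_2)P(t(\vec g,b)=c)$; - $P(\langle\!\langle s,t\rangle\!\rangle(\vec g)=a_1)=P(s(\vec g)=a_1)$; $P(\langle\!\langle s,t\rangle\!\rangle(\vec g)=b_2)=P(t(\vec g)=b_1)$; $P(\mathsf{left}\,t(\vec g)=a)=P(t(\vec g)=a_1)$; - $P(\mathsf{instr}_{\lambda xt}(s)(\vec g)=a_i)=P(s(\vec g)=a)\,P(t(a)=i)$, where $a_i$ is the $i$-th copy of $a$; - $P(1/n(\vec g)=\top)=1/n$, $P(1/n(\vec g)=\bot)=(n-1)/n$; $b_{mn}$ takes the three values of $\mathbf 3$ with probabilities $m/n$, $1/n$, $(n-m-1)/n$; - $P(\mathsf{norm}\,t(\vec g)=a)=P(t(\vec g)=a_1)/(1-P(t(\vec g)=*_2))$; - $P((s\ovee t)(\vec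 g)=a_1)=P(s(\vec g)=a_1)+P(t(\vec g)=a_1)$; $P((s\ovee t)(\vec g)=*_2)=P(s(\vec g)=*_2)+P(t(\vec g)=*_2)-1$. *Claim.* 1. If $\Gamma\vdash t:A$ is derivable, then for every $\vec g\in[\![\Gamma]\!]$ the function $P(t(\vec g)=-)$ is a probability distribution on $[\![A]\!]$: its values lie in $[0,1]$, its support is a finite subset of $[\![A]\!]$, and its values sum to $1$. 2. If $\Gamma\vdash s=t:A$ is derivable, then $P(s(\vec g)=a)=P(t(\vec g)=a)$ for all $\vec g\in[\![\Gamma]\!]$ and $a\in[\![A]\!]$. -/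

import Mathlib

/-!
# The type theory COMET and its discrete probabilistic semantics

Terms are raw (untyped) terms.  They are identified up to renaming of bound variables by using
de Bruijn indices: variable `i` is the one bound by the `i`-th enclosing binder or, outside all
binders, the `i`-th entry of the context.
-/

namespace COMET

/-! ## Types -/

/-- The types built from a set `C` of type constants. -/
inductive Ty (C : Type*) where
  | const (c : C)
  | zero
  | one
  | sum (A B : Ty C)
  | tensor (A B : Ty C)

/-- The copower `n · A = A + ⋯ + A`, with `0 · A = 0`, `1 · A = A` and
`(n + 1) · A = n · A + A`. -/
def Ty.copower {C : Type*} : ℕ → Ty C → Ty C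
  | 0, _ => .zero
  | 1, A => A
  | n + 2, A => .sum (Ty.copower (n + 1) A) A

/-- The type `𝐧 = n · 1`. -/
def Ty.fin {C : Type*} (n : ℕ) : Ty C := Ty.copower n .one

/-- The type `𝟐 = 1 + 1` of predicates. -/
def Ty.two {C : Type*} : Ty C := .sum .one .one

/-- The type `A + 1` of partial computations with output in `A`. -/
def Ty.partialTy {C : Type*} (A : Ty C) : Ty C := .sum A .one

/-! ## Terms -/

inductive Tm where
  /-- a variable -/
  | var (i : ℕ)
  /-- `*` -/
  | star
  /-- `s ⊗ t` -/
  | pair (s t : Tm)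
  /-- `let x ⊗ y = s in t`; in `t` the index of `y` is 0 and that of `x` is 1 -/
  | letPair (s t : Tm)
  /-- `magic t` -/
  | magic (t : Tm)
  /-- `inl t` -/
  | inl (t : Tm)
  /-- `inr t` -/
  | inr (t : Tm)
  /-- `case r of inl x ↦ s | inr y ↦ t`; `x` is bound in `s` and `y` in `t` -/
  | caseOf (r s t : Tm)
  /-- the partial pairing `⟪s, t⟫` -/
  | inlr (s t : Tm)
  /-- `left t` -/
  | lft (t : Tm)
  /-- `instr_{λ x t}(s)`; `x` is bound in `t` -/
  | instr (t s : Tm)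
  /-- the constant scalar `1 / n` -/
  | frac (n : ℕ)
  /-- the constant `b_{mn}`, a bound for `m · (1 / n) ⊻ 1 / n` -/
  | bound (m n : ℕ)
  /-- `norm t` -/
  | normal (t : Tm)
  /-- the partial sum `s ⊻ t` -/
  | psum (s t : Tm)

/-- The renaming `f` carried under one binder. -/
def liftRen (f : ℕ → ℕ) : ℕ → ℕ
  | 0 => 0
  | i + 1 => f i + 1

def Tm.rename : Tm → (ℕ → ℕ) → Tm
  | .var i, f => .var (f i)
  | .star, _ => .star
  | .pair s t, f => .pair (s.rename f) (t.rename f)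
  | .letPair s t, f => .letPair (s.rename f) (t.rename (liftRen (liftRen f)))
  | .magic t, f => .magic (t.rename f)
  | .inl t, f => .inl (t.rename f)
  | .inr t, f => .inr (t.rename f)
  | .caseOf r s t, f =>
      .caseOf (r.rename f) (s.rename (liftRen f)) (t.rename (liftRen f))
  | .inlr s t, f => .inlr (s.rename f) (t.rename f)
  | .lft t, f => .lft (t.rename f)
  | .instr t s, f => .instr (t.rename (liftRen f)) (s.rename f)
  | .frac n, _ => .frac n
  | .bound m n, _ => .bound m n
  | .normal t, f => .normal (t.rename f)
  | .psum s t, f => .psum (s.rename f) (t.rename f)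

/-- `t.shift k d` makes room for `d` new variables in front of the variables of index `≥ k`. -/
def Tm.shift (t : Tm) (k d : ℕ) : Tm := t.rename fun i => if i < k then i else i + d

/-- The simultaneous substitution `σ` carried under one binder. -/
def liftSub (σ : ℕ → Tm) : ℕ → Tm
  | 0 => .var 0
  | i + 1 => (σ i).shift 0 1

/-- Simultaneous capture-avoiding substitution. -/
def Tm.subst : Tm → (ℕ → Tm) → Tm
  | .var i, σ => σ i
  | .star, _ => .star
  | .pair s t, σ => .pair (s.subst σ) (t.subst σ)
  | .letPair s t, σ => .letPair (s.subst σ) (t.subst (liftSub (liftSub σ)))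
  | .magic t, σ => .magic (t.subst σ)
  | .inl t, σ => .inl (t.subst σ)
  | .inr t, σ => .inr (t.subst σ)
  | .caseOf r s t, σ =>
      .caseOf (r.subst σ) (s.subst (liftSub σ)) (t.subst (liftSub σ))
  | .inlr s t, σ => .inlr (s.subst σ) (t.subst σ)
  | .lft t, σ => .lft (t.subst σ)
  | .instr t s, σ => .instr (t.subst (liftSub σ)) (s.subst σ)
  | .frac n, _ => .frac n
  | .bound m n, _ => .bound m n
  | .normal t, σ => .normal (t.subst σ)
  | .psum s t, σ => .psum (s.subst σ) (t.subst σ)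

/-- `t[x := s]`, where `x` is the variable of index 0 of `t`. -/
def Tm.inst (t s : Tm) : Tm :=
  t.subst fun i => match i with
    | 0 => s
    | i + 1 => .var i

/-- `t[x := r, y := s]`, where `y` and `x` are the variables of index 0 and 1 of `t`. -/
def Tm.inst₂ (t r s : Tm) : Tm :=
  t.subst fun i => match i with
    | 0 => s
    | 1 => r
    | i + 2 => .var i

/-! ## Defined constructions -/

namespace Tm

def top : Tm := .inl .star

def bot : Tm := .inr .star

/-- `return t` -/
def ret (t : Tm) : Tm := .inl t

/-- `fail` -/
def fail : Tm := .inr .star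

/-- `do x ← s; t`, where `x` is bound in `t`. -/
def doIn (s t : Tm) : Tm := .caseOf s t fail

/-- The domain predicate `t↓`, also written `inl?(t)`. -/
def dom (t : Tm) : Tm := .caseOf t top bot

/-- The kernel `t↑`, also written `inr?(t)`. -/
def ker (t : Tm) : Tm := .caseOf t bot top

/-- The first partial projection `▷₁ t : A + 1` of `t : A + B`. -/
def proj₁ (t : Tm) : Tm := .caseOf t (ret (.var 0)) fail

/-- The second partial projection `▷₂ t : B + 1` of `t : A + B`. -/
def proj₂ (t : Tm) : Tm := .caseOf t fail (ret (.var 0))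

/-- The `i`-th injection `inᵢⁿ t` into an `n`-fold sum. -/
def inj : (n : ℕ) → Fin n → Tm → Tm
  | 0, i, _ => i.elim0
  | 1, _, t => t
  | n + 2, i, t => Fin.lastCases (motive := fun _ => Tm) (.inr t) (fun j => .inl (inj (n + 1) j t)) i

/-- `case_{i=1}^n t of inᵢⁿ x ↦ fᵢ`, where `x` is bound in each `fᵢ`. -/
def caseN : (n : ℕ) → Tm → (Fin n → Tm) → Tm
  | 0, t, _ => .magic t
  | 1, t, f => (f 0).inst t
  | n + 2, t, f =>
      .caseOf t (caseN (n + 1) (.var 0) fun i => (f i.castSucc).shift 1 1) (f (Fin.last (n + 1)))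

/-- The codiagonal `∇ t : A` of `t : n · A`. -/
def nabla (n : ℕ) (t : Tm) : Tm := caseN n t fun _ => .var 0

/-- `ind t : 𝐧` for `t : n · A`, the index of the summand that `t` comes from. -/
def ind (n : ℕ) (t : Tm) : Tm := caseN n t fun i => inj n i .star

/-- `assert_{λ x p}(t)`, where `x` is bound in `p`. -/
def assert (p t : Tm) : Tm := .caseOf (.instr p t) (ret (.var 0)) fail

/-- The `n`-fold partial sum `n · t = t ⊻ ⋯ ⊻ t`. -/
def nsum : ℕ → Tm → Tm
  | 0, _ => fail
  | 1, t => t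
  | n + 2, t => .psum (nsum (n + 1) t) t

end Tm

/-! ## Judgements and rules of deduction -/

/-- The right-hand sides of judgements. -/
inductive Judgement (C : Type*) where
  /-- `t : A` -/
  | typ (t : Tm) (A : Ty C)
  /-- `s = t : A` -/
  | eq (s t : Tm) (A : Ty C)
  /-- `s ≤ t : A + 1` -/
  | le (s t : Tm) (A : Ty C)

def Judgement.rename {C : Type*} (f : ℕ → ℕ) : Judgement C → Judgement C
  | .typ t A => .typ (t.rename f) A
  | .eq s t A => .eq (s.rename f) (t.rename f) A
  | .le s t A => .le (s.rename f) (t.rename f) A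

open Judgement

/-- `Derives Γ J` says that the judgement `Γ ⊢ J` is derivable.

The head of the list `Γ` is the most recent variable, so that `Γ, x : A` is `A :: Γ` and the
context `Γ, Δ` is `Δ ++ Γ`.  A term over `Δ` is then, unchanged, a term over `Γ, Δ`, and a term
over `Γ` becomes one by a shift by the length of `Δ`. -/
inductive Derives {C : Type*} : List (Ty C) → Judgement C → Prop where
  -- Structural rules
  | exch (Γ Δ : List (Ty C)) (A B : Ty C) (J : Judgement C) :
      Derives (Δ ++ B :: A :: Γ) J →
      Derives (Δ ++ A :: B :: Γ) (J.rename (Equiv.swap Δ.length (Δ.length + 1)))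
  | var (Γ : List (Ty C)) (i : ℕ) (A : Ty C) :
      Γ[i]? = some A → Derives Γ (.typ (.var i) A)
  | refl (Γ : List (Ty C)) (t : Tm) (A : Ty C) :
      Derives Γ (typ t A) → Derives Γ (eq t t A)
  | symm (Γ : List (Ty C)) (s t : Tm) (A : Ty C) :
      Derives Γ (eq s t A) → Derives Γ (eq t s A)
  | trans (Γ : List (Ty C)) (r s t : Tm) (A : Ty C) :
      Derives Γ (eq r s A) → Derives Γ (eq s t A) → Derives Γ (eq r t A)
  -- Singleton type
  | unit (Γ : List (Ty C)) : Derives Γ (typ .star .one)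
  | eta_one (Γ : List (Ty C)) (t : Tm) :
      Derives Γ (typ t .one) → Derives Γ (eq t .star .one)
  -- Tensor product
  | pair (Γ Δ : List (Ty C)) (s t : Tm) (A B : Ty C) :
      Derives Γ (typ s A) → Derives Δ (typ t B) →
      Derives (Δ ++ Γ) (typ (.pair (s.shift 0 Δ.length) t) (.tensor A B))
  | letPair (Γ Δ : List (Ty C)) (s t : Tm) (A B D : Ty C) :
      Derives Γ (typ s (.tensor A B)) → Derives (B :: A :: Δ) (typ t D) →
      Derives (Δ ++ Γ) (typ (.letPair (s.shift 0 Δ.length) t) D)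
  | pair_eq (Γ Δ : List (Ty C)) (s s' t t' : Tm) (A B : Ty C) :
      Derives Γ (eq s s' A) → Derives Δ (eq t t' B) →
      Derives (Δ ++ Γ)
        (eq (.pair (s.shift 0 Δ.length) t) (.pair (s'.shift 0 Δ.length) t') (.tensor A B))
  | letPair_eq (Γ Δ : List (Ty C)) (s s' t t' : Tm) (A B D : Ty C) :
      Derives Γ (eq s s' (.tensor A B)) → Derives (B :: A :: Δ) (eq t t' D) →
      Derives (Δ ++ Γ)
        (eq (.letPair (s.shift 0 Δ.length) t) (.letPair (s'.shift 0 Δ.length) t') D)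
  | beta_tensor (Γ Δ Θ : List (Ty C)) (r s t : Tm) (A B D : Ty C) :
      Derives Γ (typ r A) → Derives Δ (typ s B) → Derives (B :: A :: Θ) (typ t D) →
      Derives (Θ ++ (Δ ++ Γ))
        (eq (.letPair (.pair (r.shift 0 (Θ.length + Δ.length)) (s.shift 0 Θ.length)) t)
          (t.inst₂ (r.shift 0 (Θ.length + Δ.length)) (s.shift 0 Θ.length)) D)
  | eta_tensor (Γ : List (Ty C)) (t : Tm) (A B : Ty C) :
      Derives Γ (typ t (.tensor A B)) →
      Derives Γ (eq (.letPair t (.pair (.var 1) (.var 0))) t (.tensor A B))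
  /-- `let x ⊗ y = r in (let z ⊗ w = s in t) = let z ⊗ w = (let x ⊗ y = r in s) in t` -/
  | let_let (Γ Δ Θ : List (Ty C)) (r s t : Tm) (A B D E F : Ty C) :
      Derives Γ (typ r (.tensor A B)) → Derives (B :: A :: Δ) (typ s (.tensor D E)) →
      Derives (E :: D :: Θ) (typ t F) →
      Derives (Θ ++ (Δ ++ Γ))
        (eq
          (.letPair (r.shift 0 (Θ.length + Δ.length))
            (.letPair (s.shift 2 Θ.length) (t.shift 2 2)))
          (.letPair (.letPair (r.shift 0 (Θ.length + Δ.length)) (s.shift 2 Θ.length)) t) F)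
  /-- `(let x ⊗ y = r in s) ⊗ t = let x ⊗ y = r in (s ⊗ t)` -/
  | let_pair (Γ Δ Θ : List (Ty C)) (r s t : Tm) (A B D E : Ty C) :
      Derives Γ (typ r (.tensor A B)) → Derives (B :: A :: Δ) (typ s D) →
      Derives Θ (typ t E) →
      Derives (Θ ++ (Δ ++ Γ))
        (eq
          (.pair (.letPair (r.shift 0 (Θ.length + Δ.length)) (s.shift 2 Θ.length)) t)
          (.letPair (r.shift 0 (Θ.length + Δ.length))
            (.pair (s.shift 2 Θ.length) (t.shift 0 2))) (.tensor D E))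
  -- Empty type
  | magic (Γ : List (Ty C)) (t : Tm) (A : Ty C) :
      Derives Γ (typ t .zero) → Derives Γ (typ (.magic t) A)
  | eta_zero (Γ : List (Ty C)) (s t : Tm) (A : Ty C) :
      Derives Γ (typ s .zero) → Derives Γ (typ t A) → Derives Γ (eq (.magic s) t A)
  -- Binary coproducts
  | inl (Γ : List (Ty C)) (t : Tm) (A B : Ty C) :
      Derives Γ (typ t A) → Derives Γ (typ (.inl t) (.sum A B))
  | inr (Γ : List (Ty C)) (t : Tm) (A B : Ty C) :
      Derives Γ (typ t B) → Derives Γ (typ (.inr t) (.sum A B))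
  | inl_eq (Γ : List (Ty C)) (t t' : Tm) (A B : Ty C) :
      Derives Γ (eq t t' A) → Derives Γ (eq (.inl t) (.inl t') (.sum A B))
  | inr_eq (Γ : List (Ty C)) (t t' : Tm) (A B : Ty C) :
      Derives Γ (eq t t' B) → Derives Γ (eq (.inr t) (.inr t') (.sum A B))
  | caseOf (Γ Δ : List (Ty C)) (r s t : Tm) (A B D : Ty C) :
      Derives Γ (typ r (.sum A B)) → Derives (A :: Δ) (typ s D) → Derives (B :: Δ) (typ t D) →
      Derives (Δ ++ Γ) (typ (.caseOf (r.shift 0 Δ.length) s t) D)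
  | caseOf_eq (Γ Δ : List (Ty C)) (r r' s s' t t' : Tm) (A B D : Ty C) :
      Derives Γ (eq r r' (.sum A B)) → Derives (A :: Δ) (eq s s' D) →
      Derives (B :: Δ) (eq t t' D) →
      Derives (Δ ++ Γ)
        (eq (.caseOf (r.shift 0 Δ.length) s t) (.caseOf (r'.shift 0 Δ.length) s' t') D)
  | beta_inl (Γ Δ : List (Ty C)) (r s t : Tm) (A B D : Ty C) :
      Derives Γ (typ r A) → Derives (A :: Δ) (typ s D) → Derives (B :: Δ) (typ t D) →
      Derives (Δ ++ Γ)
        (eq (.caseOf (.inl (r.shift 0 Δ.length)) s t) (s.inst (r.shift 0 Δ.length)) D)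
  | beta_inr (Γ Δ : List (Ty C)) (r s t : Tm) (A B D : Ty C) :
      Derives Γ (typ r B) → Derives (A :: Δ) (typ s D) → Derives (B :: Δ) (typ t D) →
      Derives (Δ ++ Γ)
        (eq (.caseOf (.inr (r.shift 0 Δ.length)) s t) (t.inst (r.shift 0 Δ.length)) D)
  | eta_sum (Γ : List (Ty C)) (t : Tm) (A B : Ty C) :
      Derives Γ (typ t (.sum A B)) →
      Derives Γ (eq (.caseOf t (.inl (.var 0)) (.inr (.var 0))) t (.sum A B))
  /-- `case r of inl x ↦ (case s of inl z ↦ t | inr w ↦ t')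
        | inr y ↦ (case s' of inl z ↦ t | inr w ↦ t')
      = case (case r of inl x ↦ s | inr y ↦ s') of inl z ↦ t | inr w ↦ t'` -/
  | case_case (Γ Δ Θ : List (Ty C)) (r s s' t t' : Tm) (A B D E F : Ty C) :
      Derives Γ (typ r (.sum A B)) →
      Derives (A :: Δ) (typ s (.sum D E)) → Derives (B :: Δ) (typ s' (.sum D E)) →
      Derives (D :: Θ) (typ t F) → Derives (E :: Θ) (typ t' F) →
      Derives (Θ ++ (Δ ++ Γ))
        (eq
          (.caseOf (r.shift 0 (Θ.length + Δ.length))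
            (.caseOf (s.shift 1 Θ.length) (t.shift 1 1) (t'.shift 1 1))
            (.caseOf (s'.shift 1 Θ.length) (t.shift 1 1) (t'.shift 1 1)))
          (.caseOf
            (.caseOf (r.shift 0 (Θ.length + Δ.length)) (s.shift 1 Θ.length) (s'.shift 1 Θ.length))
            t t') F)
  /-- `(case r of inl x ↦ s | inr y ↦ s') ⊗ t = case r of inl x ↦ s ⊗ t | inr y ↦ s' ⊗ t` -/
  | case_pair (Γ Δ Θ : List (Ty C)) (r s s' t : Tm) (A B D E : Ty C) :
      Derives Γ (typ r (.sum A B)) → Derives (A :: Δ) (typ s D) → Derives (B :: Δ) (typ s' D) →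
      Derives Θ (typ t E) →
      Derives (Θ ++ (Δ ++ Γ))
        (eq
          (.pair
            (.caseOf (r.shift 0 (Θ.length + Δ.length)) (s.shift 1 Θ.length) (s'.shift 1 Θ.length))
            t)
          (.caseOf (r.shift 0 (Θ.length + Δ.length))
            (.pair (s.shift 1 Θ.length) (t.shift 0 1))
            (.pair (s'.shift 1 Θ.length) (t.shift 0 1))) (.tensor D E))
  /-- `let z ⊗ w = (case r of inl x ↦ s | inr y ↦ s') in t
      = case r of inl x ↦ (let z ⊗ w = s in t) | inr y ↦ (let z ⊗ w = s' in t)` -/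
  | let_case (Γ Δ Θ : List (Ty C)) (r s s' t : Tm) (A B D E F : Ty C) :
      Derives Γ (typ r (.sum A B)) →
      Derives (A :: Δ) (typ s (.tensor D E)) → Derives (B :: Δ) (typ s' (.tensor D E)) →
      Derives (E :: D :: Θ) (typ t F) →
      Derives (Θ ++ (Δ ++ Γ))
        (eq
          (.letPair
            (.caseOf (r.shift 0 (Θ.length + Δ.length)) (s.shift 1 Θ.length) (s'.shift 1 Θ.length))
            t)
          (.caseOf (r.shift 0 (Θ.length + Δ.length))
            (.letPair (s.shift 1 Θ.length) (t.shift 2 1))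
            (.letPair (s'.shift 1 Θ.length) (t.shift 2 1))) F)
  -- Partial pairing
  | inlr (Γ : List (Ty C)) (s t : Tm) (A B : Ty C) :
      Derives Γ (typ s A.partialTy) → Derives Γ (typ t B.partialTy) →
      Derives Γ (eq s.dom t.ker .two) →
      Derives Γ (typ (.inlr s t) (.sum A B))
  | inlr_eq (Γ : List (Ty C)) (s s' t t' : Tm) (A B : Ty C) :
      Derives Γ (eq s s' A.partialTy) → Derives Γ (eq t t' B.partialTy) →
      Derives Γ (eq s.dom t.ker .two) →
      Derives Γ (eq (.inlr s t) (.inlr s' t') (.sum A B))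
  | beta_inlr₁ (Γ : List (Ty C)) (s t : Tm) (A B : Ty C) :
      Derives Γ (typ s A.partialTy) → Derives Γ (typ t B.partialTy) →
      Derives Γ (eq s.dom t.ker .two) →
      Derives Γ (eq (Tm.inlr s t).proj₁ s A.partialTy)
  | beta_inlr₂ (Γ : List (Ty C)) (s t : Tm) (A B : Ty C) :
      Derives Γ (typ s A.partialTy) → Derives Γ (typ t B.partialTy) →
      Derives Γ (eq s.dom t.ker .two) →
      Derives Γ (eq (Tm.inlr s t).proj₂ t B.partialTy)
  | eta_inlr (Γ : List (Ty C)) (t : Tm) (A B : Ty C) :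
      Derives Γ (typ t (.sum A B)) → Derives Γ (eq (.inlr t.proj₁ t.proj₂) t (.sum A B))
  -- The construction `left`
  | lft (Γ : List (Ty C)) (t : Tm) (A B : Ty C) :
      Derives Γ (typ t (.sum A B)) → Derives Γ (eq t.dom .top .two) →
      Derives Γ (typ (.lft t) A)
  | lft_eq (Γ : List (Ty C)) (t t' : Tm) (A B : Ty C) :
      Derives Γ (eq t t' (.sum A B)) → Derives Γ (eq t.dom .top .two) →
      Derives Γ (eq (.lft t) (.lft t') A)
  | beta_lft (Γ : List (Ty C)) (t : Tm) (A B : Ty C) :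
      Derives Γ (typ t (.sum A B)) → Derives Γ (eq t.dom .top .two) →
      Derives Γ (eq (.inl (.lft t)) t (.sum A B))
  | eta_lft (Γ : List (Ty C)) (t : Tm) (A : Ty C) :
      Derives Γ (typ t A) → Derives Γ (eq (.lft (.inl t)) t A)
  -- Joint monicity
  | joint_mono (Γ : List (Ty C)) (s t : Tm) (A : Ty C) :
      Derives Γ (typ s (Ty.sum A A).partialTy) → Derives Γ (typ t (Ty.sum A A).partialTy) →
      Derives Γ
        (eq (s.doIn (Tm.var 0).proj₁) (t.doIn (Tm.var 0).proj₁) A.partialTy) →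
      Derives Γ
        (eq (s.doIn (Tm.var 0).proj₂) (t.doIn (Tm.var 0).proj₂) A.partialTy) →
      Derives Γ (eq s t (Ty.sum A A).partialTy)
  -- Ordering and partial sum
  | le_intro (Γ : List (Ty C)) (s t b : Tm) (A : Ty C) :
      Derives Γ (typ s A.partialTy) → Derives Γ (typ t A.partialTy) →
      Derives Γ (typ b (Ty.sum A A).partialTy) →
      Derives Γ (eq (b.doIn (Tm.var 0).proj₁) s A.partialTy) →
      Derives Γ (eq (b.doIn (Tm.ret ((Tm.var 0).nabla 2))) t A.partialTy) →
      Derives Γ (le s t A)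
  | psum (Γ : List (Ty C)) (s t b : Tm) (A : Ty C) :
      Derives Γ (typ s A.partialTy) → Derives Γ (typ t A.partialTy) →
      Derives Γ (typ b (Ty.sum A A).partialTy) →
      Derives Γ (eq (b.doIn (Tm.var 0).proj₁) s A.partialTy) →
      Derives Γ (eq (b.doIn (Tm.var 0).proj₂) t A.partialTy) →
      Derives Γ (typ (.psum s t) A.partialTy)
  | psum_def (Γ : List (Ty C)) (s t b : Tm) (A : Ty C) :
      Derives Γ (typ s A.partialTy) → Derives Γ (typ t A.partialTy) →
      Derives Γ (typ b (Ty.sum A A).partialTy) →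
      Derives Γ (eq (b.doIn (Tm.var 0).proj₁) s A.partialTy) →
      Derives Γ (eq (b.doIn (Tm.var 0).proj₂) t A.partialTy) →
      Derives Γ (eq (.psum s t) (b.doIn (Tm.ret ((Tm.var 0).nabla 2))) A.partialTy)
  -- Instruments
  | instr (Γ : List (Ty C)) (n : ℕ) (t s : Tm) (A : Ty C) :
      Derives [A] (typ t (.fin n)) → Derives Γ (typ s A) →
      Derives Γ (typ (.instr t s) (A.copower n))
  | nabla_instr (Γ : List (Ty C)) (n : ℕ) (t s : Tm) (A : Ty C) :
      Derives [A] (typ t (.fin n)) → Derives Γ (typ s A) →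
      Derives Γ (eq ((Tm.instr t s).nabla n) s A)
  | instr_test (Γ : List (Ty C)) (n : ℕ) (t s : Tm) (A : Ty C) :
      Derives [A] (typ t (.fin n)) → Derives Γ (typ s A) →
      Derives Γ (eq ((Tm.instr t s).ind n) (t.inst s) (.fin n))
  | eta_instr (Γ : List (Ty C)) (n : ℕ) (t s : Tm) (A : Ty C) :
      Derives [A] (typ t (A.copower n)) → Derives [A] (eq (t.nabla n) (.var 0) A) →
      Derives Γ (typ s A) →
      Derives Γ (eq (.instr (t.ind n) s) (t.inst s) (A.copower n))
  | instr_eq (Γ : List (Ty C)) (n : ℕ) (t t' s s' : Tm) (A : Ty C) :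
      Derives [A] (eq t t' (.fin n)) → Derives Γ (eq s s' A) →
      Derives Γ (eq (.instr t s) (.instr t' s') (A.copower n))
  | comm (Γ : List (Ty C)) (p q t : Tm) (A : Ty C) :
      Derives [A] (typ p .two) → Derives [A] (typ q .two) → Derives Γ (typ t A) →
      Derives Γ
        (eq ((Tm.assert p t).doIn (Tm.assert q (.var 0)))
          ((Tm.assert q t).doIn (Tm.assert p (.var 0))) A.partialTy)
  -- Scalar constants
  | frac (Γ : List (Ty C)) (n : ℕ) : 2 ≤ n → Derives Γ (typ (.frac n) .two)
  | nsum_frac (Γ : List (Ty C)) (n : ℕ) :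
      2 ≤ n → Derives Γ (eq (Tm.nsum n (.frac n)) .top .two)
  | divide (Γ : List (Ty C)) (n : ℕ) (t : Tm) :
      2 ≤ n → Derives Γ (typ t .two) → Derives Γ (eq (Tm.nsum n t) .top .two) →
      Derives Γ (eq t (.frac n) .two)
  | bound (Γ : List (Ty C)) (m n : ℕ) :
      2 ≤ n → 1 ≤ m → m < n → Derives Γ (typ (.bound m n) (.fin 3))
  | proj₁_bound (Γ : List (Ty C)) (m n : ℕ) :
      2 ≤ n → 1 ≤ m → m < n →
      Derives Γ (eq ((Tm.bound m n).doIn (Tm.var 0).proj₁) (Tm.nsum m (.frac n)) .two)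
  | proj₂_bound (Γ : List (Ty C)) (m n : ℕ) :
      2 ≤ n → 1 ≤ m → m < n →
      Derives Γ (eq ((Tm.bound m n).doIn (Tm.var 0).proj₂) (.frac n) .two)
  -- Normalisation (of closed terms)
  | normal (Γ : List (Ty C)) (n : ℕ) (t : Tm) (A : Ty C) :
      2 ≤ n → Derives [] (typ t A.partialTy) → Derives [] (le (.frac n) t.dom .one) →
      Derives Γ (typ (.normal t) A)
  | beta_normal (Γ : List (Ty C)) (n : ℕ) (t : Tm) (A : Ty C) :
      2 ≤ n → Derives [] (typ t A.partialTy) → Derives [] (le (.frac n) t.dom .one) →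
      Derives Γ (eq (t.doIn (.ret (.normal t))) t A.partialTy)
  | eta_normal (Γ : List (Ty C)) (n : ℕ) (t ρ : Tm) (A : Ty C) :
      2 ≤ n → Derives [] (typ t A.partialTy) → Derives [] (le (.frac n) t.dom .one) →
      Derives Γ (typ ρ A) →
      Derives Γ (eq t (t.doIn (.ret (ρ.shift 0 1))) A.partialTy) →
      Derives Γ (eq ρ (.normal t) A)

/-! ## Discrete semantics -/

/-- Values: a universe that contains the sets `⟦A⟧`.  Elements of the interpretations of type
constants are atoms from a set `α`; `inl a` and `inr b` are the elements `a₁` and `b₂` of a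
disjoint union. -/
inductive Value (α : Type*) where
  | atom (a : α)
  | star
  | pair (a b : Value α)
  | inl (a : Value α)
  | inr (b : Value α)

/-- The set `⟦A⟧`, given the set `⟦c⟧ = I c` for each type constant `c`. -/
def Ty.interp {C α : Type*} (I : C → Set α) : Ty C → Set (Value α)
  | .const c => Value.atom '' I c
  | .zero => ∅
  | .one => {Value.star}
  | .sum A B => Value.inl '' A.interp I ∪ Value.inr '' B.interp I
  | .tensor A B => {v | ∃ a ∈ A.interp I, ∃ b ∈ B.interp I, v = Value.pair a b}

/-- The set `⟦Γ⟧` of tuples of values of the types in `Γ`. -/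
def interpCtx {C α : Type*} (I : C → Set α) (Γ : List (Ty C)) : Set (List (Value α)) :=
  {g | List.Forall₂ (fun v A => v ∈ A.interp I) g Γ}

/-- `Value.tag i a` replaces the leaf `*` of an element `i` of `⟦𝐧⟧` by `a`: the element
`inᵢⁿ *` of `⟦𝐧⟧` and the element `a` of `⟦A⟧` give the copy `inᵢⁿ a` of `a` in `⟦n · A⟧`. -/
def Value.tag {α : Type*} : Value α → Value α → Value α
  | .star, a => a
  | .inl i, a => .inl (Value.tag i a)
  | .inr i, a => .inr (Value.tag i a)
  | .atom x, _ => .atom x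
  | .pair x y, _ => .pair x y

/-- The copies `aᵢ` in `⟦n · A⟧` are pairwise distinct. -/
theorem Value.tag_inj {C α : Type*} (I : C → Set α) (n : ℕ) {i j a b : Value α}
    (hi : i ∈ (Ty.fin n : Ty C).interp I) (hj : j ∈ (Ty.fin n : Ty C).interp I)
    (h : Value.tag i a = Value.tag j b) : i = j ∧ a = b := by
  induction n generalizing i j with
  | zero => simp [Ty.fin, Ty.copower, Ty.interp] at hi
  | succ n ih =>
    cases n with
    | zero =>
      simp only [Ty.fin, Ty.copower, Ty.interp, Set.mem_singleton_iff] at hi hj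
      subst hi; subst hj
      exact ⟨rfl, h⟩
    | succ n =>
      simp only [Ty.fin, Ty.copower, Ty.interp, Set.mem_union, Set.mem_image,
        Set.mem_singleton_iff] at hi hj
      rcases hi with ⟨i', hi', rfl⟩ | ⟨_, rfl, rfl⟩ <;>
        rcases hj with ⟨j', hj', rfl⟩ | ⟨_, rfl, rfl⟩
      · obtain ⟨h1, h2⟩ := ih hi' hj' (by simpa [Value.tag] using h)
        exact ⟨by rw [h1], h2⟩
      · simp [Value.tag] at h
      · simp [Value.tag] at h
      · exact ⟨rfl, by simpa [Value.tag] using h⟩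

open Classical in
/-- `prob t g v` is the probability `P(t(g) = v)` that the term `t` outputs `v` on the input `g`.
The sums run over all values: for a well-typed term the probabilities vanish outside the
interpretation of its type. -/
noncomputable def prob {α : Type*} : Tm → List (Value α) → Value α → ℝ
  | .var i, g, v => if g[i]? = some v then 1 else 0
  | .star, _, v => if v = .star then 1 else 0
  | .pair s t, g, v => match v with
      | .pair a b => prob s g a * prob t g b
      | _ => 0
  | .letPair s t, g, v => ∑ᶠ a, ∑ᶠ b, prob s g (.pair a b) * prob t (b :: a :: g) v
  | .magic _, _, _ => 0
  | .inl t, g, v => match v with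
      | .inl a => prob t g a
      | _ => 0
  | .inr t, g, v => match v with
      | .inr b => prob t g b
      | _ => 0
  | .caseOf r s t, g, v =>
      (∑ᶠ a, prob r g (.inl a) * prob s (a :: g) v) + ∑ᶠ b, prob r g (.inr b) * prob t (b :: g) v
  | .inlr s t, g, v => match v with
      | .inl a => prob s g (.inl a)
      | .inr b => prob t g (.inl b)
      | _ => 0
  | .lft t, g, v => prob t g (.inl v)
  -- the only nonzero term for `v = aᵢ` is `P(s(g) = a) P(t(a) = i)`
  | .instr t s, g, v =>
      ∑ᶠ a, ∑ᶠ i, if Value.tag i a = v then prob s g a * prob t [a] i else 0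
  | .frac n, _, v => match v with
      | .inl .star => 1 / (n : ℝ)
      | .inr .star => ((n : ℝ) - 1) / n
      | _ => 0
  | .bound m n, _, v => match v with
      | .inl (.inl .star) => (m : ℝ) / n
      | .inl (.inr .star) => 1 / (n : ℝ)
      | .inr .star => ((n : ℝ) - m - 1) / n
      | _ => 0
  | .normal t, g, v => prob t g (.inl v) / (1 - prob t g (.inr .star))
  | .psum s t, g, v => match v with
      | .inl a => prob s g (.inl a) + prob t g (.inl a)
      | .inr .star => prob s g (.inr .star) + prob t g (.inr .star) - 1
      | _ => 0

/-- `φ` is a (finitely supported, discrete) probability distribution on the set `S`. -/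
structure IsDistributionOn {X : Type*} (S : Set X) (φ : X → ℝ) : Prop where
  mem_unit : ∀ x, φ x ∈ Set.Icc (0 : ℝ) 1
  support_subset : Function.support φ ⊆ S
  support_finite : (Function.support φ).Finite
  sum_eq_one : ∑ᶠ x, φ x = 1

end COMET

/-!
# Soundness of the discrete semantics of COMET

The weights `prob t g` of a term are studied through the functional
`F ↦ ∑ v, prob t g v * F v`, called `expect (prob t g) F`.  Every raw term has finitely many values
of nonzero weight on every input (`support_prob_finite`), so these functionals are linear in `F`
and commute with one another, without any typing.  In this form the clauses of the semantics read
as in a monad: the value of `let x ⊗ y = s in t` at `F` is the expectation, over the values `(a, b)`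
of `s`, of the value of `t` at `F` on the input extended by `a` and `b`.  The commuting
conversions then hold by unfolding, and the rules for `⟪s, t⟫`, `left`, partial sums, instruments
and normalisation become short computations with linear functionals.  Being a distribution on `S`
means to be normalised, and nonnegative on the functions that are nonnegative on `S`
(`isDistributionOn_of_expect`).

The `β`-rules need a substitution lemma: running `t[x := r]` amounts to sampling a value `a` of `r`
and running `t` with `x` bound to `a` (`expect_subst`).  This fails when `x` is used twice, since
`r` would then be sampled twice, and it fails below `norm`, which is not linear in the weights.
Derivable terms are therefore shown to be linear (`Tm.Linear`) along with the soundness claims: the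
subterms that run one after the other share no variables, and normalised terms are closed.  The
components of `⟪s, t⟫` and `s ⊻ t` may share variables, because the probability of each outcome is
an affine function of the probabilities for the components.

The induction over derivations (`Derives.valid`) proves a statement stronger than the claim
(`Judgement.Valid`).  It bounds the free variables of a term by the context, which gives weakening,
and it makes both sides of an equation distributions, so that functions
which agree on `⟦A⟧` have the same expectation.  The judgement `s ≤ t` is read as an inequality
between the probabilities of each returned value; it keeps the divisor in `norm t` away from zero.
-/

namespace COMET

/-! ### Expectations of finitely supported weights -/

/-- The expectation `∑ v, φ v * F v` of `F` under the weights `φ`.  It is the intended sum when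
`φ` has finite support. -/
noncomputable def expect {X : Type*} (φ F : X → ℝ) : ℝ := ∑ᶠ v, φ v * F v

open Classical in
/-- The weights of the point mass at `a`. -/
noncomputable def dirac {X : Type*} (a v : X) : ℝ := if a = v then 1 else 0

section Expect

variable {X Y : Type*} {φ ψ : X → ℝ}

theorem expect_eq_sum_of_subset {s : Finset X} (h : Function.support φ ⊆ s) (F : X → ℝ) :
    expect φ F = ∑ v ∈ s, φ v * F v :=
  finsum_eq_sum_of_support_subset _ fun v hv => h fun h0 => hv (by simp [h0])

theorem expect_eq_sum (h : (Function.support φ).Finite) (F : X → ℝ) :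
    expect φ F = ∑ v ∈ h.toFinset, φ v * F v :=
  expect_eq_sum_of_subset (by simp) F

theorem expect_congr {F G : X → ℝ} (h : ∀ x, φ x ≠ 0 → F x = G x) : expect φ F = expect φ G := by
  refine finsum_congr fun x => ?_
  by_cases hx : φ x = 0
  · simp [hx]
  · rw [h x hx]

@[simp] theorem expect_zero : expect φ (fun _ => 0) = 0 := by simp [expect]

@[simp] theorem expect_zero_left (F : X → ℝ) : expect (fun _ => 0) F = 0 := by simp [expect]

theorem expect_add (h : (Function.support φ).Finite) (F G : X → ℝ) :
    expect φ (fun x => F x + G x) = expect φ F + expect φ G := by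
  simp only [expect_eq_sum h, mul_add, Finset.sum_add_distrib]

theorem expect_const_mul (h : (Function.support φ).Finite) (c : ℝ) (F : X → ℝ) :
    expect φ (fun x => c * F x) = c * expect φ F := by
  simp only [expect_eq_sum h, Finset.mul_sum]
  exact Finset.sum_congr rfl fun _ _ => by ring

theorem expect_mul_const (h : (Function.support φ).Finite) (c : ℝ) (F : X → ℝ) :
    expect φ (fun x => F x * c) = expect φ F * c := by
  simp only [mul_comm _ c, expect_const_mul h]

theorem expect_const (h : (Function.support φ).Finite) (c : ℝ) :
    expect φ (fun _ => c) = expect φ (fun _ => 1) * c := by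
  simpa using expect_mul_const h c fun _ => 1

theorem expect_comm {χ : Y → ℝ} (hφ : (Function.support φ).Finite)
    (hχ : (Function.support χ).Finite) (F : X → Y → ℝ) :
    expect φ (fun x => expect χ fun y => F x y) = expect χ fun y => expect φ fun x => F x y := by
  simp only [expect_eq_sum hφ, expect_eq_sum hχ, Finset.mul_sum]
  rw [Finset.sum_comm]
  exact Finset.sum_congr rfl fun _ _ => Finset.sum_congr rfl fun _ _ => by ring

theorem expect_add_left (hφ : (Function.support φ).Finite) (hψ : (Function.support ψ).Finite)
    (F : X → ℝ) : expect (fun x => φ x + ψ x) F = expect φ F + expect ψ F := by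
  classical
  have h1 : Function.support φ ⊆ ↑(hφ.toFinset ∪ hψ.toFinset) := fun x hx => by simp_all
  have h2 : Function.support ψ ⊆ ↑(hφ.toFinset ∪ hψ.toFinset) := fun x hx => by simp_all
  rw [expect_eq_sum_of_subset h1, expect_eq_sum_of_subset h2,
    expect_eq_sum_of_subset ((Function.support_add φ ψ).trans (Set.union_subset h1 h2)),
    ← Finset.sum_add_distrib]
  exact Finset.sum_congr rfl fun _ _ => by ring

theorem expect_const_mul_left (h : (Function.support φ).Finite) (c : ℝ) (F : X → ℝ) :
    expect (fun x => c * φ x) F = c * expect φ F := by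
  rw [← expect_const_mul h]
  exact finsum_congr fun _ => by ring

@[simp] theorem dirac_self (a : X) : dirac a a = 1 := by simp [dirac]

theorem dirac_of_ne {a b : X} (h : a ≠ b) : dirac a b = 0 := by simp [dirac, h]

theorem dirac_map {f : X → Y} (hf : Function.Injective f) (a b : X) :
    dirac (f a) (f b) = dirac a b := by
  by_cases h : a = b
  · simp [h]
  · rw [dirac_of_ne h, dirac_of_ne (hf.ne h)]

theorem support_dirac_finite (a : X) : (Function.support (dirac a)).Finite :=
  (Set.finite_singleton a).subset fun v hv => by
    by_contra h
    exact hv (if_neg fun h' => h h'.symm)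

@[simp] theorem expect_dirac (a : X) (F : X → ℝ) : expect (dirac a) F = F a := by
  rw [expect, finsum_eq_single _ a]
  · simp [dirac]
  · intro x hx
    simp [dirac, hx.symm]

/-- Weights are recovered from expectations. -/
theorem expect_dirac_right (φ : X → ℝ) (v : X) : expect φ (fun x => dirac x v) = φ v := by
  rw [expect, finsum_eq_single _ v]
  · simp [dirac]
  · intro x hx
    simp [dirac, hx]

theorem eq_of_expect_eq (h : ∀ F, expect φ F = expect ψ F) : φ = ψ := by
  funext v
  rw [← expect_dirac_right φ, ← expect_dirac_right ψ, h]

theorem support_expect_subset (q : X → Y → ℝ) :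
    (Function.support fun v => expect φ fun x => q x v) ⊆
      ⋃ x ∈ Function.support φ, Function.support (q x) := fun v hv => by
  by_contra h
  refine hv (Eq.trans (expect_congr (G := fun _ => 0) fun x hx => ?_) expect_zero)
  by_contra h'
  exact h (Set.mem_biUnion (Function.mem_support.2 hx) h')

theorem support_expect_finite {q : X → Y → ℝ} (hφ : (Function.support φ).Finite)
    (hq : ∀ x, (Function.support (q x)).Finite) :
    (Function.support fun v => expect φ fun x => q x v).Finite := by
  exact (hφ.biUnion fun x _ => hq x).subset (support_expect_subset q)

/-- The expectation under a mixture is the iterated expectation. -/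
theorem expect_expect {q : X → Y → ℝ} (hφ : (Function.support φ).Finite)
    (hq : ∀ x, (Function.support (q x)).Finite) (F : Y → ℝ) :
    expect (fun v => expect φ fun x => q x v) F = expect φ fun x => expect (q x) F := by
  have hU := hφ.biUnion fun x _ => hq x
  have h : ∀ x ∈ hφ.toFinset, expect (q x) F = ∑ v ∈ hU.toFinset, q x v * F v := fun x hx => by
    refine expect_eq_sum_of_subset ?_ F
    rw [Set.Finite.coe_toFinset]
    exact Set.subset_biUnion_of_mem (u := fun x => Function.support (q x)) (by simpa using hx)
  have hsub : (Function.support fun v => expect φ fun x => q x v) ⊆ hU.toFinset := by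
    simpa using support_expect_subset q
  have hr : (expect φ fun x => expect (q x) F) =
      ∑ x ∈ hφ.toFinset, φ x * ∑ v ∈ hU.toFinset, q x v * F v := by
    rw [expect_eq_sum hφ]
    exact Finset.sum_congr rfl fun x hx => by rw [h x hx]
  rw [expect_eq_sum_of_subset hsub, hr]
  simp only [expect_eq_sum hφ, Finset.sum_mul, Finset.mul_sum]
  rw [Finset.sum_comm]
  exact Finset.sum_congr rfl fun _ _ => Finset.sum_congr rfl fun _ _ => by ring

theorem finsum_eq_finsum_comp {e : Y → X} (he : Function.Injective e) (f : X → ℝ)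
    (hf : ∀ x, x ∉ Set.range e → f x = 0) : ∑ᶠ x, f x = ∑ᶠ y, f (e y) := by
  rw [← finsum_mem_range he, ← finsum_mem_univ]
  refine finsum_mem_inter_support_eq' _ _ _ fun x hx => ?_
  simp only [Set.mem_univ, true_iff]
  by_contra h
  exact hx (hf x h)

end Expect

/-! ### Case analysis on values -/

section Values

variable {α : Type*}

theorem Value.inl_injective : Function.Injective (Value.inl (α := α)) := fun a b h => by
  simpa using h

theorem Value.inr_injective : Function.Injective (Value.inr (α := α)) := fun a b h => by
  simpa using h

/-- The function on values that is `f` on pairs and vanishes elsewhere. -/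
def onPair (f : Value α → Value α → ℝ) : Value α → ℝ
  | .pair a b => f a b
  | _ => 0

/-- The function on values that is `f` on left summands, `h` on right summands and vanishes
elsewhere. -/
def onSum (f h : Value α → ℝ) : Value α → ℝ
  | .inl a => f a
  | .inr b => h b
  | _ => 0

@[simp] theorem onPair_pair (f : Value α → Value α → ℝ) (a b : Value α) :
    onPair f (.pair a b) = f a b := rfl
@[simp] theorem onSum_inl (f h : Value α → ℝ) (a : Value α) : onSum f h (.inl a) = f a := rfl
@[simp] theorem onSum_inr (f h : Value α → ℝ) (a : Value α) : onSum f h (.inr a) = h a := rfl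

theorem onSum_zero : onSum (fun _ : Value α => 0) (fun _ => 0) = fun _ => 0 := by
  funext v; cases v <;> rfl

theorem onSum_add (f f' h h' : Value α → ℝ) :
    onSum (fun a => f a + f' a) (fun b => h b + h' b) = fun v => onSum f h v + onSum f' h' v := by
  funext v; cases v <;> simp [onSum]

theorem onSum_const_mul (c : ℝ) (f h : Value α → ℝ) :
    onSum (fun a => c * f a) (fun b => c * h b) = fun v => c * onSum f h v := by
  funext v; cases v <;> simp [onSum]

variable {φ : Value α → ℝ}

theorem expect_onPair (hφ : (Function.support φ).Finite) (f : Value α → Value α → ℝ) :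
    expect φ (onPair f) = ∑ᶠ a, ∑ᶠ b, φ (.pair a b) * f a b := by
  have he : Function.Injective fun p : Value α × Value α => Value.pair p.1 p.2 := by
    rintro ⟨a, b⟩ ⟨a', b'⟩ h
    simpa using h
  have hfin : (Function.support fun p : Value α × Value α =>
      φ (.pair p.1 p.2) * f p.1 p.2).Finite :=
    (hφ.preimage he.injOn).subset fun p hp h0 => hp (by simp [h0])
  rw [← finsum_curry (fun p : Value α × Value α => φ (.pair p.1 p.2) * f p.1 p.2) hfin, expect,
    finsum_eq_finsum_comp he]
  · rfl
  · intro x hx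
    cases x <;> simp [onPair] at hx ⊢

theorem expect_onSum (hφ : (Function.support φ).Finite) (f h : Value α → ℝ) :
    expect φ (onSum f h) = (∑ᶠ a, φ (.inl a) * f a) + ∑ᶠ b, φ (.inr b) * h b := by
  have h1 : onSum f h = fun v => onSum f (fun _ => 0) v + onSum (fun _ => 0) h v := by
    rw [← onSum_add]; simp
  rw [h1, expect_add hφ]
  congr 1
  · rw [expect, finsum_eq_finsum_comp Value.inl_injective]
    · rfl
    · intro x hx
      cases x <;> simp [onSum] at hx ⊢
  · rw [expect, finsum_eq_finsum_comp Value.inr_injective]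
    · rfl
    · intro x hx
      cases x <;> simp [onSum] at hx ⊢

end Values

/-! ### Probabilities of compound terms as mixtures -/

section Mixtures

variable {α : Type*}

theorem support_onPair_finite {q : Value α → Value α → Value α → ℝ}
    (hq : ∀ a b, (Function.support (q a b)).Finite) (x : Value α) :
    (Function.support fun v => onPair (fun a b => q a b v) x).Finite := by
  cases x <;> first | exact hq _ _ | simp [onPair]

theorem support_onSum_finite {p q : Value α → Value α → ℝ}
    (hp : ∀ a, (Function.support (p a)).Finite) (hq : ∀ a, (Function.support (q a)).Finite)
    (x : Value α) :
    (Function.support fun v => onSum (fun a => p a v) (fun b => q b v) x).Finite := by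
  cases x <;> first | exact hp _ | exact hq _ | simp [onSum]

theorem expect_onPair_weights (q : Value α → Value α → Value α → ℝ) (x : Value α)
    (F : Value α → ℝ) :
    expect (fun v => onPair (fun a b => q a b v) x) F = onPair (fun a b => expect (q a b) F) x := by
  cases x <;> simp [onPair, expect]

theorem expect_onSum_weights (p q : Value α → Value α → ℝ) (x : Value α) (F : Value α → ℝ) :
    expect (fun v => onSum (fun a => p a v) (fun b => q b v) x) F =
      onSum (fun a => expect (p a) F) (fun b => expect (q b) F) x := by
  cases x <;> simp [onSum, expect]

theorem prob_var (i : ℕ) (g : List (Value α)) :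
    prob (.var i) g = (g[i]?).elim (fun _ => 0) dirac := by
  funext v
  rw [prob]
  cases g[i]? with
  | none => simp
  | some w =>
    by_cases h : w = v
    · simp [h]
    · simp [h, dirac_of_ne h]

theorem prob_star (g : List (Value α)) : prob .star g = dirac .star := by
  funext v
  by_cases h : v = .star
  · simp [prob, h]
  · simp [prob, h, dirac_of_ne (Ne.symm h)]

theorem prob_magic (t : Tm) (g : List (Value α)) : prob (.magic t) g = fun _ => 0 := rfl

theorem prob_pair (s t : Tm) (g : List (Value α)) (hs : (Function.support (prob s g)).Finite) :
    prob (.pair s t) g = fun v =>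
      expect (prob s g) fun a => expect (prob t g) fun b => dirac (Value.pair a b) v := by
  funext v
  cases v with
  | pair a b =>
    have h : ∀ a', expect (prob t g) (fun b' => dirac (Value.pair a' b') (Value.pair a b)) =
        dirac a' a * prob t g b := fun a' => by
      by_cases h1 : a' = a
      · subst h1
        rw [dirac_self, one_mul, ← expect_dirac_right (prob t g) b]
        exact congrArg _ (funext fun b' =>
          dirac_map (f := Value.pair a') (fun _ _ h => by simpa using h) _ _)
      · simp [dirac, h1]
    simp only [h]
    rw [prob, expect_mul_const hs, expect_dirac_right]
  | _ => simp [prob, dirac]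

theorem prob_letPair (s t : Tm) (g : List (Value α)) (hs : (Function.support (prob s g)).Finite) :
    prob (.letPair s t) g = fun v =>
      expect (prob s g) fun x => onPair (fun a b => prob t (b :: a :: g) v) x := by
  funext v
  exact (expect_onPair hs _).symm

theorem prob_inl (t : Tm) (g : List (Value α)) :
    prob (.inl t) g = fun v => expect (prob t g) fun a => dirac (.inl a) v := by
  funext v
  cases v with
  | inl a =>
    rw [prob, ← expect_dirac_right (prob t g) a]
    exact expect_congr fun x _ => (dirac_map Value.inl_injective x a).symm
  | _ => simp [prob, dirac]

theorem prob_inr (t : Tm) (g : List (Value α)) :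
    prob (.inr t) g = fun v => expect (prob t g) fun a => dirac (.inr a) v := by
  funext v
  cases v with
  | inr a =>
    rw [prob, ← expect_dirac_right (prob t g) a]
    exact expect_congr fun x _ => (dirac_map Value.inr_injective x a).symm
  | _ => simp [prob, dirac]

/-- The two sums in the semantics of `case` are the two parts of one sum over the values of the
scrutinee. -/
theorem prob_caseOf (r s t : Tm) (g : List (Value α))
    (hr : (Function.support (prob r g)).Finite) :
    prob (.caseOf r s t) g = fun v => expect (prob r g) fun x =>
      onSum (fun a => prob s (a :: g) v) (fun b => prob t (b :: g) v) x := by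
  funext v
  exact (expect_onSum hr _ _).symm

theorem prob_lft (t : Tm) (g : List (Value α)) :
    prob (.lft t) g = fun v =>
      expect (prob t g) fun x => onSum (fun a => dirac a v) (fun _ => 0) x := by
  funext v
  rw [prob, ← expect_dirac_right (prob t g)]
  refine expect_congr fun x _ => ?_
  cases x with
  | inl a => exact dirac_map Value.inl_injective a v
  | _ => exact dirac_of_ne (by simp)

/-- The mixture that keeps the left part of the weights `φ` and drops the right part. -/
theorem expect_onSum_dirac_inl (φ : Value α → ℝ) (a : Value α) :
    expect φ (fun x => onSum (fun b => dirac (Value.inl b) (Value.inl a)) (fun _ => 0) x) =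
      φ (.inl a) := by
  rw [← expect_dirac_right φ]
  exact expect_congr fun x _ => by cases x <;> simp [onSum, dirac_of_ne]

theorem prob_inlr (s t : Tm) (g : List (Value α)) :
    prob (.inlr s t) g = fun v =>
      (expect (prob s g) fun x => onSum (fun a => dirac (.inl a) v) (fun _ => 0) x) +
        expect (prob t g) fun x => onSum (fun b => dirac (.inr b) v) (fun _ => 0) x := by
  have h0 : ∀ x : Value α, onSum (fun _ => 0) (fun _ => 0) x = 0 := congrFun onSum_zero
  funext v
  cases v with
  | inl a => simp [prob, dirac_of_ne, h0, expect_onSum_dirac_inl]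
  | inr a =>
    simp only [prob, dirac_of_ne, ne_eq, reduceCtorEq, not_false_eq_true, h0, expect_zero, zero_add]
    rw [← expect_onSum_dirac_inl (prob t g)]
    simp only [dirac_map Value.inl_injective, dirac_map Value.inr_injective]
  | _ => simp [prob, dirac, h0]

theorem prob_instr (t s : Tm) (g : List (Value α))
    (ht : ∀ a : Value α, (Function.support (prob t [a])).Finite) :
    prob (.instr t s) g = fun v =>
      expect (prob s g) fun a => expect (prob t [a]) fun i => dirac (Value.tag i a) v := by
  funext v
  rw [prob]
  refine finsum_congr fun a => ?_
  rw [← expect_const_mul (ht a) (prob s g a)]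
  refine finsum_congr fun i => ?_
  by_cases h : Value.tag i a = v <;> simp [dirac, h, mul_comm]

theorem prob_frac (n : ℕ) (g : List (Value α)) :
    prob (.frac n) g = fun v =>
      1 / (n : ℝ) * dirac (.inl .star) v + ((n : ℝ) - 1) / n * dirac (.inr .star) v := by
  funext v
  rcases v with _ | _ | _ | x | x
  case inl | inr => cases x <;> simp [prob, dirac]
  all_goals simp [prob, dirac]

theorem prob_bound (m n : ℕ) (g : List (Value α)) :
    prob (.bound m n) g = fun v =>
      (m : ℝ) / n * dirac (.inl (.inl .star)) v + (1 / (n : ℝ) * dirac (.inl (.inr .star)) v +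
        ((n : ℝ) - m - 1) / n * dirac (.inr .star) v) := by
  funext v
  rcases v with _ | _ | _ | x | x
  case inl =>
    rcases x with _ | _ | _ | x | x
    case inl | inr => cases x <;> simp [prob, dirac]
    all_goals simp [prob, dirac]
  case inr => cases x <;> simp [prob, dirac]
  all_goals simp [prob, dirac]

/-- If the divisor is zero, both sides vanish by the conventions for `/` and `⁻¹`. -/
theorem prob_normal (t : Tm) (g : List (Value α)) :
    prob (.normal t) g = fun v => (1 - prob t g (.inr .star))⁻¹ *
      expect (prob t g) fun x => onSum (fun a => dirac a v) (fun _ => 0) x := by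
  funext v
  rw [prob, div_eq_inv_mul]
  congr 1
  exact congrFun (prob_lft t g) v

theorem prob_psum (s t : Tm) (g : List (Value α)) :
    prob (.psum s t) g = fun v =>
      (expect (prob s g) fun x => onSum (fun a => dirac (.inl a) v) (fun _ => 0) x) +
        ((expect (prob t g) fun x => onSum (fun a => dirac (.inl a) v) (fun _ => 0) x) +
          (prob s g (.inr .star) + prob t g (.inr .star) - 1) * dirac (.inr .star) v) := by
  have h0 : ∀ x : Value α, onSum (fun _ => 0) (fun _ => 0) x = 0 := congrFun onSum_zero
  funext v
  cases v with
  | inl a =>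
    simp only [prob, expect_onSum_dirac_inl, dirac_of_ne, ne_eq, reduceCtorEq, not_false_eq_true,
      mul_zero, add_zero]
  | inr a => cases a <;> simp [prob, dirac, h0]
  | _ => simp [prob, dirac, h0]

theorem support_add_finite {φ ψ : Value α → ℝ} (hφ : (Function.support φ).Finite)
    (hψ : (Function.support ψ).Finite) : (Function.support fun v => φ v + ψ v).Finite :=
  (hφ.union hψ).subset (Function.support_add φ ψ)

theorem support_const_mul_finite {φ : Value α → ℝ} (c : ℝ) (hφ : (Function.support φ).Finite) :
    (Function.support fun v => c * φ v).Finite :=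
  hφ.subset fun v hv h0 => hv (by simp [h0])

theorem support_zero_finite : (Function.support fun _ : Value α => (0 : ℝ)).Finite := by simp

/-- Every raw term, on every input, has only finitely many values of nonzero weight. -/
theorem support_prob_finite (t : Tm) (g : List (Value α)) :
    (Function.support (prob t g)).Finite := by
  induction t generalizing g with
  | var i =>
    rw [prob_var]
    cases g[i]? with
    | none => exact support_zero_finite
    | some v => exact support_dirac_finite v
  | star => rw [prob_star]; exact support_dirac_finite _
  | pair s t hs ht =>
    rw [prob_pair s t g (hs g)]
    exact support_expect_finite (hs g) fun a =>
      support_expect_finite (ht g) fun b => support_dirac_finite _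
  | letPair s t hs ht =>
    rw [prob_letPair s t g (hs g)]
    exact support_expect_finite (hs g) (support_onPair_finite fun a b => ht _)
  | magic t _ => exact support_zero_finite
  | inl t ht =>
    rw [prob_inl]
    exact support_expect_finite (ht g) fun a => support_dirac_finite _
  | inr t ht =>
    rw [prob_inr]
    exact support_expect_finite (ht g) fun a => support_dirac_finite _
  | caseOf r s t hr hs ht =>
    rw [prob_caseOf r s t g (hr g)]
    exact support_expect_finite (hr g) (support_onSum_finite (fun a => hs _) fun b => ht _)
  | inlr s t hs ht =>
    rw [prob_inlr]
    exact support_add_finite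
      (support_expect_finite (hs g) (support_onSum_finite (fun a => support_dirac_finite _)
        fun _ => support_zero_finite))
      (support_expect_finite (ht g) (support_onSum_finite (fun a => support_dirac_finite _)
        fun _ => support_zero_finite))
  | lft t ht =>
    rw [prob_lft]
    exact support_expect_finite (ht g) (support_onSum_finite (fun a => support_dirac_finite _)
      fun _ => support_zero_finite)
  | instr t s ht hs =>
    rw [prob_instr t s g fun a => ht _]
    exact support_expect_finite (hs g) fun a =>
      support_expect_finite (ht _) fun i => support_dirac_finite _
  | frac n =>
    rw [prob_frac]
    exact support_add_finite (support_const_mul_finite _ (support_dirac_finite _))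
      (support_const_mul_finite _ (support_dirac_finite _))
  | bound m n =>
    rw [prob_bound]
    exact support_add_finite (support_const_mul_finite _ (support_dirac_finite _))
      (support_add_finite (support_const_mul_finite _ (support_dirac_finite _))
        (support_const_mul_finite _ (support_dirac_finite _)))
  | normal t ht =>
    rw [prob_normal]
    exact support_const_mul_finite _ (support_expect_finite (ht g)
      (support_onSum_finite (fun a => support_dirac_finite _) fun _ => support_zero_finite))
  | psum s t hs ht =>
    rw [prob_psum]
    exact support_add_finite
      (support_expect_finite (hs g) (support_onSum_finite (fun a => support_dirac_finite _)
        fun _ => support_zero_finite))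
      (support_add_finite
        (support_expect_finite (ht g) (support_onSum_finite (fun a => support_dirac_finite _)
          fun _ => support_zero_finite))
        (support_const_mul_finite _ (support_dirac_finite _)))

end Mixtures

/-! ### Expectations under the semantics of compound terms -/

section Expectations

variable {α : Type*} (g : List (Value α)) (F : Value α → ℝ)

theorem expect_prob_of_getElem? {i : ℕ} {a : Value α} (h : g[i]? = some a) :
    expect (prob (.var i) g) F = F a := by
  rw [prob_var, h]; simp

@[simp] theorem expect_prob_var_zero (a : Value α) :
    expect (prob (.var 0) (a :: g)) F = F a := expect_prob_of_getElem? _ _ rfl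

@[simp] theorem expect_prob_var_one (a b : Value α) :
    expect (prob (.var 1) (b :: a :: g)) F = F a := expect_prob_of_getElem? _ _ rfl

@[simp] theorem expect_prob_star : expect (prob .star g) F = F .star := by
  rw [prob_star]; simp

@[simp] theorem expect_prob_pair (s t : Tm) :
    expect (prob (.pair s t) g) F =
      expect (prob s g) fun a => expect (prob t g) fun b => F (.pair a b) := by
  rw [prob_pair _ _ _ (support_prob_finite s g), expect_expect (support_prob_finite s g) fun a =>
    support_expect_finite (support_prob_finite t g) fun b => support_dirac_finite _]
  refine congrArg _ (funext fun a => ?_)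
  rw [expect_expect (support_prob_finite t g) fun b => support_dirac_finite _]
  simp

@[simp] theorem expect_prob_letPair (s t : Tm) :
    expect (prob (.letPair s t) g) F =
      expect (prob s g) (onPair fun a b => expect (prob t (b :: a :: g)) F) := by
  rw [prob_letPair _ _ _ (support_prob_finite s g), expect_expect (support_prob_finite s g)
    (support_onPair_finite fun a b => support_prob_finite _ _)]
  exact congrArg _ (funext fun x => expect_onPair_weights _ _ _)

@[simp] theorem expect_prob_magic (t : Tm) : expect (prob (.magic t) g) F = 0 := by
  simp [prob_magic, expect]

@[simp] theorem expect_prob_inl (t : Tm) :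
    expect (prob (.inl t) g) F = expect (prob t g) fun a => F (.inl a) := by
  rw [prob_inl, expect_expect (support_prob_finite t g) fun b => support_dirac_finite _]
  simp

@[simp] theorem expect_prob_inr (t : Tm) :
    expect (prob (.inr t) g) F = expect (prob t g) fun a => F (.inr a) := by
  rw [prob_inr, expect_expect (support_prob_finite t g) fun b => support_dirac_finite _]
  simp

@[simp] theorem expect_prob_caseOf (r s t : Tm) :
    expect (prob (.caseOf r s t) g) F = expect (prob r g)
      (onSum (fun a => expect (prob s (a :: g)) F) fun b => expect (prob t (b :: g)) F) := by
  rw [prob_caseOf _ _ _ _ (support_prob_finite r g), expect_expect (support_prob_finite r g)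
    (support_onSum_finite (fun a => support_prob_finite _ _) fun a => support_prob_finite _ _)]
  exact congrArg _ (funext fun x => expect_onSum_weights _ _ _ _)

theorem expect_expect_onSum_dirac (t : Tm) (f : Value α → Value α) :
    expect (fun v => expect (prob t g) fun x => onSum (fun a => dirac (f a) v) (fun _ => 0) x) F =
      expect (prob t g) (onSum (fun a => F (f a)) fun _ => 0) := by
  rw [expect_expect (support_prob_finite t g) (support_onSum_finite
    (fun a => support_dirac_finite _) fun _ => support_zero_finite)]
  refine congrArg _ (funext fun x => ?_)
  rw [expect_onSum_weights]
  simp only [expect_dirac, expect_zero_left]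

theorem support_expect_onSum_dirac_finite (t : Tm) (f : Value α → Value α) :
    (Function.support fun v => expect (prob t g) fun x =>
      onSum (fun a => dirac (f a) v) (fun _ => 0) x).Finite :=
  support_expect_finite (support_prob_finite t g) (support_onSum_finite
    (fun _ => support_dirac_finite _) fun _ => support_zero_finite)

@[simp] theorem expect_prob_lft (t : Tm) :
    expect (prob (.lft t) g) F = expect (prob t g) (onSum F fun _ => 0) := by
  rw [prob_lft]
  exact expect_expect_onSum_dirac g F t id

@[simp] theorem expect_prob_inlr (s t : Tm) :
    expect (prob (.inlr s t) g) F =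
      expect (prob s g) (onSum (fun a => F (.inl a)) fun _ => 0) +
        expect (prob t g) (onSum (fun b => F (.inr b)) fun _ => 0) := by
  rw [prob_inlr, expect_add_left (support_expect_onSum_dirac_finite ..)
    (support_expect_onSum_dirac_finite ..), expect_expect_onSum_dirac, expect_expect_onSum_dirac]

@[simp] theorem expect_prob_instr (t s : Tm) :
    expect (prob (.instr t s) g) F =
      expect (prob s g) fun a => expect (prob t [a]) fun i => F (Value.tag i a) := by
  rw [prob_instr _ _ _ fun _ => support_prob_finite _ _, expect_expect (support_prob_finite s g)
    fun _ => support_expect_finite (support_prob_finite t _) fun b => support_dirac_finite _]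
  refine congrArg _ (funext fun a => ?_)
  rw [expect_expect (support_prob_finite t _) fun b => support_dirac_finite _]
  simp

@[simp] theorem expect_prob_frac (n : ℕ) :
    expect (prob (.frac n) g) F =
      1 / (n : ℝ) * F (.inl .star) + ((n : ℝ) - 1) / n * F (.inr .star) := by
  rw [prob_frac, expect_add_left (support_const_mul_finite _ (support_dirac_finite _))
    (support_const_mul_finite _ (support_dirac_finite _)),
    expect_const_mul_left (support_dirac_finite _),
    expect_const_mul_left (support_dirac_finite _), expect_dirac, expect_dirac]

@[simp] theorem expect_prob_bound (m n : ℕ) :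
    expect (prob (.bound m n) g) F =
      (m : ℝ) / n * F (.inl (.inl .star)) + (1 / (n : ℝ) * F (.inl (.inr .star)) +
        ((n : ℝ) - m - 1) / n * F (.inr .star)) := by
  have h : ∀ (c : ℝ) (v : Value α), (Function.support fun x => c * dirac v x).Finite :=
    fun c v => support_const_mul_finite _ (support_dirac_finite _)
  rw [prob_bound, expect_add_left (h _ _) (support_add_finite (h _ _) (h _ _)),
    expect_add_left (h _ _) (h _ _)]
  simp only [expect_const_mul_left (support_dirac_finite _), expect_dirac]

@[simp] theorem expect_prob_normal (t : Tm) :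
    expect (prob (.normal t) g) F =
      (1 - prob t g (.inr .star))⁻¹ * expect (prob t g) (onSum F fun _ => 0) := by
  rw [prob_normal]
  exact (expect_const_mul_left (support_expect_onSum_dirac_finite g t id) _ F).trans
    (congrArg _ (expect_expect_onSum_dirac g F t id))

@[simp] theorem expect_prob_psum (s t : Tm) :
    expect (prob (.psum s t) g) F =
      expect (prob s g) (onSum (fun a => F (.inl a)) fun _ => 0) +
        (expect (prob t g) (onSum (fun a => F (.inl a)) fun _ => 0) +
          (prob s g (.inr .star) + prob t g (.inr .star) - 1) * F (.inr .star)) := by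
  have h := support_const_mul_finite (prob s g (.inr .star) + prob t g (.inr .star) - 1)
    (support_dirac_finite (Value.inr Value.star : Value α))
  rw [prob_psum, expect_add_left (support_expect_onSum_dirac_finite ..)
    (support_add_finite (support_expect_onSum_dirac_finite ..) h),
    expect_add_left (support_expect_onSum_dirac_finite ..) h,
    expect_expect_onSum_dirac, expect_expect_onSum_dirac,
    expect_const_mul_left (support_dirac_finite _), expect_dirac]

end Expectations

/-! ### Free variables and linearity -/

/-- The variable of index `i` occurs free in the term. -/
def Tm.Free : Tm → ℕ → Prop
  | .var j, i => i = j
  | .star, _ => False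
  | .pair s t, i => s.Free i ∨ t.Free i
  | .letPair s t, i => s.Free i ∨ t.Free (i + 2)
  | .magic t, i => t.Free i
  | .inl t, i => t.Free i
  | .inr t, i => t.Free i
  | .caseOf r s t, i => r.Free i ∨ s.Free (i + 1) ∨ t.Free (i + 1)
  | .inlr s t, i => s.Free i ∨ t.Free i
  | .lft t, i => t.Free i
  | .instr t s, i => t.Free (i + 1) ∨ s.Free i
  | .frac _, _ => False
  | .bound _ _, _ => False
  | .normal t, i => t.Free i
  | .psum s t, i => s.Free i ∨ t.Free i

/-- All free variables of the term have index less than `n`, the length of a context. -/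
def Tm.Scoped (t : Tm) (n : ℕ) : Prop := ∀ i, t.Free i → i < n

/-- A term is linear if the subterms that run one after the other share no variables, the test of
an instrument has no free variable but its argument, and normalised terms are closed.  The
alternatives of a `case`, and the two components of `⟪s, t⟫` and of `s ⊻ t`, may share
variables. -/
def Tm.Linear : Tm → Prop
  | .var _ => True
  | .star => True
  | .pair s t => s.Linear ∧ t.Linear ∧ ∀ i, s.Free i → ¬ t.Free i
  | .letPair s t => s.Linear ∧ t.Linear ∧ ∀ i, s.Free i → ¬ t.Free (i + 2)
  | .magic t => t.Linear
  | .inl t => t.Linear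
  | .inr t => t.Linear
  | .caseOf r s t => r.Linear ∧ s.Linear ∧ t.Linear ∧
      ∀ i, r.Free i → ¬ s.Free (i + 1) ∧ ¬ t.Free (i + 1)
  | .inlr s t => s.Linear ∧ t.Linear
  | .lft t => t.Linear
  | .instr t s => t.Linear ∧ s.Linear ∧ t.Scoped 1
  | .frac _ => True
  | .bound _ _ => True
  | .normal t => t.Linear ∧ t.Scoped 0
  | .psum s t => s.Linear ∧ t.Linear

theorem exists_free_of_free_lift {P Q : ℕ → Prop} {f : ℕ → ℕ}
    (h : ∀ j, P j → ∃ i, Q i ∧ liftRen f i = j) (j : ℕ) (hj : P (j + 1)) :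
    ∃ i, Q (i + 1) ∧ f i = j := by
  obtain ⟨i, hi, hij⟩ := h _ hj
  cases i with
  | zero => simp [liftRen] at hij
  | succ i => exact ⟨i, hi, by simpa [liftRen] using hij⟩

theorem Tm.Free.of_rename {t : Tm} {f : ℕ → ℕ} {j : ℕ} (h : (t.rename f).Free j) :
    ∃ i, t.Free i ∧ f i = j := by
  induction t generalizing f j with
  | var i => exact ⟨i, rfl, Eq.symm h⟩
  | star | frac | bound => exact h.elim
  | pair s t hs ht | inlr s t hs ht | psum s t hs ht =>
    rcases h with h | h
    · exact (hs h).imp fun i hi => ⟨.inl hi.1, hi.2⟩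
    · exact (ht h).imp fun i hi => ⟨.inr hi.1, hi.2⟩
  | letPair s t hs ht =>
    rcases h with h | h
    · exact (hs h).imp fun i hi => ⟨.inl hi.1, hi.2⟩
    · exact (exists_free_of_free_lift (exists_free_of_free_lift fun _ => ht) j h).imp
        fun i hi => ⟨.inr hi.1, hi.2⟩
  | magic t ht | inl t ht | inr t ht | lft t ht | normal t ht => exact ht h
  | caseOf r s t hr hs ht =>
    rcases h with h | h | h
    · exact (hr h).imp fun i hi => ⟨.inl hi.1, hi.2⟩
    · exact (exists_free_of_free_lift (fun _ => hs) j h).imp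
        fun i hi => ⟨.inr (.inl hi.1), hi.2⟩
    · exact (exists_free_of_free_lift (fun _ => ht) j h).imp
        fun i hi => ⟨.inr (.inr hi.1), hi.2⟩
  | instr t s ht hs =>
    rcases h with h | h
    · exact (exists_free_of_free_lift (fun _ => ht) j h).imp fun i hi => ⟨.inl hi.1, hi.2⟩
    · exact (hs h).imp fun i hi => ⟨.inr hi.1, hi.2⟩

theorem liftRen_injective {f : ℕ → ℕ} (hf : Function.Injective f) :
    Function.Injective (liftRen f) := by
  intro i j h
  cases i <;> cases j <;> simp [liftRen] at h ⊢
  exact hf h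

theorem Tm.Scoped.rename {t : Tm} {f : ℕ → ℕ} {m n : ℕ} (h : t.Scoped m)
    (hf : ∀ i < m, f i < n) : (t.rename f).Scoped n := fun j hj => by
  obtain ⟨i, hi, rfl⟩ := hj.of_rename
  exact hf i (h i hi)

theorem Tm.Linear.rename {t : Tm} (h : t.Linear) {f : ℕ → ℕ} (hf : Function.Injective f) :
    (t.rename f).Linear := by
  -- a free variable common to two renamed terms comes from a common free variable
  have key : ∀ {s t : Tm} {f f' : ℕ → ℕ} {j : ℕ} {c : ℕ}, Function.Injective f →
      (∀ i j, f' i = f j + c → i = j + c) → (∀ i, s.Free i → ¬ t.Free (i + c)) →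
      (s.rename f).Free j → ¬ (t.rename f').Free (j + c) := by
    intro s t f f' j c hf hf' h h1 h2
    obtain ⟨i, hi, rfl⟩ := h1.of_rename
    obtain ⟨i', hi', he⟩ := h2.of_rename
    exact h i hi (hf' _ _ he ▸ hi')
  have h1 : ∀ {f : ℕ → ℕ}, Function.Injective f → ∀ i j, liftRen f i = f j + 1 → i = j + 1 := by
    intro f hf i j h
    exact liftRen_injective hf (a₂ := j + 1) h
  have h2 : ∀ {f : ℕ → ℕ}, Function.Injective f →
      ∀ i j, liftRen (liftRen f) i = f j + 2 → i = j + 2 := by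
    intro f hf i j h
    exact liftRen_injective (liftRen_injective hf) (a₂ := j + 2) h
  induction t generalizing f with
  | var | star | frac | bound => exact trivial
  | pair s t hs ht =>
    exact ⟨hs h.1 hf, ht h.2.1 hf, fun i => key (c := 0) hf (fun i j h => hf h) h.2.2⟩
  | letPair s t hs ht =>
    exact ⟨hs h.1 hf, ht h.2.1 (liftRen_injective (liftRen_injective hf)),
      fun i => key (c := 2) hf (h2 hf) h.2.2⟩
  | magic t ht | inl t ht | inr t ht | lft t ht => exact ht h hf
  | caseOf r s t hr hs ht =>
    exact ⟨hr h.1 hf, hs h.2.1 (liftRen_injective hf), ht h.2.2.1 (liftRen_injective hf),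
      fun i hi => ⟨key (c := 1) hf (h1 hf) (fun i hi => (h.2.2.2 i hi).1) hi,
        key (c := 1) hf (h1 hf) (fun i hi => (h.2.2.2 i hi).2) hi⟩⟩
  | inlr s t hs ht | psum s t hs ht => exact ⟨hs h.1 hf, ht h.2 hf⟩
  | instr t s ht hs =>
    exact ⟨ht h.1 (liftRen_injective hf), hs h.2.1 hf, h.2.2.rename fun i hi => by
      obtain rfl : i = 0 := by omega
      exact hi⟩
  | normal t ht => exact ⟨ht h.1 hf, h.2.rename fun i hi => absurd hi (Nat.not_lt_zero i)⟩

theorem Tm.Scoped.shift {t : Tm} {m n : ℕ} (h : t.Scoped m) (k d : ℕ) (hn : m + d ≤ n) :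
    (t.shift k d).Scoped n :=
  h.rename fun i hi => by split_ifs <;> omega

theorem Tm.Linear.shift {t : Tm} (h : t.Linear) (k d : ℕ) : (t.shift k d).Linear :=
  h.rename fun i j hij => by
    split_ifs at hij <;> omega

theorem Tm.Scoped.mono {t : Tm} {m n : ℕ} (h : t.Scoped m) (hn : m ≤ n) : t.Scoped n :=
  fun i hi => (h i hi).trans_le hn

theorem le_of_free_shift {t : Tm} {d i : ℕ} (h : (t.shift 0 d).Free i) : d ≤ i := by
  obtain ⟨j, _, rfl⟩ := h.of_rename
  simp

theorem liftRen_id : liftRen id = id := by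
  funext i; cases i <;> rfl

theorem Tm.rename_id (t : Tm) : t.rename id = t := by
  induction t <;> simp_all [Tm.rename, liftRen_id]

theorem liftSub_var : liftSub .var = .var := by
  funext i; cases i <;> simp [liftSub, Tm.shift, Tm.rename]

theorem Tm.subst_var (t : Tm) : t.subst .var = t := by
  induction t <;> simp_all [Tm.subst, liftSub_var]

/-! ### Renaming and substitution in the semantics -/

section Substitution

variable {α : Type*}

theorem getElem?_liftRen {P : ℕ → Prop} {f : ℕ → ℕ} {g g' : List (Value α)}
    (h : ∀ i, P (i + 1) → g[f i]? = g'[i]?) (a : Value α) (i : ℕ) (hi : P i) :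
    (a :: g)[liftRen f i]? = (a :: g')[i]? := by
  cases i with
  | zero => rfl
  | succ i => simpa [liftRen] using h i hi

/-- Only the values of the free variables matter.  The test of an instrument is run on the input
`[a]`, on which every other variable is undefined both before and after the renaming. -/
theorem prob_rename {t : Tm} {f : ℕ → ℕ} {g g' : List (Value α)}
    (h : ∀ i, t.Free i → g[f i]? = g'[i]?) : prob (t.rename f) g = prob t g' := by
  induction t generalizing f g g' with
  | var i => simp only [Tm.rename, prob_var, h i rfl]
  | star | frac | bound => rfl
  | pair s t hs ht | inlr s t hs ht | psum s t hs ht =>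
    refine eq_of_expect_eq fun F => ?_
    simp [Tm.rename, hs fun i hi => h i (.inl hi), ht fun i hi => h i (.inr hi)]
  | letPair s t hs ht =>
    refine eq_of_expect_eq fun F => ?_
    simp [Tm.rename, hs fun i hi => h i (.inl hi), fun a b => ht
      (getElem?_liftRen (getElem?_liftRen (fun i hi => h i (.inr hi)) a) b)]
  | magic t ht | inl t ht | inr t ht | lft t ht | normal t ht =>
    refine eq_of_expect_eq fun F => ?_
    simp [Tm.rename, ht h]
  | caseOf r s t hr hs ht =>
    refine eq_of_expect_eq fun F => ?_
    simp [Tm.rename, hr fun i hi => h i (.inl hi),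
      fun a => hs (getElem?_liftRen (fun i hi => h i (.inr (.inl hi))) a),
      fun a => ht (getElem?_liftRen (fun i hi => h i (.inr (.inr hi))) a)]
  | instr t s ht hs =>
    refine eq_of_expect_eq fun F => ?_
    have h1 : ∀ a : Value α, prob (t.rename (liftRen f)) [a] = prob t [a] := fun a =>
      ht (getElem?_liftRen (fun i _ => by simp) a)
    simp [Tm.rename, hs fun i hi => h i (.inr hi), h1]

theorem prob_congr_of_free {t : Tm} {g g' : List (Value α)}
    (h : ∀ i, t.Free i → g[i]? = g'[i]?) : prob t g = prob t g' := by
  conv_lhs => rw [← t.rename_id]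
  exact prob_rename h

/-- A term over `Δ` is also a term over `Γ, Δ`. -/
theorem prob_append {t : Tm} {d : List (Value α)} (g : List (Value α)) (h : t.Scoped d.length) :
    prob t (d ++ g) = prob t d :=
  prob_congr_of_free fun i hi => List.getElem?_append_left (h i hi)

theorem prob_of_scoped_zero {t : Tm} (h : t.Scoped 0) (g g' : List (Value α)) :
    prob t g = prob t g' :=
  prob_congr_of_free fun i hi => absurd (h i hi) (Nat.not_lt_zero i)

theorem prob_shift (u w v z : List (Value α)) {t : Tm} {k d : ℕ} (hk : k = u.length)
    (hd : d = w.length) (h : t.Scoped (u.length + v.length)) :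
    prob (t.shift k d) (u ++ (w ++ (v ++ z))) = prob t (u ++ v) := by
  subst hk hd
  refine prob_rename fun i hi => ?_
  have := h i hi
  split_ifs with hiu
  · rw [List.getElem?_append_left hiu, List.getElem?_append_left hiu]
  · have h1 : i + w.length - u.length - w.length = i - u.length := by omega
    rw [List.getElem?_append_right (by omega), List.getElem?_append_right (by omega),
      List.getElem?_append_left (by omega), List.getElem?_append_right (by omega), h1]

theorem prob_shift_cons (t : Tm) (a : Value α) (g : List (Value α)) :
    prob (t.shift 0 1) (a :: g) = prob t g :=
  prob_rename fun i _ => by simp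

theorem prob_liftSub {P : ℕ → Prop} {σ σ' : ℕ → Tm} {g g' : List (Value α)}
    (h : ∀ i, P (i + 1) → prob (σ i) g = prob (σ' i) g') (a : Value α) (i : ℕ) (hi : P i) :
    prob (liftSub σ i) (a :: g) = prob (liftSub σ' i) (a :: g') := by
  cases i with
  | zero => simp [liftSub, prob_var]
  | succ i => simpa [liftSub, prob_shift_cons] using h i hi

/-- The semantics of `t[σ]` depends only on that of the terms that `σ` substitutes for the free
variables of `t`.  Linearity serves to exclude that an instrument hides free variables in its
test. -/
theorem prob_subst_congr {t : Tm} (hl : t.Linear) {σ σ' : ℕ → Tm} {g g' : List (Value α)}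
    (h : ∀ i, t.Free i → prob (σ i) g = prob (σ' i) g') :
    prob (t.subst σ) g = prob (t.subst σ') g' := by
  induction t generalizing σ σ' g g' with
  | var i => exact h i rfl
  | star | frac | bound => rfl
  | pair s t hs ht =>
    refine eq_of_expect_eq fun F => ?_
    simp [Tm.subst, hs hl.1 fun i hi => h i (.inl hi), ht hl.2.1 fun i hi => h i (.inr hi)]
  | inlr s t hs ht | psum s t hs ht =>
    refine eq_of_expect_eq fun F => ?_
    simp [Tm.subst, hs hl.1 fun i hi => h i (.inl hi), ht hl.2 fun i hi => h i (.inr hi)]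
  | letPair s t hs ht =>
    refine eq_of_expect_eq fun F => ?_
    simp [Tm.subst, hs hl.1 fun i hi => h i (.inl hi), fun a b => ht hl.2.1
      (prob_liftSub (prob_liftSub (fun i hi => h i (.inr hi)) a) b)]
  | magic t ht | inl t ht | inr t ht | lft t ht =>
    refine eq_of_expect_eq fun F => ?_
    simp [Tm.subst, ht hl h]
  | normal t ht =>
    refine eq_of_expect_eq fun F => ?_
    simp [Tm.subst, ht hl.1 h]
  | caseOf r s t hr hs ht =>
    refine eq_of_expect_eq fun F => ?_
    simp [Tm.subst, hr hl.1 fun i hi => h i (.inl hi),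
      fun a => hs hl.2.1 (prob_liftSub (fun i hi => h i (.inr (.inl hi))) a),
      fun a => ht hl.2.2.1 (prob_liftSub (fun i hi => h i (.inr (.inr hi))) a)]
  | instr t s ht hs =>
    refine eq_of_expect_eq fun F => ?_
    have h1 : ∀ a : Value α, prob (t.subst (liftSub σ)) [a] = prob (t.subst (liftSub σ')) [a] :=
      fun a => ht hl.1 (prob_liftSub (fun i hi => absurd (hl.2.2 _ hi) (by omega)) a)
    simp [Tm.subst, hs hl.2.1 fun i hi => h i (.inr hi), h1]

theorem expect_onPair_comm {φ : Value α → ℝ} {ψ : Value α → ℝ} (hφ : (Function.support φ).Finite)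
    (hψ : (Function.support ψ).Finite) (f : Value α → Value α → Value α → ℝ) :
    expect ψ (onPair fun a b => expect φ fun c => f c a b) =
      expect φ fun c => expect ψ (onPair fun a b => f c a b) := by
  rw [expect_comm hφ hψ fun c => onPair fun a b => f c a b]
  exact congrArg _ (funext fun x => by cases x <;> simp [onPair])

theorem expect_onSum_comm {φ : Value α → ℝ} {ψ : Value α → ℝ} (hφ : (Function.support φ).Finite)
    (hψ : (Function.support ψ).Finite) (f h : Value α → Value α → ℝ) :
    expect ψ (onSum (fun a => expect φ fun c => f c a) fun b => expect φ fun c => h c b) =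
      expect φ fun c => expect ψ (onSum (fun a => f c a) fun b => h c b) := by
  rw [expect_comm hφ hψ fun c => onSum (fun a => f c a) fun b => h c b]
  exact congrArg _ (funext fun x => by cases x <;> simp [onSum])

/-- Substituting for one variable of a linear term amounts to sampling its value beforehand.
Here `σ k` is sampled from `φ`, and `σ'` agrees with `σ` but for the variable `k`, which it reads
off the environment `e a` that records the sampled value `a`.  Linearity is needed because a
variable that is used twice takes the same value twice, while a term that is substituted twice is
run twice. -/
theorem expect_subst {t : Tm} (hl : t.Linear) {φ : Value α → ℝ} (hφ : (Function.support φ).Finite)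
    (hφ1 : expect φ (fun _ => 1) = 1) {k : ℕ} {σ σ' : ℕ → Tm} {g : List (Value α)}
    {e : Value α → List (Value α)} (hk : prob (σ k) g = φ) (hk' : ∀ a, prob (σ' k) (e a) = dirac a)
    (h : ∀ i, i ≠ k → ∀ a, prob (σ' i) (e a) = prob (σ i) g) (F : Value α → ℝ) :
    expect (prob (t.subst σ) g) F = expect φ fun a => expect (prob (t.subst σ') (e a)) F := by
  have hconst : ∀ c : ℝ, (expect φ fun _ => c) = c := fun c => by
    rw [expect_const hφ, hφ1, one_mul]
  -- a term in which the variable `k` is not free does not notice the sample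
  have hnot : ∀ {t : Tm} {k : ℕ} {σ σ' : ℕ → Tm} {g : List (Value α)}
      {e : Value α → List (Value α)}, t.Linear → ¬ t.Free k →
      (∀ i, i ≠ k → ∀ a, prob (σ' i) (e a) = prob (σ i) g) →
      ∀ a, prob (t.subst σ') (e a) = prob (t.subst σ) g := fun hl hk h a =>
    prob_subst_congr hl fun i hi => h i (fun hik => hk (hik ▸ hi)) a
  -- the hypotheses on `σ` and `σ'` carry over to the substitutions under a binder
  have hlift : ∀ {k : ℕ} {σ σ' : ℕ → Tm} {g : List (Value α)} {e : Value α → List (Value α)},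
      (∀ i, i ≠ k → ∀ a, prob (σ' i) (e a) = prob (σ i) g) → ∀ b i, i ≠ k + 1 →
      ∀ a, prob (liftSub σ' i) (b :: e a) = prob (liftSub σ i) (b :: g) := by
    intro k σ σ' g e h b i hi a
    exact prob_liftSub (P := fun i => i ≠ k + 1) (fun i hi => h i (fun h' => hi (by rw [h'])) a)
      b i hi
  have hzero : ∀ {σ : ℕ → Tm} {g : List (Value α)} {k : ℕ} {ψ : Value α → ℝ},
      prob (σ k) g = ψ → ∀ b, prob (liftSub σ (k + 1)) (b :: g) = ψ := by
    intro σ g k ψ h b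
    rw [← h]
    exact prob_shift_cons _ _ _
  induction t generalizing k σ σ' g e F with
  | var i =>
    by_cases hi : i = k
    · subst hi
      simp [Tm.subst, hk, hk']
    · simp [Tm.subst, h i hi, hconst]
  | star | frac | bound => simp [Tm.subst, hconst]
  | pair s t hs ht =>
    by_cases hf : t.Free k
    · simp only [Tm.subst, expect_prob_pair, hnot hl.1 (fun hf' => hl.2.2 k hf' hf) h]
      rw [expect_comm hφ (support_prob_finite _ _)]
      exact congrArg _ (funext fun x => ht hl.2.1 hk hk' h _)
    · simp only [Tm.subst, expect_prob_pair, hnot hl.2.1 hf h]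
      exact hs hl.1 hk hk' h _
  | letPair s t hs ht =>
    have h2 : ∀ a b, _ := fun a b => hlift (hlift h a) b
    by_cases hf : t.Free (k + 2)
    · simp only [Tm.subst, expect_prob_letPair, hnot hl.1 (fun hf' => hl.2.2 k hf' hf) h]
      rw [← expect_onPair_comm hφ (support_prob_finite _ _)]
      simp only [fun a b => ht hl.2.1 (hzero (hzero hk a) b)
        (fun c => hzero (hzero (hk' c) a) b) (h2 a b) F]
    · simp only [Tm.subst, expect_prob_letPair, fun a b => hnot hl.2.1 hf (h2 a b)]
      exact hs hl.1 hk hk' h _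
  | magic t ht => simp [Tm.subst]
  | inl t ht | inr t ht | lft t ht =>
    simp only [Tm.subst, expect_prob_inl, expect_prob_inr, expect_prob_lft, ht hl hk hk' h]
  | caseOf r s t hr hs ht =>
    by_cases hf : r.Free k
    · simp only [Tm.subst, expect_prob_caseOf,
        fun a => hnot hl.2.1 (hl.2.2.2 k hf).1 (hlift h a),
        fun a => hnot hl.2.2.1 (hl.2.2.2 k hf).2 (hlift h a)]
      exact hr hl.1 hk hk' h _
    · simp only [Tm.subst, expect_prob_caseOf, hnot hl.1 hf h]
      rw [← expect_onSum_comm hφ (support_prob_finite _ _)]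
      simp only [fun a => hs hl.2.1 (hzero hk a) (fun c => hzero (hk' c) a) (hlift h a) F,
        fun a => ht hl.2.2.1 (hzero hk a) (fun c => hzero (hk' c) a) (hlift h a) F]
  | inlr s t hs ht =>
    simp only [Tm.subst, expect_prob_inlr]
    rw [expect_add hφ, hs hl.1 hk hk' h, ht hl.2 hk hk' h]
  | instr t s ht hs =>
    have h1 : ∀ (τ : ℕ → Tm) (a : Value α), prob (t.subst (liftSub τ)) [a] = prob t [a] := by
      intro τ a
      conv_rhs => rw [← t.subst_var, ← liftSub_var]
      exact prob_subst_congr hl.1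
        (prob_liftSub (fun i hi => absurd (hl.2.2 _ hi) (by omega)) a)
    simp only [Tm.subst, expect_prob_instr, h1]
    exact hs hl.2.1 hk hk' h _
  | normal t ht =>
    simp only [Tm.subst, expect_prob_normal,
      hnot hl.1 (fun hf => Nat.not_lt_zero _ (hl.2 _ hf)) h, hconst]
  | psum s t hs ht =>
    simp only [Tm.subst, expect_prob_psum]
    rw [expect_add hφ, expect_add hφ, expect_mul_const hφ, ← hs hl.1 hk hk' h,
      ← ht hl.2 hk hk' h]
    -- the summand `-1` in the weight of failure is an expectation because `φ` has mass one
    have hsub : ∀ p q : Value α → ℝ,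
        (expect φ fun x => p x + q x - 1) = expect φ p + expect φ q - 1 := fun p q => by
      simp only [sub_eq_add_neg]
      rw [expect_add hφ, expect_add hφ, hconst]
    simp only [hsub, ← expect_dirac_right (prob _ _) (Value.inr Value.star)]
    rw [← hs hl.1 hk hk' h, ← ht hl.2 hk hk' h]

/-- The semantics of `t[x := r]`. -/
theorem expect_inst {t r : Tm} (hl : t.Linear) {g : List (Value α)}
    (hr : expect (prob r g) (fun _ => 1) = 1) (F : Value α → ℝ) :
    expect (prob (t.inst r) g) F = expect (prob r g) fun a => expect (prob t (a :: g)) F := by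
  rw [Tm.inst, expect_subst hl (support_prob_finite r g) hr (k := 0) (σ' := .var)
    (e := fun a => a :: g) rfl (fun a => by simp [prob_var])]
  · simp only [Tm.subst_var]
  · intro i hi a
    cases i with
    | zero => exact absurd rfl hi
    | succ i => simp [prob_var]

/-- The semantics of `t[x := r, y := s]`. -/
theorem expect_inst₂ {t r s : Tm} (hl : t.Linear) {g : List (Value α)}
    (hr : expect (prob r g) (fun _ => 1) = 1) (hs : expect (prob s g) (fun _ => 1) = 1)
    (F : Value α → ℝ) :
    expect (prob (t.inst₂ r s) g) F =
      expect (prob r g) fun a => expect (prob s g) fun b => expect (prob t (b :: a :: g)) F := by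
  -- the two variables are sampled in turn, which takes an intermediate substitution
  rw [expect_comm (support_prob_finite r g) (support_prob_finite s g), Tm.inst₂,
    expect_subst hl (support_prob_finite s g) hs (k := 0) (e := fun b => b :: g)
      (σ' := fun i => match i with
        | 0 => .var 0
        | 1 => r.shift 0 1
        | i + 2 => .var (i + 1)) rfl (fun b => by simp [prob_var])]
  · refine congrArg _ (funext fun b => ?_)
    refine (expect_subst hl (support_prob_finite r g) hr (k := 1) (σ' := .var)
      (e := fun a => b :: a :: g) ?_ (fun a => by simp [prob_var])
      (fun i hi a => ?_) F).trans ?_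
    · exact prob_shift_cons r b g
    · rcases i with _ | _ | i
      · simp [prob_var]
      · exact absurd rfl hi
      · simp [prob_var]
    · simp only [Tm.subst_var]
  · intro i hi a
    rcases i with _ | _ | i
    · exact absurd rfl hi
    · exact prob_shift_cons r a g
    · simp [prob_var]

end Substitution

/-! ### Distributions on the interpretation of a type -/

section Distributions

variable {X : Type*} {S : Set X} {φ : X → ℝ}

theorem IsDistributionOn.expect_one (h : IsDistributionOn S φ) : expect φ (fun _ => 1) = 1 := by
  simpa [expect] using h.sum_eq_one

theorem IsDistributionOn.expect_const (h : IsDistributionOn S φ) (c : ℝ) :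
    expect φ (fun _ => c) = c := by
  rw [COMET.expect_const h.support_finite, h.expect_one, one_mul]

theorem IsDistributionOn.expect_congr (h : IsDistributionOn S φ) {F G : X → ℝ}
    (hFG : ∀ x ∈ S, F x = G x) : expect φ F = expect φ G :=
  COMET.expect_congr fun x hx => hFG x (h.support_subset hx)

theorem IsDistributionOn.expect_nonneg (h : IsDistributionOn S φ) {F : X → ℝ}
    (hF : ∀ x ∈ S, 0 ≤ F x) : 0 ≤ expect φ F := by
  refine finsum_nonneg fun x => ?_
  by_cases hx : φ x = 0
  · simp [hx]
  · exact mul_nonneg (h.mem_unit x).1 (hF x (h.support_subset hx))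

/-- A nonnegative function with expectation zero vanishes at every value of positive weight. -/
theorem IsDistributionOn.eq_zero_of_expect_eq_zero (h : IsDistributionOn S φ) {F : X → ℝ}
    (hF : ∀ x ∈ S, 0 ≤ F x) (h0 : expect φ F = 0) {x : X} (hx : φ x ≠ 0) : F x = 0 := by
  rw [expect_eq_sum h.support_finite, Finset.sum_eq_zero_iff_of_nonneg] at h0
  · exact (mul_eq_zero.1 (h0 x (by simpa using hx))).resolve_left hx
  · exact fun y hy => mul_nonneg (h.mem_unit y).1 (hF y (h.support_subset (by simpa using hy)))

/-- Finitely supported weights form a distribution on `S` as soon as their expectation functional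
is normalised, and nonnegative on the functions that are nonnegative on `S`. -/
theorem isDistributionOn_of_expect (hf : (Function.support φ).Finite)
    (h1 : expect φ (fun _ => 1) = 1) (h : ∀ F : X → ℝ, (∀ x ∈ S, 0 ≤ F x) → 0 ≤ expect φ F) :
    IsDistributionOn S φ := by
  have hnn : ∀ v : X, ∀ x, 0 ≤ dirac x v := fun v x => by
    unfold dirac; split_ifs <;> norm_num
  have h0 : ∀ v, 0 ≤ φ v := fun v => by
    rw [← expect_dirac_right φ]
    exact h _ fun x _ => hnn v x
  have hsum : ∑ᶠ v, φ v = 1 := by simpa [expect] using h1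
  refine ⟨fun v => ⟨h0 v, ?_⟩, fun v hv => ?_, hf, hsum⟩
  · rw [← hsum]
    exact single_le_finsum v hf h0
  · -- outside `S` the point mass at `v` has both signs
    by_contra hS
    refine hv (le_antisymm ?_ (h0 v))
    have h2 := h (fun x => -1 * dirac x v) fun x hx => by
      have hxv : x ≠ v := fun h => hS (h ▸ hx)
      simp [dirac_of_ne hxv]
    rw [expect_const_mul hf, expect_dirac_right] at h2
    linarith

end Distributions

section Yields

variable {C α : Type*} (I : C → Set α)

/-- On the input `g` the term `t` produces a distribution on `⟦A⟧`.  No typing of `t` is assumed. -/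
def Tm.Yields (t : Tm) (g : List (Value α)) (A : Ty C) : Prop :=
  IsDistributionOn (A.interp I) (prob t g)

variable {I} {r s t : Tm} {g : List (Value α)} {A B D : Ty C}

theorem Ty.mem_interp_sum {v : Value α} : v ∈ (Ty.sum A B).interp I ↔
    (∃ a ∈ A.interp I, v = .inl a) ∨ ∃ b ∈ B.interp I, v = .inr b := by
  simp [Ty.interp, eq_comm]

theorem Ty.mem_interp_one {v : Value α} : v ∈ (Ty.one : Ty C).interp I ↔ v = .star := Iff.rfl

theorem Ty.inl_mem {a : Value α} (h : a ∈ A.interp I) : Value.inl a ∈ (Ty.sum A B).interp I :=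
  mem_interp_sum.2 (.inl ⟨a, h, rfl⟩)

theorem Ty.inr_mem {b : Value α} (h : b ∈ B.interp I) : Value.inr b ∈ (Ty.sum A B).interp I :=
  mem_interp_sum.2 (.inr ⟨b, h, rfl⟩)

theorem Tm.Yields.of_expect (h1 : expect (prob t g) (fun _ => 1) = 1)
    (h : ∀ F : Value α → ℝ, (∀ x ∈ A.interp I, 0 ≤ F x) → 0 ≤ expect (prob t g) F) :
    t.Yields I g A := isDistributionOn_of_expect (support_prob_finite t g) h1 h

theorem Tm.Yields.of_prob_eq {g' : List (Value α)} (h : t.Yields I g' A)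
    (he : prob s g = prob t g') : s.Yields I g A := by
  unfold Tm.Yields; rw [he]; exact h

theorem Tm.yields_var {i : ℕ} {a : Value α} (hi : g[i]? = some a) (ha : a ∈ A.interp I) :
    (Tm.var i).Yields I g A :=
  .of_expect (by rw [expect_prob_of_getElem? _ _ hi]) fun F hF => by
    rw [expect_prob_of_getElem? _ _ hi]; exact hF _ ha

theorem Tm.yields_star : Tm.star.Yields I g (.one : Ty C) :=
  .of_expect (by simp) fun F hF => by simpa using hF _ rfl

theorem Tm.Yields.pair (hs : s.Yields I g A) (ht : t.Yields I g B) :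
    (Tm.pair s t).Yields I g (.tensor A B) :=
  .of_expect (by simp [ht.expect_const, hs.expect_const]) fun F hF => by
    rw [expect_prob_pair]
    exact hs.expect_nonneg fun a ha => ht.expect_nonneg fun b hb => hF _ ⟨a, ha, b, hb, rfl⟩

theorem Tm.Yields.expect_onPair_congr (hs : s.Yields I g (.tensor A B))
    {f f' : Value α → Value α → ℝ}
    (h : ∀ a ∈ A.interp I, ∀ b ∈ B.interp I, f a b = f' a b) :
    expect (prob s g) (onPair f) = expect (prob s g) (onPair f') :=
  hs.expect_congr fun x hx => by
    obtain ⟨a, ha, b, hb, rfl⟩ := hx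
    exact h a ha b hb

theorem Tm.Yields.expect_onSum_congr (hs : s.Yields I g (.sum A B)) {f f' k k' : Value α → ℝ}
    (h : ∀ a ∈ A.interp I, f a = f' a) (h' : ∀ b ∈ B.interp I, k b = k' b) :
    expect (prob s g) (onSum f k) = expect (prob s g) (onSum f' k') :=
  hs.expect_congr fun x hx => by
    obtain ⟨a, ha, rfl⟩ | ⟨b, hb, rfl⟩ := Ty.mem_interp_sum.1 hx
    exacts [h a ha, h' b hb]

theorem Tm.Yields.expect_eq_onPair (hs : s.Yields I g (.tensor A B)) (F : Value α → ℝ) :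
    expect (prob s g) F = expect (prob s g) (onPair fun a b => F (.pair a b)) :=
  hs.expect_congr fun x hx => by
    obtain ⟨a, ha, b, hb, rfl⟩ := hx
    rfl

theorem Tm.Yields.expect_eq_onSum (hs : s.Yields I g (.sum A B)) (F : Value α → ℝ) :
    expect (prob s g) F =
      expect (prob s g) (onSum (fun a => F (.inl a)) fun b => F (.inr b)) :=
  hs.expect_congr fun x hx => by
    obtain ⟨a, ha, rfl⟩ | ⟨b, hb, rfl⟩ := Ty.mem_interp_sum.1 hx <;> rfl

theorem Tm.Yields.expect_onSum_nonneg (hs : s.Yields I g (.sum A B)) {f h : Value α → ℝ}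
    (hf : ∀ a ∈ A.interp I, 0 ≤ f a) (hh : ∀ b ∈ B.interp I, 0 ≤ h b) :
    0 ≤ expect (prob s g) (onSum f h) :=
  hs.expect_nonneg fun x hx => by
    obtain ⟨a, ha, rfl⟩ | ⟨b, hb, rfl⟩ := Ty.mem_interp_sum.1 hx
    exacts [hf a ha, hh b hb]

theorem Tm.Yields.letPair (hs : s.Yields I g (.tensor A B))
    (ht : ∀ a ∈ A.interp I, ∀ b ∈ B.interp I, t.Yields I (b :: a :: g) D) :
    (Tm.letPair s t).Yields I g D :=
  .of_expect (by
      rw [expect_prob_letPair, hs.expect_onPair_congr fun a ha b hb => (ht a ha b hb).expect_one,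
        ← hs.expect_eq_onPair fun _ => 1, hs.expect_one])
    fun F hF => by
      rw [expect_prob_letPair]
      refine hs.expect_nonneg fun x hx => ?_
      obtain ⟨a, ha, b, hb, rfl⟩ := hx
      exact (ht a ha b hb).expect_nonneg hF

theorem Tm.Yields.inl (ht : t.Yields I g A) : (Tm.inl t).Yields I g (.sum A B) :=
  .of_expect (by simp [ht.expect_one]) fun F hF => by
    rw [expect_prob_inl]
    exact ht.expect_nonneg fun a ha => hF _ (Ty.inl_mem ha)

theorem Tm.Yields.inr (ht : t.Yields I g B) : (Tm.inr t).Yields I g (.sum A B) :=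
  .of_expect (by simp [ht.expect_one]) fun F hF => by
    rw [expect_prob_inr]
    exact ht.expect_nonneg fun a ha => hF _ (Ty.inr_mem ha)

theorem Tm.Yields.caseOf (hr : r.Yields I g (.sum A B))
    (hs : ∀ a ∈ A.interp I, s.Yields I (a :: g) D) (ht : ∀ b ∈ B.interp I, t.Yields I (b :: g) D) :
    (Tm.caseOf r s t).Yields I g D :=
  .of_expect (by
      rw [expect_prob_caseOf, hr.expect_onSum_congr (fun a ha => (hs a ha).expect_one)
        fun b hb => (ht b hb).expect_one, ← hr.expect_eq_onSum fun _ => 1, hr.expect_one])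
    fun F hF => by
      rw [expect_prob_caseOf]
      exact hr.expect_onSum_nonneg (fun a ha => (hs a ha).expect_nonneg hF)
        fun b hb => (ht b hb).expect_nonneg hF

theorem Tm.Yields.inst (hl : t.Linear) (hs : s.Yields I g A)
    (ht : ∀ a ∈ A.interp I, t.Yields I (a :: g) B) : (t.inst s).Yields I g B :=
  .of_expect (by
      rw [expect_inst hl hs.expect_one, IsDistributionOn.expect_congr hs fun a ha =>
        (ht a ha).expect_one, hs.expect_one])
    fun F hF => by
      rw [expect_inst hl hs.expect_one]
      exact hs.expect_nonneg fun a ha => (ht a ha).expect_nonneg hF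

end Yields

/-! ### Partial computations -/

section Partial

variable {C α : Type*} {I : C → Set α} {s t : Tm} {g : List (Value α)} {A B : Ty C}

theorem expect_onSum_split {φ : Value α → ℝ} (hφ : (Function.support φ).Finite)
    (f h : Value α → ℝ) :
    expect φ (onSum f h) = expect φ (onSum f fun _ => 0) + expect φ (onSum (fun _ => 0) h) := by
  rw [← expect_add hφ, ← onSum_add]
  simp

theorem expect_onSum_const_left {φ : Value α → ℝ} (hφ : (Function.support φ).Finite) (c : ℝ) :
    expect φ (onSum (fun _ => c) fun _ => 0) =
      c * expect φ (onSum (fun _ => 1) fun _ => 0) := by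
  rw [← expect_const_mul hφ, ← onSum_const_mul]
  simp

theorem expect_onSum_const_right {φ : Value α → ℝ} (hφ : (Function.support φ).Finite) (c : ℝ) :
    expect φ (onSum (fun _ => 0) fun _ => c) =
      c * expect φ (onSum (fun _ => 0) fun _ => 1) := by
  rw [← expect_const_mul hφ, ← onSum_const_mul]
  simp

theorem Tm.Yields.expect_inl_add_expect_inr (ht : t.Yields I g (.sum A B)) :
    expect (prob t g) (onSum (fun _ => 1) fun _ => 0) +
      expect (prob t g) (onSum (fun _ => 0) fun _ => 1) = 1 := by
  rw [← expect_onSum_split (support_prob_finite t g), ← ht.expect_eq_onSum fun _ => 1,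
    ht.expect_one]

/-- The expectation of `F` under a partial computation is the contribution of the returned values
and that of failure. -/
theorem Tm.Yields.expect_eq_partial (ht : t.Yields I g A.partialTy) (F : Value α → ℝ) :
    expect (prob t g) F = expect (prob t g) (onSum (fun a => F (.inl a)) fun _ => 0) +
      F (.inr .star) * expect (prob t g) (onSum (fun _ => 0) fun _ => 1) := by
  have hf := support_prob_finite t g
  rw [← expect_onSum_const_right hf, ← expect_onSum_split hf, ht.expect_eq_onSum]
  exact ht.expect_onSum_congr (fun _ _ => rfl) fun b hb => by rw [Ty.mem_interp_one.1 hb]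

theorem Tm.Yields.prob_fail (ht : t.Yields I g A.partialTy) :
    prob t g (.inr .star) = expect (prob t g) (onSum (fun _ => 0) fun _ => 1) := by
  rw [← expect_dirac_right (prob t g), ht.expect_eq_partial]
  simp [dirac_of_ne, onSum_zero]

/-- A distribution on `⟦𝟐⟧` is determined by the two probabilities `p` and `q`. -/
theorem Tm.Yields.exists_two (ht : t.Yields I g (.two : Ty C)) :
    ∃ p q : ℝ, p + q = 1 ∧ ∀ F : Value α → ℝ,
      expect (prob t g) F = p * F (.inl .star) + q * F (.inr .star) := by
  have hf := support_prob_finite t g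
  refine ⟨_, _, ht.expect_inl_add_expect_inr, fun F => ?_⟩
  rw [mul_comm _ (F _), mul_comm _ (F _), ← expect_onSum_const_right hf,
    ← expect_onSum_const_left hf, ← expect_onSum_split hf, ht.expect_eq_onSum]
  exact ht.expect_onSum_congr (fun b hb => by rw [Ty.mem_interp_one.1 hb])
    fun b hb => by rw [Ty.mem_interp_one.1 hb]

theorem expect_prob_dom (F : Value α → ℝ) : expect (prob t.dom g) F =
    expect (prob t g) (onSum (fun _ => F (.inl .star)) fun _ => F (.inr .star)) := by
  simp [Tm.dom, Tm.top, Tm.bot]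

theorem expect_prob_ker (F : Value α → ℝ) : expect (prob t.ker g) F =
    expect (prob t g) (onSum (fun _ => F (.inr .star)) fun _ => F (.inl .star)) := by
  simp [Tm.ker, Tm.top, Tm.bot]

theorem expect_prob_proj₁ (F : Value α → ℝ) : expect (prob t.proj₁ g) F =
    expect (prob t g) (onSum (fun a => F (.inl a)) fun _ => F (.inr .star)) := by
  simp [Tm.proj₁, Tm.ret, Tm.fail]

theorem expect_prob_proj₂ (F : Value α → ℝ) : expect (prob t.proj₂ g) F =
    expect (prob t g) (onSum (fun _ => F (.inr .star)) fun a => F (.inl a)) := by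
  simp [Tm.proj₂, Tm.ret, Tm.fail]

theorem expect_prob_doIn (F : Value α → ℝ) : expect (prob (s.doIn t) g) F =
    expect (prob s g) (onSum (fun a => expect (prob t (a :: g)) F) fun _ => F (.inr .star)) := by
  simp [Tm.doIn, Tm.fail]

/-- `s↓ = t↑` says that `s` succeeds with the probability with which `t` fails. -/
theorem expect_of_dom_eq_ker (h : prob s.dom g = prob t.ker g) :
    expect (prob s g) (onSum (fun _ => 1) fun _ => 0) =
      expect (prob t g) (onSum (fun _ => 0) fun _ => 1) := by
  have := congrArg (fun φ => expect φ (onSum (fun _ => 1) fun _ => 0)) h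
  simpa [expect_prob_dom, expect_prob_ker] using this

theorem Tm.Yields.inlr (hs : s.Yields I g A.partialTy) (ht : t.Yields I g B.partialTy)
    (h : prob s.dom g = prob t.ker g) : (Tm.inlr s t).Yields I g (.sum A B) :=
  .of_expect (by
      rw [expect_prob_inlr, expect_of_dom_eq_ker h, add_comm, ht.expect_inl_add_expect_inr])
    fun F hF => by
      rw [expect_prob_inlr]
      exact add_nonneg
        (hs.expect_onSum_nonneg (fun a ha => hF _ (Ty.inl_mem ha)) fun _ _ => le_rfl)
        (ht.expect_onSum_nonneg (fun a ha => hF _ (Ty.inr_mem ha)) fun _ _ => le_rfl)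

theorem expect_inl_of_dom_eq_top (h : prob t.dom g = prob .top g) :
    expect (prob t g) (onSum (fun _ => 1) fun _ => 0) = 1 := by
  have := congrArg (fun φ => expect φ (onSum (fun _ => 1) fun _ => 0)) h
  simpa [expect_prob_dom, Tm.top] using this

theorem Tm.Yields.lft (ht : t.Yields I g (.sum A B)) (h : prob t.dom g = prob .top g) :
    (Tm.lft t).Yields I g A :=
  .of_expect (by rw [expect_prob_lft, expect_inl_of_dom_eq_top h]) fun F hF => by
    rw [expect_prob_lft]
    exact ht.expect_onSum_nonneg hF fun _ _ => le_rfl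

/-- If `t↓ = ⊤` then the right summands carry no weight. -/
theorem Tm.Yields.expect_of_dom_eq_top (ht : t.Yields I g (.sum A B))
    (h : prob t.dom g = prob .top g) (F : Value α → ℝ) :
    expect (prob t g) F = expect (prob t g) (onSum (fun a => F (.inl a)) fun _ => 0) := by
  have h0 : expect (prob t g) (onSum (fun _ => 0) fun _ => 1) = 0 := by
    linarith [ht.expect_inl_add_expect_inr, expect_inl_of_dom_eq_top h]
  rw [ht.expect_eq_onSum]
  refine expect_congr fun x hx => ?_
  have := ht.eq_zero_of_expect_eq_zero (fun x hx => ?_) h0 hx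
  · cases x <;> simp [onSum] at this ⊢
  · obtain ⟨a, ha, rfl⟩ | ⟨b, hb, rfl⟩ := Ty.mem_interp_sum.1 hx <;> simp

end Partial

/-! ### Scopes of compound terms -/

section Scopes

variable {r s t : Tm} {m n : ℕ}

theorem forall_or_imp_iff {P Q R : ℕ → Prop} :
    (∀ i, P i ∨ Q i → R i) ↔ (∀ i, P i → R i) ∧ ∀ i, Q i → R i := by
  simp only [or_imp, forall_and]

theorem Tm.scoped_var {i : ℕ} : (Tm.var i).Scoped n ↔ i < n :=
  ⟨fun h => h i rfl, fun h _ hj => hj ▸ h⟩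

theorem Tm.scoped_star : Tm.star.Scoped n := fun _ h => h.elim
theorem Tm.scoped_frac {k : ℕ} : (Tm.frac k).Scoped n := fun _ h => h.elim
theorem Tm.scoped_bound {k l : ℕ} : (Tm.bound k l).Scoped n := fun _ h => h.elim

theorem Tm.scoped_pair : (Tm.pair s t).Scoped n ↔ s.Scoped n ∧ t.Scoped n := forall_or_imp_iff
theorem Tm.scoped_inlr : (Tm.inlr s t).Scoped n ↔ s.Scoped n ∧ t.Scoped n := forall_or_imp_iff
theorem Tm.scoped_psum : (Tm.psum s t).Scoped n ↔ s.Scoped n ∧ t.Scoped n := forall_or_imp_iff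
theorem Tm.scoped_inl : (Tm.inl t).Scoped n ↔ t.Scoped n := Iff.rfl
theorem Tm.scoped_normal : (Tm.normal t).Scoped n ↔ t.Scoped n := Iff.rfl

theorem forall_free_add_iff (k : ℕ) : (∀ i, t.Free (i + k) → i < n) ↔ t.Scoped (n + k) := by
  refine ⟨fun h i hi => ?_, fun h i hi => by have := h _ hi; omega⟩
  by_contra hn
  have := h (i - k) (by rwa [Nat.sub_add_cancel (by omega)])
  omega

theorem Tm.scoped_letPair : (Tm.letPair s t).Scoped n ↔ s.Scoped n ∧ t.Scoped (n + 2) := by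
  rw [← forall_free_add_iff]
  exact forall_or_imp_iff

theorem Tm.scoped_instr : (Tm.instr t s).Scoped n ↔ t.Scoped (n + 1) ∧ s.Scoped n := by
  rw [← forall_free_add_iff]
  exact forall_or_imp_iff

theorem Tm.scoped_caseOf :
    (Tm.caseOf r s t).Scoped n ↔ r.Scoped n ∧ s.Scoped (n + 1) ∧ t.Scoped (n + 1) := by
  rw [← forall_free_add_iff, ← forall_free_add_iff]
  exact forall_or_imp_iff.trans (and_congr Iff.rfl forall_or_imp_iff)

theorem exists_free_of_free_liftSub {P Q : ℕ → Prop} {σ : ℕ → Tm}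
    (h : ∀ j, P j → ∃ i, Q i ∧ (liftSub σ i).Free j) (j : ℕ) (hj : P (j + 1)) :
    ∃ i, Q (i + 1) ∧ (σ i).Free j := by
  obtain ⟨i, hi, hij⟩ := h _ hj
  cases i with
  | zero => exact absurd hij (Nat.succ_ne_zero j)
  | succ i =>
    obtain ⟨l, hl, hlj⟩ := hij.of_rename
    obtain rfl : l = j := by simpa using hlj
    exact ⟨i, hi, hl⟩

theorem Tm.Free.of_subst {σ : ℕ → Tm} {j : ℕ} (h : (t.subst σ).Free j) :
    ∃ i, t.Free i ∧ (σ i).Free j := by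
  induction t generalizing σ j with
  | var i => exact ⟨i, rfl, h⟩
  | star | frac | bound => exact h.elim
  | pair s t hs ht | inlr s t hs ht | psum s t hs ht =>
    rcases h with h | h
    · exact (hs h).imp fun i hi => ⟨.inl hi.1, hi.2⟩
    · exact (ht h).imp fun i hi => ⟨.inr hi.1, hi.2⟩
  | letPair s t hs ht =>
    rcases h with h | h
    · exact (hs h).imp fun i hi => ⟨.inl hi.1, hi.2⟩
    · exact (exists_free_of_free_liftSub (exists_free_of_free_liftSub fun _ => ht) j h).imp
        fun i hi => ⟨.inr hi.1, hi.2⟩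
  | magic t ht | inl t ht | inr t ht | lft t ht | normal t ht => exact ht h
  | caseOf r s t hr hs ht =>
    rcases h with h | h | h
    · exact (hr h).imp fun i hi => ⟨.inl hi.1, hi.2⟩
    · exact (exists_free_of_free_liftSub (fun _ => hs) j h).imp
        fun i hi => ⟨.inr (.inl hi.1), hi.2⟩
    · exact (exists_free_of_free_liftSub (fun _ => ht) j h).imp
        fun i hi => ⟨.inr (.inr hi.1), hi.2⟩
  | instr t s ht hs =>
    rcases h with h | h
    · exact (exists_free_of_free_liftSub (fun _ => ht) j h).imp fun i hi => ⟨.inl hi.1, hi.2⟩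
    · exact (hs h).imp fun i hi => ⟨.inr hi.1, hi.2⟩

theorem Tm.Scoped.inst (ht : t.Scoped m) (hm : m ≤ n + 1) (hs : s.Scoped n) :
    (t.inst s).Scoped n := fun j hj => by
  obtain ⟨i, hi, hij⟩ := hj.of_subst
  cases i with
  | zero => exact hs j hij
  | succ i => exact Tm.scoped_var.2 (by have := ht _ hi; omega) j hij

theorem Tm.Scoped.inst₂ (ht : t.Scoped m) (hm : m ≤ n + 2) (hr : r.Scoped n) (hs : s.Scoped n) :
    (t.inst₂ r s).Scoped n := fun j hj => by
  obtain ⟨i, hi, hij⟩ := hj.of_subst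
  rcases i with _ | _ | i
  · exact hs j hij
  · exact hr j hij
  · exact Tm.scoped_var.2 (by have := ht _ hi; omega) j hij

theorem Tm.scoped_proj₁ (ht : t.Scoped n) : t.proj₁.Scoped n :=
  Tm.scoped_caseOf.2 ⟨ht, Tm.scoped_var.2 n.succ_pos, scoped_star⟩

theorem Tm.scoped_proj₂ (ht : t.Scoped n) : t.proj₂.Scoped n :=
  Tm.scoped_caseOf.2 ⟨ht, scoped_star, Tm.scoped_var.2 n.succ_pos⟩

theorem Tm.scoped_doIn (hs : s.Scoped n) (ht : t.Scoped (n + 1)) : (s.doIn t).Scoped n :=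
  Tm.scoped_caseOf.2 ⟨hs, ht, scoped_star⟩

theorem Tm.scoped_assert (hs : s.Scoped 1) (ht : t.Scoped n) : (Tm.assert s t).Scoped n :=
  scoped_proj₁ (Tm.scoped_instr.2 ⟨hs.mono (by omega), ht⟩)

theorem Tm.scoped_nsum (ht : t.Scoped n) : ∀ k, (Tm.nsum k t).Scoped n
  | 0 => scoped_star
  | 1 => ht
  | k + 2 => Tm.scoped_psum.2 ⟨scoped_nsum ht (k + 1), ht⟩

end Scopes

/-! ### Copowers -/

section Copowers

variable {C α : Type*} {I : C → Set α} {A : Ty C} {t : Tm} {g : List (Value α)}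

theorem Value.tag_mem : ∀ (n : ℕ) {i a : Value α}, i ∈ (Ty.fin n : Ty C).interp I →
    a ∈ A.interp I → Value.tag i a ∈ (A.copower n).interp I
  | 0, _, _, hi, _ => hi.elim
  | 1, _, _, hi, ha => by
    rw [Ty.mem_interp_one.1 hi]
    exact ha
  | n + 2, _, _, hi, ha => by
    obtain ⟨i, hi', rfl⟩ | ⟨i, hi', rfl⟩ := Ty.mem_interp_sum.1 hi
    · exact Ty.inl_mem (tag_mem (n + 1) hi' ha)
    · rw [Ty.mem_interp_one.1 hi']
      exact Ty.inr_mem ha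

theorem Value.exists_tag_eq : ∀ (n : ℕ) {x : Value α}, x ∈ (A.copower n).interp I →
    ∃ i ∈ (Ty.fin n : Ty C).interp I, ∃ a ∈ A.interp I, x = Value.tag i a
  | 0, _, hx => hx.elim
  | 1, x, hx => ⟨.star, rfl, x, hx, rfl⟩
  | n + 2, _, hx => by
    obtain ⟨x, hx', rfl⟩ | ⟨x, hx', rfl⟩ := Ty.mem_interp_sum.1 hx
    · obtain ⟨i, hi, a, ha, rfl⟩ := exists_tag_eq (n + 1) hx'
      exact ⟨.inl i, Ty.inl_mem hi, a, ha, rfl⟩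
    · exact ⟨.inr .star, Ty.inr_mem rfl, x, hx', rfl⟩

/-- The function on `⟦n · A⟧` that is `F` on each of the `n` summands. -/
def nablaFun : ℕ → (Value α → ℝ) → Value α → ℝ
  | 0, _ => fun _ => 0
  | 1, F => F
  | n + 2, F => onSum (nablaFun (n + 1) F) F

/-- The function on an `n`-fold sum that is constant, with value `c i`, on the `i`-th summand. -/
def caseFun : (n : ℕ) → (Fin n → ℝ) → Value α → ℝ
  | 0, _ => fun _ => 0
  | 1, c => fun _ => c 0
  | n + 2, c => onSum (caseFun (n + 1) fun i => c i.castSucc) fun _ => c (Fin.last (n + 1))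

theorem nablaFun_tag (F : Value α → ℝ) (a : Value α) : ∀ (n : ℕ) {i : Value α},
    i ∈ (Ty.fin n : Ty C).interp I → nablaFun n F (Value.tag i a) = F a
  | 0, _, hi => hi.elim
  | 1, _, hi => by
    rw [Ty.mem_interp_one.1 hi]
    rfl
  | n + 2, _, hi => by
    obtain ⟨i, hi', rfl⟩ | ⟨i, hi', rfl⟩ := Ty.mem_interp_sum.1 hi
    · exact nablaFun_tag F a (n + 1) hi'
    · rw [Ty.mem_interp_one.1 hi']
      rfl

theorem expect_prob_nabla (F : Value α → ℝ) : ∀ (n : ℕ) (t : Tm) (g : List (Value α)),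
    expect (prob (t.nabla n) g) F = expect (prob t g) (nablaFun n F)
  | 0, t, g => by simp [Tm.nabla, Tm.caseN, nablaFun]
  | 1, t, g => rfl
  | n + 2, t, g => by
    have h : t.nabla (n + 2) = .caseOf t ((Tm.var 0).nabla (n + 1)) (.var 0) := rfl
    simp [h, expect_prob_nabla F (n + 1), nablaFun]

theorem Tm.Scoped.nabla : ∀ (n : ℕ) {t : Tm} {m : ℕ}, t.Scoped m → (t.nabla n).Scoped m
  | 0, _, _, h => h
  | 1, _, _, h => h
  | n + 2, _, m, h => Tm.scoped_caseOf.2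
    ⟨h, Tm.Scoped.nabla (n + 1) (Tm.scoped_var.2 m.succ_pos), Tm.scoped_var.2 m.succ_pos⟩

/-- A term without free variables, stated as invariance under renaming and substitution. -/
structure Tm.Closed (t : Tm) : Prop where
  rename_eq : ∀ f, t.rename f = t
  subst_eq : ∀ σ, t.subst σ = t
  scoped_zero : t.Scoped 0

theorem Tm.Closed.prob_eq (h : t.Closed) : prob t g = prob t [] :=
  prob_of_scoped_zero h.scoped_zero _ _

theorem closed_inj_star : ∀ (n : ℕ) (i : Fin n), (Tm.inj n i .star).Closed
  | 0, i => i.elim0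
  | 1, _ => ⟨fun _ => rfl, fun _ => rfl, Tm.scoped_star⟩
  | n + 2, i => by
    refine Fin.lastCases ?_ (fun j => ?_) i
    · simp only [Tm.inj, Fin.lastCases_last]
      exact ⟨fun _ => rfl, fun _ => rfl, Tm.scoped_star⟩
    · have h := closed_inj_star (n + 1) j
      simp only [Tm.inj, Fin.lastCases_castSucc]
      exact ⟨fun f => congrArg Tm.inl (h.rename_eq f), fun σ => congrArg Tm.inl (h.subst_eq σ),
        Tm.scoped_inl.2 h.scoped_zero⟩

/-- The `n`-fold `case` with constant branches.  For `n = 1` it is a substitution and does not run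
`t`, hence the hypothesis that `t` has total mass one. -/
theorem expect_prob_caseN : ∀ (n : ℕ) (f : Fin n → Tm), (∀ i, (f i).Closed) →
    ∀ (t : Tm) (g : List (Value α)), expect (prob t g) (fun _ => 1) = 1 → ∀ F : Value α → ℝ,
      expect (prob (Tm.caseN n t f) g) F =
        expect (prob t g) (caseFun n fun i => expect (prob (f i) []) F)
  | 0, f, hf, t, g, ht, F => by simp [Tm.caseN, caseFun]
  | 1, f, hf, t, g, ht, F => by
    rw [Tm.caseN, Tm.inst, (hf 0).subst_eq, (hf 0).prob_eq, caseFun,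
      expect_const (support_prob_finite t g), ht, one_mul]
  | n + 2, f, hf, t, g, ht, F => by
    have h : Tm.caseN (n + 2) t f = .caseOf t (Tm.caseN (n + 1) (.var 0) fun i => f i.castSucc)
        (f (Fin.last (n + 1))) := by
      rw [Tm.caseN]
      simp only [Tm.shift, (hf _).rename_eq]
    rw [h, expect_prob_caseOf, caseFun]
    congr 2
    · funext a
      rw [expect_prob_caseN (n + 1) _ (fun i => hf _) _ _ (by simp), expect_prob_var_zero]
    · funext b
      rw [(hf _).prob_eq]

theorem scoped_caseN : ∀ (n : ℕ) (f : Fin n → Tm), (∀ i, (f i).Closed) →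
    ∀ {t : Tm} {m : ℕ}, t.Scoped m → (Tm.caseN n t f).Scoped m
  | 0, _, _, _, _, ht => ht
  | 1, f, hf, _, m, ht => by
    rw [Tm.caseN, Tm.inst, (hf 0).subst_eq]
    exact (hf 0).scoped_zero.mono m.zero_le
  | n + 2, f, hf, _, m, ht => by
    rw [Tm.caseN]
    simp only [Tm.shift, (hf _).rename_eq]
    exact Tm.scoped_caseOf.2 ⟨ht, scoped_caseN (n + 1) _ (fun i => hf _)
      (Tm.scoped_var.2 m.succ_pos), (hf _).scoped_zero.mono (Nat.zero_le _)⟩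

/-- The index of the copy `tag i a` of `a` is `i`. -/
theorem caseFun_inj_tag (a : Value α) : ∀ (n : ℕ) {i : Value α},
    i ∈ (Ty.fin n : Ty C).interp I → ∀ F : Value α → ℝ,
      caseFun n (fun j => expect (prob (Tm.inj n j .star) []) F) (Value.tag i a) = F i
  | 0, _, hi, _ => hi.elim
  | 1, _, hi, F => by
    rw [Ty.mem_interp_one.1 hi]
    simp [caseFun, Tm.inj]
  | n + 2, _, hi, F => by
    obtain ⟨i, hi', rfl⟩ | ⟨i, hi', rfl⟩ := Ty.mem_interp_sum.1 hi
    · simpa [caseFun, Tm.inj, Value.tag] using caseFun_inj_tag a (n + 1) hi' fun v => F (.inl v)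
    · rw [Ty.mem_interp_one.1 hi']
      simp [caseFun, Tm.inj, Value.tag]

theorem Tm.Scoped.ind {m : ℕ} (n : ℕ) (h : t.Scoped m) : (t.ind n).Scoped m :=
  scoped_caseN n _ (closed_inj_star n) h

theorem expect_prob_ind (n : ℕ) (ht : expect (prob t g) (fun _ => 1) = 1) (F : Value α → ℝ) :
    expect (prob (t.ind n) g) F = expect (prob t g)
      (caseFun n fun i => expect (prob (Tm.inj n i .star) []) F) :=
  expect_prob_caseN n _ (closed_inj_star n) t g ht F

end Copowers

/-! ### Instruments, partial sums, scalars and normalisation -/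

section Constructions

variable {C α : Type*} {I : C → Set α} {A B : Ty C} {g : List (Value α)}

theorem Tm.Yields.instr {s t : Tm} {n : ℕ} (hs : s.Yields I g A)
    (ht : ∀ a ∈ A.interp I, t.Yields I [a] (.fin n : Ty C)) :
    (Tm.instr t s).Yields I g (A.copower n) :=
  .of_expect (by
      rw [expect_prob_instr, IsDistributionOn.expect_congr hs fun a ha => (ht a ha).expect_one,
        hs.expect_one])
    fun F hF => by
      rw [expect_prob_instr]
      exact hs.expect_nonneg fun a ha => (ht a ha).expect_nonneg fun i hi =>
        hF _ (Value.tag_mem n hi ha)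

theorem prob_nabla_instr {s t : Tm} {n : ℕ} (hs : s.Yields I g A)
    (ht : ∀ a ∈ A.interp I, t.Yields I [a] (.fin n : Ty C)) :
    prob ((Tm.instr t s).nabla n) g = prob s g :=
  eq_of_expect_eq fun F => by
    rw [expect_prob_nabla, expect_prob_instr]
    refine hs.expect_congr fun a ha => ?_
    rw [(ht a ha).expect_congr fun i hi => nablaFun_tag F a n hi, (ht a ha).expect_const]

theorem expect_prob_ind_instr {s t : Tm} {n : ℕ} (hs : s.Yields I g A)
    (ht : ∀ a ∈ A.interp I, t.Yields I [a] (.fin n : Ty C)) (F : Value α → ℝ) :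
    expect (prob ((Tm.instr t s).ind n) g) F =
      expect (prob s g) fun a => expect (prob t [a]) F := by
  rw [expect_prob_ind n (hs.instr ht).expect_one, expect_prob_instr]
  exact hs.expect_congr fun a ha => (ht a ha).expect_congr fun _ hi => caseFun_inj_tag a n hi F

/-- If `∇ t` returns the input `a` unchanged, then `t` outputs a copy of `a`, so that `t` is
recovered from its index. -/
theorem expect_ind_tag {t : Tm} {n : ℕ} {a : Value α}
    (ht : t.Yields I [a] (A.copower n)) (h : prob (t.nabla n) [a] = prob (.var 0) [a])
    (F : Value α → ℝ) :
    expect (prob (t.ind n) [a]) (fun i => F (Value.tag i a)) = expect (prob t [a]) F := by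
  rw [expect_prob_ind n ht.expect_one]
  -- `G` vanishes at `a` only, and its expectation under `∇ t` is zero
  set G : Value α → ℝ := fun x => 1 - dirac a x with hG
  have h0 : expect (prob t [a]) (nablaFun n G) = 0 := by
    rw [← expect_prob_nabla, h, expect_prob_var_zero]
    simp [hG]
  have hnn : ∀ x ∈ (A.copower n).interp I, 0 ≤ nablaFun n G x := fun x hx => by
    obtain ⟨i, hi, a', ha', rfl⟩ := Value.exists_tag_eq n hx
    rw [nablaFun_tag G a' n hi, hG]
    by_cases haa : a = a'
    · simp [haa]
    · simp [dirac_of_ne haa]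
  refine expect_congr fun x hx => ?_
  have hxG := ht.eq_zero_of_expect_eq_zero hnn h0 hx
  obtain ⟨i, hi, a', ha', rfl⟩ := Value.exists_tag_eq n (ht.support_subset hx)
  rw [nablaFun_tag G a' n hi, hG] at hxG
  rw [caseFun_inj_tag a' n hi fun i => F (Value.tag i a)]
  by_cases haa : a = a'
  · rw [haa]
  · simp [dirac_of_ne haa] at hxG

theorem Tm.Yields.assert {p t : Tm} (ht : t.Yields I g A)
    (hp : ∀ a ∈ A.interp I, p.Yields I [a] (.two : Ty C)) :
    (Tm.assert p t).Yields I g A.partialTy :=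
  (ht.instr (n := 2) hp).caseOf (fun _ ha => (Tm.yields_var rfl ha).inl)
    fun _ _ => Tm.yields_star.inr

/-- Both orders of two assertions return `a` with the product of the probabilities that the two
predicates hold at `a`. -/
theorem prob_assert_comm {p q t : Tm} (ht : t.Yields I g A)
    (hp : ∀ a ∈ A.interp I, p.Yields I [a] (.two : Ty C))
    (hq : ∀ a ∈ A.interp I, q.Yields I [a] (.two : Ty C)) :
    prob ((Tm.assert p t).doIn (Tm.assert q (.var 0))) g =
      prob ((Tm.assert q t).doIn (Tm.assert p (.var 0))) g :=
  eq_of_expect_eq fun F => by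
    simp only [Tm.assert, Tm.doIn, Tm.ret, Tm.fail, expect_prob_caseOf, expect_prob_instr,
      expect_prob_inl, expect_prob_inr, expect_prob_star, expect_prob_var_zero]
    refine ht.expect_congr fun a ha => ?_
    obtain ⟨p₁, p₂, hp1, hp⟩ := (hp a ha).exists_two
    obtain ⟨q₁, q₂, hq1, hq⟩ := (hq a ha).exists_two
    simp only [hp, hq, Value.tag, onSum_inl, onSum_inr]
    rw [← eq_sub_iff_add_eq'] at hp1 hq1
    rw [hp1, hq1]
    ring

theorem expect_doIn_proj₁ {b : Tm} (F : Value α → ℝ) :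
    expect (prob (b.doIn (Tm.var 0).proj₁) g) F = expect (prob b g)
      (onSum (onSum (fun a => F (.inl a)) fun _ => F (.inr .star)) fun _ => F (.inr .star)) := by
  simp [expect_prob_doIn, expect_prob_proj₁]

theorem expect_doIn_proj₂ {b : Tm} (F : Value α → ℝ) :
    expect (prob (b.doIn (Tm.var 0).proj₂) g) F = expect (prob b g)
      (onSum (onSum (fun _ => F (.inr .star)) fun a => F (.inl a)) fun _ => F (.inr .star)) := by
  simp [expect_prob_doIn, expect_prob_proj₂]

theorem expect_doIn_nabla {b : Tm} (F : Value α → ℝ) :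
    expect (prob (b.doIn (Tm.ret ((Tm.var 0).nabla 2))) g) F = expect (prob b g)
      (onSum (onSum (fun a => F (.inl a)) fun a => F (.inl a)) fun _ => F (.inr .star)) := by
  simp [expect_prob_doIn, Tm.ret, expect_prob_nabla, nablaFun]

theorem Tm.Yields.doIn_nabla {b : Tm} (hb : b.Yields I g (Ty.sum A A).partialTy) :
    (b.doIn (Tm.ret ((Tm.var 0).nabla 2))).Yields I g A.partialTy :=
  hb.caseOf (fun _ ha => ((Tm.yields_var rfl ha).caseOf (fun _ ha => Tm.yields_var rfl ha)
    fun _ ha => Tm.yields_var rfl ha).inl) fun _ _ => Tm.yields_star.inr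

theorem expect_onSum_onSum_split {φ : Value α → ℝ} (hφ : (Function.support φ).Finite)
    (f h k : Value α → ℝ) :
    expect φ (onSum (onSum f h) k) =
      expect φ (onSum (onSum f fun _ => 0) fun _ => 0) +
        expect φ (onSum (onSum (fun _ => 0) h) fun _ => 0) +
          expect φ (onSum (fun _ => 0) k) := by
  rw [expect_onSum_split hφ]
  congr 1
  rw [← expect_add hφ]
  refine congrArg _ (funext fun v => ?_)
  cases v with
  | inl x => cases x <;> simp [onSum]
  | _ => simp [onSum]

theorem Tm.Yields.expect_parts {b : Tm} (hb : b.Yields I g (Ty.sum A B).partialTy) :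
    expect (prob b g) (onSum (onSum (fun _ => 1) fun _ => 0) fun _ => 0) +
      expect (prob b g) (onSum (onSum (fun _ => 0) fun _ => 1) fun _ => 0) +
        expect (prob b g) (onSum (fun _ => 0) fun _ => 1) = 1 := by
  rw [← expect_onSum_onSum_split (support_prob_finite b g)]
  refine Eq.trans ?_ hb.expect_one
  rw [hb.expect_eq_onSum fun _ => 1]
  refine hb.expect_onSum_congr (fun x hx => ?_) fun _ _ => rfl
  obtain ⟨a, _, rfl⟩ | ⟨a, _, rfl⟩ := Ty.mem_interp_sum.1 hx <;> rfl

/-- If `b` bounds `s` and `t`, then `s ⊻ t` is what `b` computes when its two sides are merged. -/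
theorem prob_psum_eq {s t b : Tm} (hs : s.Yields I g A.partialTy) (ht : t.Yields I g A.partialTy)
    (hb : b.Yields I g (Ty.sum A A).partialTy)
    (h₁ : prob (b.doIn (Tm.var 0).proj₁) g = prob s g)
    (h₂ : prob (b.doIn (Tm.var 0).proj₂) g = prob t g) :
    prob (.psum s t) g = prob (b.doIn (Tm.ret ((Tm.var 0).nabla 2))) g :=
  eq_of_expect_eq fun F => by
    have hf := support_prob_finite b g
    rw [expect_prob_psum, hs.prob_fail, ht.prob_fail, ← h₁, ← h₂, expect_doIn_nabla,
      expect_onSum_onSum_split hf]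
    simp only [expect_doIn_proj₁, expect_doIn_proj₂, onSum_inl, onSum_inr]
    rw [expect_onSum_onSum_split hf (fun _ => 0) (fun _ => 1),
      expect_onSum_onSum_split hf (fun _ => 1) (fun _ => 0),
      expect_onSum_const_right hf (F (.inr .star))]
    simp only [onSum_zero, expect_zero]
    -- the masses of failure of `s` and `t` count both the failure of `b` and the other side
    linear_combination F (.inr .star) * hb.expect_parts

/-- The two partial projections are jointly monic. -/
theorem prob_eq_of_proj_eq {s t : Tm} (hs : s.Yields I g (Ty.sum A B).partialTy)
    (ht : t.Yields I g (Ty.sum A B).partialTy)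
    (h₁ : prob (s.doIn (Tm.var 0).proj₁) g = prob (t.doIn (Tm.var 0).proj₁) g)
    (h₂ : prob (s.doIn (Tm.var 0).proj₂) g = prob (t.doIn (Tm.var 0).proj₂) g) :
    prob s g = prob t g := by
  have e₁ : ∀ f, expect (prob s g) (onSum (onSum f fun _ => 0) fun _ => 0) =
      expect (prob t g) (onSum (onSum f fun _ => 0) fun _ => 0) := fun f => by
    have := congrArg (fun φ => expect φ (onSum f fun _ => 0)) h₁
    simpa [expect_doIn_proj₁] using this
  have e₂ : ∀ f, expect (prob s g) (onSum (onSum (fun _ => 0) f) fun _ => 0) =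
      expect (prob t g) (onSum (onSum (fun _ => 0) f) fun _ => 0) := fun f => by
    have := congrArg (fun φ => expect φ (onSum f fun _ => 0)) h₂
    simpa [expect_doIn_proj₂] using this
  have hsplit : ∀ {r : Tm}, r.Yields I g (Ty.sum A B).partialTy → ∀ F : Value α → ℝ,
      expect (prob r g) F =
        expect (prob r g) (onSum (onSum (fun a => F (.inl (.inl a))) fun _ => 0) fun _ => 0) +
        expect (prob r g) (onSum (onSum (fun _ => 0) fun b => F (.inl (.inr b))) fun _ => 0) +
          F (.inr .star) * expect (prob r g) (onSum (fun _ => 0) fun _ => 1) := by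
    intro r hr F
    have hf := support_prob_finite r g
    rw [← expect_onSum_const_right hf, ← expect_onSum_onSum_split hf, hr.expect_eq_onSum]
    refine hr.expect_onSum_congr (fun x hx => ?_) fun x hx => by rw [Ty.mem_interp_one.1 hx]
    obtain ⟨a, _, rfl⟩ | ⟨a, _, rfl⟩ := Ty.mem_interp_sum.1 hx <;> rfl
  -- the probability of failure is the mass that the two projections leave
  have e₃ : expect (prob s g) (onSum (fun _ => 0) fun _ => 1) =
      expect (prob t g) (onSum (fun _ => 0) fun _ => 1) := by
    linarith [hs.expect_parts, ht.expect_parts, e₁ fun _ => 1, e₂ fun _ => 1]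
  exact eq_of_expect_eq fun F => by rw [hsplit hs, hsplit ht, e₁, e₂, e₃]

theorem IsDistributionOn.expect_mono {X : Type*} {S : Set X} {φ : X → ℝ}
    (h : IsDistributionOn S φ) {F G : X → ℝ} (hFG : ∀ x ∈ S, F x ≤ G x) :
    expect φ F ≤ expect φ G := by
  have h1 := h.expect_nonneg (F := fun x => G x + -1 * F x) fun x hx => by
    linarith [hFG x hx]
  rw [expect_add h.support_finite, expect_const_mul h.support_finite] at h1
  linarith

theorem prob_inl_le_of_bound {s t b : Tm} (hb : b.Yields I g (Ty.sum A A).partialTy)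
    (h₁ : prob (b.doIn (Tm.var 0).proj₁) g = prob s g)
    (h₂ : prob (b.doIn (Tm.ret ((Tm.var 0).nabla 2))) g = prob t g) (a : Value α) :
    prob s g (.inl a) ≤ prob t g (.inl a) := by
  have hnn : ∀ x : Value α, 0 ≤ dirac x (.inl a) := fun x => by
    unfold dirac; split_ifs <;> norm_num
  rw [← expect_dirac_right (prob s g), ← expect_dirac_right (prob t g), ← h₁, ← h₂,
    expect_doIn_proj₁, expect_doIn_nabla]
  refine hb.expect_mono fun x hx => ?_
  obtain ⟨x, hx', rfl⟩ | ⟨x, -, rfl⟩ := Ty.mem_interp_sum.1 hx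
  · obtain ⟨y, -, rfl⟩ | ⟨y, -, rfl⟩ := Ty.mem_interp_sum.1 hx'
    · exact le_rfl
    · simpa [dirac_of_ne] using hnn _
  · exact le_rfl

/-- The formula for `0 · t = fail` is included: the weight of failure is then `0 - (0 - 1) = 1`. -/
theorem expect_prob_nsum {t : Tm} {p q : ℝ}
    (ht : ∀ F : Value α → ℝ, expect (prob t g) F = p * F (.inl .star) + q * F (.inr .star)) :
    ∀ (m : ℕ) (F : Value α → ℝ), expect (prob (Tm.nsum m t) g) F =
      m * p * F (.inl .star) + (m * q - (m - 1)) * F (.inr .star)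
  | 0, F => by simp [Tm.nsum, Tm.fail]
  | 1, F => by simp [Tm.nsum, ht]
  | m + 2, F => by
    have hs := expect_prob_nsum ht (m + 1)
    rw [Tm.nsum, expect_prob_psum, ← expect_dirac_right (prob t g),
      ← expect_dirac_right (prob (Tm.nsum (m + 1) t) g), hs, hs, ht, ht]
    simp only [onSum_inl, onSum_inr, dirac_self,
      dirac_of_ne (show Value.inl (Value.star : Value α) ≠ .inr .star by simp)]
    push_cast
    ring

theorem Tm.yields_top : Tm.top.Yields I g (.two : Ty C) := Tm.yields_star.inl

theorem Tm.yields_frac {n : ℕ} (hn : 2 ≤ n) : (Tm.frac n).Yields I g (.two : Ty C) := by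
  have hn' : (2 : ℝ) ≤ n := by exact_mod_cast hn
  refine .of_expect ?_ fun F hF => ?_
  · rw [expect_prob_frac]
    field_simp
    ring
  · rw [expect_prob_frac]
    have h1 := hF (.inl .star) (Ty.inl_mem rfl)
    have h2 := hF (.inr .star) (Ty.inr_mem rfl)
    have : 0 ≤ (n : ℝ) - 1 := by linarith
    positivity

theorem Tm.yields_bound {m n : ℕ} (hn : 2 ≤ n) (hmn : m < n) :
    (Tm.bound m n).Yields I g (.fin 3 : Ty C) := by
  have hn' : (2 : ℝ) ≤ n := by exact_mod_cast hn
  have hmn' : (m : ℝ) + 1 ≤ n := by exact_mod_cast hmn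
  refine .of_expect ?_ fun F hF => ?_
  · rw [expect_prob_bound]
    field_simp
    ring
  · rw [expect_prob_bound]
    have h1 := hF (.inl (.inl .star)) (Ty.inl_mem (Ty.inl_mem rfl))
    have h2 := hF (.inl (.inr .star)) (Ty.inl_mem (Ty.inr_mem rfl))
    have h3 := hF (.inr .star) (Ty.inr_mem rfl)
    have : 0 ≤ (n : ℝ) - m - 1 := by linarith
    positivity

/-- The probability by which `norm t` divides is that of `t` returning a value. -/
theorem Tm.Yields.one_sub_prob_fail {t : Tm} (ht : t.Yields I g A.partialTy) :
    1 - prob t g (.inr .star) = expect (prob t g) (onSum (fun _ => 1) fun _ => 0) := by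
  rw [ht.prob_fail]
  linarith [ht.expect_inl_add_expect_inr]

/-- A lower bound `1 / n ≤ t↓` keeps the divisor in `norm t` away from zero. -/
theorem Tm.Yields.prob_fail_lt_one {t : Tm} {n : ℕ} (hn : 2 ≤ n)
    (ht : t.Yields I g A.partialTy)
    (h : prob (.frac n) g (.inl .star) ≤ prob t.dom g (.inl (.star : Value α))) :
    0 < 1 - prob t g (.inr .star) := by
  rw [ht.one_sub_prob_fail]
  have h1 : prob t.dom g (.inl (.star : Value α)) =
      expect (prob t g) (onSum (fun _ => 1) fun _ => 0) := by
    rw [← expect_dirac_right (prob t.dom g), expect_prob_dom]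
    simp [dirac_of_ne]
  rw [← h1]
  refine lt_of_lt_of_le ?_ h
  rw [prob]
  have : 0 < n := by omega
  positivity

theorem Tm.Yields.normal {t : Tm} (ht : t.Yields I g A.partialTy)
    (h : 0 < 1 - prob t g (.inr .star)) : (Tm.normal t).Yields I g A :=
  .of_expect (by
      rw [expect_prob_normal, ← ht.one_sub_prob_fail, inv_mul_cancel₀ h.ne'])
    fun F hF => by
      rw [expect_prob_normal]
      exact mul_nonneg (inv_nonneg.2 h.le) (ht.expect_onSum_nonneg hF fun _ _ => le_rfl)

/-- Running `t` for its success only, and then returning `ρ`. -/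
theorem expect_doIn_ret {t ρ ρ' : Tm} (ht : t.Yields I g A.partialTy)
    (hρ : ∀ a, prob ρ (a :: g) = prob ρ' g) (F : Value α → ℝ) :
    expect (prob (t.doIn (.ret ρ)) g) F =
      expect (prob ρ' g) (fun a => F (.inl a)) * (1 - prob t g (.inr .star)) +
        F (.inr .star) * prob t g (.inr .star) := by
  have hf := support_prob_finite t g
  rw [expect_prob_doIn, ht.one_sub_prob_fail, ht.prob_fail, ← expect_onSum_const_left hf,
    ← expect_onSum_const_right hf, ← expect_onSum_split hf]
  simp only [Tm.ret, expect_prob_inl, hρ]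

end Constructions

/-! ### Contexts -/

section Contexts

variable {C α : Type*} {I : C → Set α} {A B : Ty C} {Γ Δ : List (Ty C)}

theorem length_eq_of_mem_interpCtx {g : List (Value α)} (h : g ∈ interpCtx I Γ) :
    g.length = Γ.length := List.Forall₂.length_eq h

theorem nil_mem_interpCtx : ([] : List (Value α)) ∈ interpCtx I [] := List.Forall₂.nil

theorem cons_mem_interpCtx {a : Value α} {g : List (Value α)} (ha : a ∈ A.interp I)
    (h : g ∈ interpCtx I Γ) : a :: g ∈ interpCtx I (A :: Γ) := List.Forall₂.cons ha h

theorem exists_of_mem_interpCtx_cons {g : List (Value α)} (h : g ∈ interpCtx I (A :: Γ)) :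
    ∃ a ∈ A.interp I, ∃ g' ∈ interpCtx I Γ, g = a :: g' := by
  cases h with
  | cons ha hg => exact ⟨_, ha, _, hg, rfl⟩

theorem exists_of_mem_interpCtx_append : ∀ {Δ : List (Ty C)} {g : List (Value α)},
    g ∈ interpCtx I (Δ ++ Γ) →
      ∃ d ∈ interpCtx I Δ, ∃ g' ∈ interpCtx I Γ, g = d ++ g'
  | [], g, h => ⟨[], nil_mem_interpCtx, g, h, rfl⟩
  | A :: Δ, _, h => by
    obtain ⟨a, ha, g, hg, rfl⟩ := exists_of_mem_interpCtx_cons h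
    obtain ⟨d, hd, g', hg', rfl⟩ := exists_of_mem_interpCtx_append hg
    exact ⟨a :: d, cons_mem_interpCtx ha hd, g', hg', rfl⟩

theorem append_mem_interpCtx : ∀ {Δ : List (Ty C)} {d g : List (Value α)},
    d ∈ interpCtx I Δ → g ∈ interpCtx I Γ → d ++ g ∈ interpCtx I (Δ ++ Γ)
  | [], _, _, hd, hg => by cases hd; exact hg
  | A :: Δ, _, _, hd, hg => by
    obtain ⟨a, ha, d, hd', rfl⟩ := exists_of_mem_interpCtx_cons hd
    exact cons_mem_interpCtx ha (append_mem_interpCtx hd' hg)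

theorem exists_getElem?_of_mem_interpCtx {g : List (Value α)} (h : g ∈ interpCtx I Γ) {i : ℕ}
    (hi : Γ[i]? = some A) : ∃ a ∈ A.interp I, g[i]? = some a := by
  induction h generalizing i with
  | nil => simp at hi
  | cons ha _ ih =>
    cases i with
    | zero =>
      obtain rfl := Option.some_injective _ hi
      exact ⟨_, ha, rfl⟩
    | succ i => exact ih hi

theorem prob_shift_zero {t : Tm} {k : ℕ} {w : List (Value α)} (g : List (Value α))
    (hk : k = w.length) : prob (t.shift 0 k) (w ++ g) = prob t g :=
  prob_rename fun i _ => by simp [hk, List.getElem?_append_right]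

theorem getElem?_swap {α : Type*} (d g : List α) (a b : α) (i : ℕ) :
    (d ++ a :: b :: g)[Equiv.swap d.length (d.length + 1) i]? = (d ++ b :: a :: g)[i]? := by
  rw [Equiv.swap_apply_def]
  split_ifs with h1 h2
  · subst h1; simp
  · subst h2; simp
  · rcases lt_or_ge i d.length with h | h
    · rw [List.getElem?_append_left h, List.getElem?_append_left h]
    · obtain ⟨j, rfl⟩ : ∃ j, i = d.length + (j + 2) := ⟨i - d.length - 2, by omega⟩
      simp [List.getElem?_append_right]

end Contexts

/-! ### Soundness of the rules -/

section Soundness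

variable {C α : Type*}

/-- The semantic counterpart of derivability.  Besides what soundness claims, it records how
variables are used, on which weakening, exchange and substitution depend, and it requires both
sides of an equation to produce distributions. -/
def Judgement.Valid (I : C → Set α) (Γ : List (Ty C)) : Judgement C → Prop
  | .typ t A => t.Linear ∧ t.Scoped Γ.length ∧ ∀ g ∈ interpCtx I Γ, t.Yields I g A
  | .eq s t A => s.Scoped Γ.length ∧ t.Scoped Γ.length ∧
      ∀ g ∈ interpCtx I Γ, s.Yields I g A ∧ prob s g = prob t g
  | .le s t _ => ∀ g ∈ interpCtx I Γ, ∀ a, prob s g (.inl a) ≤ prob t g (.inl a)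

variable {I : C → Set α} {Γ Δ Θ : List (Ty C)} {A B D E F : Ty C}

theorem valid_eq_of_left {s t : Tm} (hs : s.Scoped Γ.length) (ht : t.Scoped Γ.length)
    (h : ∀ g ∈ interpCtx I Γ, s.Yields I g A ∧ prob s g = prob t g) :
    (Judgement.eq s t A).Valid I Γ := ⟨hs, ht, h⟩

theorem valid_eq_of_right {s t : Tm} (hs : s.Scoped Γ.length) (ht : t.Scoped Γ.length)
    (h : ∀ g ∈ interpCtx I Γ, t.Yields I g A ∧ prob s g = prob t g) :
    (Judgement.eq s t A).Valid I Γ :=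
  ⟨hs, ht, fun g hg => ⟨(h g hg).1.of_prob_eq (h g hg).2, (h g hg).2⟩⟩

theorem Judgement.Valid.exch {J : Judgement C} (h : J.Valid I (Δ ++ B :: A :: Γ)) :
    (J.rename (Equiv.swap Δ.length (Δ.length + 1))).Valid I (Δ ++ A :: B :: Γ) := by
  have hscope : ∀ {t : Tm}, t.Scoped (Δ ++ B :: A :: Γ).length →
      (t.rename (Equiv.swap Δ.length (Δ.length + 1))).Scoped (Δ ++ A :: B :: Γ).length :=
    fun ht => ht.rename fun i hi => by
      simp only [List.length_append, List.length_cons] at hi ⊢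
      rw [Equiv.swap_apply_def]
      split_ifs <;> omega
  have hprob : ∀ g ∈ interpCtx I (Δ ++ A :: B :: Γ), ∃ g' ∈ interpCtx I (Δ ++ B :: A :: Γ),
      ∀ t : Tm, prob (t.rename (Equiv.swap Δ.length (Δ.length + 1))) g = prob t g' := by
    intro g hg
    obtain ⟨d, hd, _, hg₁, rfl⟩ := exists_of_mem_interpCtx_append hg
    obtain ⟨a, ha, _, hg₂, rfl⟩ := exists_of_mem_interpCtx_cons hg₁
    obtain ⟨b, hb, g, hg₃, rfl⟩ := exists_of_mem_interpCtx_cons hg₂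
    refine ⟨d ++ b :: a :: g, append_mem_interpCtx hd (cons_mem_interpCtx hb
      (cons_mem_interpCtx ha hg₃)), fun t => ?_⟩
    rw [← length_eq_of_mem_interpCtx hd]
    exact prob_rename fun i _ => getElem?_swap d g a b i
  cases J with
  | typ t A =>
    refine ⟨h.1.rename (Equiv.injective _), hscope h.2.1, fun g hg => ?_⟩
    obtain ⟨g', hg', hp⟩ := hprob g hg
    exact (h.2.2 g' hg').of_prob_eq (hp t)
  | eq s t A =>
    refine ⟨hscope h.1, hscope h.2.1, fun g hg => ?_⟩
    obtain ⟨g', hg', hp⟩ := hprob g hg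
    exact ⟨(h.2.2 g' hg').1.of_prob_eq (hp s), by rw [hp, hp, (h.2.2 g' hg').2]⟩
  | le s t A =>
    intro g hg a
    obtain ⟨g', hg', hp⟩ := hprob g hg
    rw [hp, hp]
    exact h g' hg' a

/-- An input for the context `Γ, Δ` splits into inputs for `Γ` and `Δ`. -/
theorem forall_mem_interpCtx_append {P : List (Value α) → Prop}
    (h : ∀ d ∈ interpCtx I Δ, ∀ g ∈ interpCtx I Γ, Δ.length = d.length → P (d ++ g)) :
    ∀ g ∈ interpCtx I (Δ ++ Γ), P g := fun _ hdg => by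
  obtain ⟨d, hd, g, hg, rfl⟩ := exists_of_mem_interpCtx_append hdg
  exact h d hd g hg (length_eq_of_mem_interpCtx hd).symm

theorem forall_mem_interpCtx_append₂ {P : List (Value α) → Prop}
    (h : ∀ e ∈ interpCtx I Θ, ∀ d ∈ interpCtx I Δ, ∀ g ∈ interpCtx I Γ,
      Θ.length = e.length → Δ.length = d.length → P (e ++ (d ++ g))) :
    ∀ g ∈ interpCtx I (Θ ++ (Δ ++ Γ)), P g :=
  forall_mem_interpCtx_append fun e he _ hdg hle => by
    obtain ⟨d, hd, g, hg, rfl⟩ := exists_of_mem_interpCtx_append hdg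
    exact h e he d hd g hg hle (length_eq_of_mem_interpCtx hd).symm

theorem prob_shift_zero₂ {t : Tm} {e d : List (Value α)} (g : List (Value α)) {k l : ℕ}
    (hk : k = e.length) (hl : l = d.length) :
    prob (t.shift 0 (k + l)) (e ++ (d ++ g)) = prob t g := by
  rw [← List.append_assoc]
  exact prob_shift_zero g (by simp [hk, hl])

theorem prob_append_of_mem {t : Tm} {d : List (Value α)} (g : List (Value α))
    (hd : d ∈ interpCtx I Δ) (ht : t.Scoped Δ.length) : prob t (d ++ g) = prob t d :=
  prob_append g (length_eq_of_mem_interpCtx hd ▸ ht)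

theorem prob_shift_of_mem {t : Tm} {k l : ℕ} {u w v z : List (Value α)}
    (huv : u ++ v ∈ interpCtx I Δ) (ht : t.Scoped Δ.length) (hk : k = u.length)
    (hl : l = w.length) : prob (t.shift k l) (u ++ (w ++ (v ++ z))) = prob t (u ++ v) :=
  prob_shift u w v z hk hl (by
    rw [← List.length_append, length_eq_of_mem_interpCtx huv]
    exact ht)

/-! #### Tensor products -/

theorem valid_pair {s t : Tm} (hs : (Judgement.typ s A).Valid I Γ)
    (ht : (Judgement.typ t B).Valid I Δ) :
    (Judgement.typ (.pair (s.shift 0 Δ.length) t) (.tensor A B)).Valid I (Δ ++ Γ) := by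
  refine ⟨⟨hs.1.shift _ _, ht.1, fun i hi hi' => ?_⟩, Tm.scoped_pair.2
    ⟨hs.2.1.shift _ _ (by simp; omega), ht.2.1.mono (by simp)⟩,
    forall_mem_interpCtx_append fun d hd g hg hl => ?_⟩
  · have := le_of_free_shift hi
    have := ht.2.1 i hi'
    omega
  · exact ((hs.2.2 g hg).of_prob_eq (prob_shift_zero g hl)).pair
      ((ht.2.2 d hd).of_prob_eq (prob_append_of_mem g hd ht.2.1))

theorem valid_letPair {s t : Tm} (hs : (Judgement.typ s (.tensor A B)).Valid I Γ)
    (ht : (Judgement.typ t D).Valid I (B :: A :: Δ)) :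
    (Judgement.typ (.letPair (s.shift 0 Δ.length) t) D).Valid I (Δ ++ Γ) := by
  refine ⟨⟨hs.1.shift _ _, ht.1, fun i hi hi' => ?_⟩, Tm.scoped_letPair.2
    ⟨hs.2.1.shift _ _ (by simp; omega), ht.2.1.mono (by simp)⟩,
    forall_mem_interpCtx_append fun d hd g hg hl => ?_⟩
  · have := le_of_free_shift hi
    have := ht.2.1 _ hi'
    simp only [List.length_cons] at this
    omega
  · refine ((hs.2.2 g hg).of_prob_eq (prob_shift_zero g hl)).letPair fun a ha b hb => ?_
    have hab := cons_mem_interpCtx hb (cons_mem_interpCtx ha hd)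
    exact (ht.2.2 _ hab).of_prob_eq (prob_append_of_mem g hab ht.2.1)

theorem valid_pair_eq {s s' t t' : Tm} (hs : (Judgement.eq s s' A).Valid I Γ)
    (ht : (Judgement.eq t t' B).Valid I Δ) :
    (Judgement.eq (.pair (s.shift 0 Δ.length) t) (.pair (s'.shift 0 Δ.length) t')
      (.tensor A B)).Valid I (Δ ++ Γ) := by
  refine valid_eq_of_left
    (Tm.scoped_pair.2 ⟨hs.1.shift _ _ (by simp; omega), ht.1.mono (by simp)⟩)
    (Tm.scoped_pair.2 ⟨hs.2.1.shift _ _ (by simp; omega), ht.2.1.mono (by simp)⟩)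
    (forall_mem_interpCtx_append fun d hd g hg hl => ⟨?_, eq_of_expect_eq fun F => ?_⟩)
  · exact ((hs.2.2 g hg).1.of_prob_eq (prob_shift_zero g hl)).pair
      ((ht.2.2 d hd).1.of_prob_eq (prob_append_of_mem g hd ht.1))
  · simp only [expect_prob_pair, prob_shift_zero g hl, prob_append_of_mem g hd ht.1,
      prob_append_of_mem g hd ht.2.1, (hs.2.2 g hg).2, (ht.2.2 d hd).2]

theorem valid_letPair_eq {s s' t t' : Tm} (hs : (Judgement.eq s s' (.tensor A B)).Valid I Γ)
    (ht : (Judgement.eq t t' D).Valid I (B :: A :: Δ)) :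
    (Judgement.eq (.letPair (s.shift 0 Δ.length) t) (.letPair (s'.shift 0 Δ.length) t')
      D).Valid I (Δ ++ Γ) := by
  refine valid_eq_of_left
    (Tm.scoped_letPair.2 ⟨hs.1.shift _ _ (by simp; omega), ht.1.mono (by simp)⟩)
    (Tm.scoped_letPair.2 ⟨hs.2.1.shift _ _ (by simp; omega), ht.2.1.mono (by simp)⟩)
    (forall_mem_interpCtx_append fun d hd g hg hl => ?_)
  have hs' := (hs.2.2 g hg).1.of_prob_eq (prob_shift_zero (k := Δ.length) g hl)
  refine ⟨hs'.letPair fun a ha b hb => ?_, eq_of_expect_eq fun F => ?_⟩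
  · have hab := cons_mem_interpCtx hb (cons_mem_interpCtx ha hd)
    exact (ht.2.2 _ hab).1.of_prob_eq (prob_append_of_mem g hab ht.1)
  · rw [expect_prob_letPair, expect_prob_letPair, prob_shift_zero (t := s') g hl,
      ← (hs.2.2 g hg).2, ← prob_shift_zero (t := s) g hl]
    refine hs'.expect_onPair_congr fun a ha b hb => ?_
    have hab := cons_mem_interpCtx hb (cons_mem_interpCtx ha hd)
    have h1 := prob_append_of_mem g hab ht.1
    have h2 := prob_append_of_mem g hab ht.2.1
    simp only [List.cons_append] at h1 h2
    rw [h1, h2, (ht.2.2 _ hab).2]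

theorem valid_beta_tensor {r s t : Tm} (hr : (Judgement.typ r A).Valid I Γ)
    (hs : (Judgement.typ s B).Valid I Δ) (ht : (Judgement.typ t D).Valid I (B :: A :: Θ)) :
    (Judgement.eq
      (.letPair (.pair (r.shift 0 (Θ.length + Δ.length)) (s.shift 0 Θ.length)) t)
      (t.inst₂ (r.shift 0 (Θ.length + Δ.length)) (s.shift 0 Θ.length)) D).Valid I
        (Θ ++ (Δ ++ Γ)) := by
  have hr' : (r.shift 0 (Θ.length + Δ.length)).Scoped (Θ ++ (Δ ++ Γ)).length :=
    hr.2.1.shift _ _ (by simp; omega)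
  have hs' : (s.shift 0 Θ.length).Scoped (Θ ++ (Δ ++ Γ)).length :=
    hs.2.1.shift _ _ (by simp; omega)
  refine valid_eq_of_left
    (Tm.scoped_letPair.2 ⟨Tm.scoped_pair.2 ⟨hr', hs'⟩, ht.2.1.mono (by simp)⟩)
    (ht.2.1.inst₂ (by simp) hr' hs')
    (forall_mem_interpCtx_append₂ fun e he d hd g hg hle hld => ?_)
  have hr'' := (hr.2.2 g hg).of_prob_eq (prob_shift_zero₂ (t := r) g hle hld)
  have hs'' := (hs.2.2 d hd).of_prob_eq ((prob_shift_zero (d ++ g) hle).trans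
    (prob_append_of_mem g hd hs.2.1))
  refine ⟨(hr''.pair hs'').letPair fun a ha b hb => ?_, eq_of_expect_eq fun F => ?_⟩
  · have hab := cons_mem_interpCtx hb (cons_mem_interpCtx ha he)
    exact (ht.2.2 _ hab).of_prob_eq (prob_append_of_mem (d ++ g) hab ht.2.1)
  · rw [expect_inst₂ ht.1 hr''.expect_one hs''.expect_one]
    simp

theorem valid_eta_tensor {t : Tm} (ht : (Judgement.typ t (.tensor A B)).Valid I Γ) :
    (Judgement.eq (.letPair t (.pair (.var 1) (.var 0))) t (.tensor A B)).Valid I Γ :=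
  valid_eq_of_right
    (Tm.scoped_letPair.2 ⟨ht.2.1, Tm.scoped_pair.2
      ⟨Tm.scoped_var.2 (by omega), Tm.scoped_var.2 (by omega)⟩⟩) ht.2.1
    fun g hg => ⟨ht.2.2 g hg, eq_of_expect_eq fun F => by
      simp [(ht.2.2 g hg).expect_eq_onPair F]⟩

theorem valid_let_let {r s t : Tm} (hr : (Judgement.typ r (.tensor A B)).Valid I Γ)
    (hs : (Judgement.typ s (.tensor D E)).Valid I (B :: A :: Δ))
    (ht : (Judgement.typ t F).Valid I (E :: D :: Θ)) :
    (Judgement.eq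
      (.letPair (r.shift 0 (Θ.length + Δ.length))
        (.letPair (s.shift 2 Θ.length) (t.shift 2 2)))
      (.letPair (.letPair (r.shift 0 (Θ.length + Δ.length)) (s.shift 2 Θ.length)) t) F).Valid I
        (Θ ++ (Δ ++ Γ)) := by
  have hr' : (r.shift 0 (Θ.length + Δ.length)).Scoped (Θ ++ (Δ ++ Γ)).length :=
    hr.2.1.shift _ _ (by simp; omega)
  have hs' : (s.shift 2 Θ.length).Scoped ((Θ ++ (Δ ++ Γ)).length + 2) :=
    hs.2.1.shift _ _ (by simp; omega)
  refine valid_eq_of_right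
    (Tm.scoped_letPair.2 ⟨hr', Tm.scoped_letPair.2 ⟨hs', ht.2.1.shift _ _ (by simp)⟩⟩)
    (Tm.scoped_letPair.2 ⟨Tm.scoped_letPair.2 ⟨hr', hs'⟩, ht.2.1.mono (by simp)⟩)
    (forall_mem_interpCtx_append₂ fun e he d hd g hg hle hld => ?_)
  have hr'' := (hr.2.2 g hg).of_prob_eq (prob_shift_zero₂ (t := r) g hle hld)
  have hs'' : ∀ a ∈ A.interp I, ∀ b ∈ B.interp I,
      (s.shift 2 Θ.length).Yields I (b :: a :: (e ++ (d ++ g))) (.tensor D E) :=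
    fun a ha b hb => by
      have hab := cons_mem_interpCtx hb (cons_mem_interpCtx ha hd)
      exact (hs.2.2 _ hab).of_prob_eq (prob_shift_of_mem (u := [b, a]) hab hs.2.1 rfl hle)
  refine ⟨(hr''.letPair hs'').letPair fun z hz w hw => ?_, eq_of_expect_eq fun F => ?_⟩
  · have hzw := cons_mem_interpCtx hw (cons_mem_interpCtx hz he)
    exact (ht.2.2 _ hzw).of_prob_eq (prob_append_of_mem (d ++ g) hzw ht.2.1)
  · simp only [expect_prob_letPair]
    refine hr''.expect_onPair_congr fun a ha b hb =>
      (hs'' a ha b hb).expect_onPair_congr fun z hz w hw => ?_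
    have hzw := cons_mem_interpCtx hw (cons_mem_interpCtx hz he)
    exact congrArg (expect · F) ((prob_shift_of_mem (u := [w, z]) (w := [b, a]) hzw ht.2.1 rfl
      rfl).trans (prob_append_of_mem (d ++ g) hzw ht.2.1).symm)

theorem valid_let_pair {r s t : Tm} (hr : (Judgement.typ r (.tensor A B)).Valid I Γ)
    (hs : (Judgement.typ s D).Valid I (B :: A :: Δ)) (ht : (Judgement.typ t E).Valid I Θ) :
    (Judgement.eq
      (.pair (.letPair (r.shift 0 (Θ.length + Δ.length)) (s.shift 2 Θ.length)) t)
      (.letPair (r.shift 0 (Θ.length + Δ.length))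
        (.pair (s.shift 2 Θ.length) (t.shift 0 2))) (.tensor D E)).Valid I (Θ ++ (Δ ++ Γ)) := by
  have hr' : (r.shift 0 (Θ.length + Δ.length)).Scoped (Θ ++ (Δ ++ Γ)).length :=
    hr.2.1.shift _ _ (by simp; omega)
  have hs' : (s.shift 2 Θ.length).Scoped ((Θ ++ (Δ ++ Γ)).length + 2) :=
    hs.2.1.shift _ _ (by simp; omega)
  refine valid_eq_of_left
    (Tm.scoped_pair.2 ⟨Tm.scoped_letPair.2 ⟨hr', hs'⟩, ht.2.1.mono (by simp)⟩)
    (Tm.scoped_letPair.2 ⟨hr', Tm.scoped_pair.2 ⟨hs', ht.2.1.shift _ _ (by simp)⟩⟩)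
    (forall_mem_interpCtx_append₂ fun e he d hd g hg hle hld => ?_)
  have hr'' := (hr.2.2 g hg).of_prob_eq (prob_shift_zero₂ (t := r) g hle hld)
  refine ⟨(hr''.letPair fun a ha b hb => ?_).pair
    ((ht.2.2 e he).of_prob_eq (prob_append_of_mem (d ++ g) he ht.2.1)),
    eq_of_expect_eq fun F => ?_⟩
  · have hab := cons_mem_interpCtx hb (cons_mem_interpCtx ha hd)
    exact (hs.2.2 _ hab).of_prob_eq (prob_shift_of_mem (u := [b, a]) hab hs.2.1 rfl hle)
  · have ht' : ∀ a b, prob (t.shift 0 2) (b :: a :: (e ++ (d ++ g))) = prob t (e ++ (d ++ g)) :=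
      fun a b => prob_shift_zero (w := [b, a]) _ rfl
    simp only [expect_prob_letPair, expect_prob_pair, ht']

/-! #### Coproducts -/

theorem valid_eta_zero {s t : Tm} (hs : (Judgement.typ s .zero).Valid I Γ)
    (ht : (Judgement.typ t A).Valid I Γ) : (Judgement.eq (.magic s) t A).Valid I Γ := by
  refine valid_eq_of_right hs.2.1 ht.2.1 fun g hg => ?_
  -- no distribution lives on the empty set, so there is no input
  have h1 := (hs.2.2 g hg).expect_one
  rw [(hs.2.2 g hg).expect_congr (G := fun _ => 0) fun x hx => hx.elim, expect_zero] at h1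
  exact absurd h1 zero_ne_one

theorem valid_magic {t : Tm} (ht : (Judgement.typ t .zero).Valid I Γ) :
    (Judgement.typ (.magic t) A).Valid I Γ := by
  refine ⟨ht.1, ht.2.1, fun g hg => ?_⟩
  have h1 := (ht.2.2 g hg).expect_one
  rw [(ht.2.2 g hg).expect_congr (G := fun _ => 0) fun x hx => hx.elim, expect_zero] at h1
  exact absurd h1 zero_ne_one

theorem valid_inl_eq {t t' : Tm} (ht : (Judgement.eq t t' A).Valid I Γ) :
    (Judgement.eq (.inl t) (.inl t') (.sum A B)).Valid I Γ :=
  valid_eq_of_left ht.1 ht.2.1 fun g hg => ⟨(ht.2.2 g hg).1.inl, eq_of_expect_eq fun F => by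
    rw [expect_prob_inl, expect_prob_inl, (ht.2.2 g hg).2]⟩

theorem valid_inr_eq {t t' : Tm} (ht : (Judgement.eq t t' B).Valid I Γ) :
    (Judgement.eq (.inr t) (.inr t') (.sum A B)).Valid I Γ :=
  valid_eq_of_left ht.1 ht.2.1 fun g hg => ⟨(ht.2.2 g hg).1.inr, eq_of_expect_eq fun F => by
    rw [expect_prob_inr, expect_prob_inr, (ht.2.2 g hg).2]⟩

theorem valid_caseOf {r s t : Tm} (hr : (Judgement.typ r (.sum A B)).Valid I Γ)
    (hs : (Judgement.typ s D).Valid I (A :: Δ)) (ht : (Judgement.typ t D).Valid I (B :: Δ)) :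
    (Judgement.typ (.caseOf (r.shift 0 Δ.length) s t) D).Valid I (Δ ++ Γ) := by
  refine ⟨⟨hr.1.shift _ _, hs.1, ht.1, fun i hi => ⟨fun hi' => ?_, fun hi' => ?_⟩⟩,
    Tm.scoped_caseOf.2 ⟨hr.2.1.shift _ _ (by simp; omega), hs.2.1.mono (by simp),
      ht.2.1.mono (by simp)⟩,
    forall_mem_interpCtx_append fun d hd g hg hl => ?_⟩
  · have := le_of_free_shift hi
    have := hs.2.1 _ hi'
    simp only [List.length_cons] at this
    omega
  · have := le_of_free_shift hi
    have := ht.2.1 _ hi'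
    simp only [List.length_cons] at this
    omega
  · refine ((hr.2.2 g hg).of_prob_eq (prob_shift_zero g hl)).caseOf (fun a ha => ?_) fun b hb => ?_
    · have had := cons_mem_interpCtx ha hd
      exact (hs.2.2 _ had).of_prob_eq (prob_append_of_mem g had hs.2.1)
    · have hbd := cons_mem_interpCtx hb hd
      exact (ht.2.2 _ hbd).of_prob_eq (prob_append_of_mem g hbd ht.2.1)

theorem valid_caseOf_eq {r r' s s' t t' : Tm} (hr : (Judgement.eq r r' (.sum A B)).Valid I Γ)
    (hs : (Judgement.eq s s' D).Valid I (A :: Δ)) (ht : (Judgement.eq t t' D).Valid I (B :: Δ)) :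
    (Judgement.eq (.caseOf (r.shift 0 Δ.length) s t) (.caseOf (r'.shift 0 Δ.length) s' t')
      D).Valid I (Δ ++ Γ) := by
  refine valid_eq_of_left
    (Tm.scoped_caseOf.2 ⟨hr.1.shift _ _ (by simp; omega), hs.1.mono (by simp),
      ht.1.mono (by simp)⟩)
    (Tm.scoped_caseOf.2 ⟨hr.2.1.shift _ _ (by simp; omega), hs.2.1.mono (by simp),
      ht.2.1.mono (by simp)⟩)
    (forall_mem_interpCtx_append fun d hd g hg hl => ?_)
  have hr' := (hr.2.2 g hg).1.of_prob_eq (prob_shift_zero (k := Δ.length) g hl)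
  refine ⟨hr'.caseOf (fun a ha => ?_) fun b hb => ?_, eq_of_expect_eq fun F => ?_⟩
  · have had := cons_mem_interpCtx ha hd
    exact (hs.2.2 _ had).1.of_prob_eq (prob_append_of_mem g had hs.1)
  · have hbd := cons_mem_interpCtx hb hd
    exact (ht.2.2 _ hbd).1.of_prob_eq (prob_append_of_mem g hbd ht.1)
  · rw [expect_prob_caseOf, expect_prob_caseOf, prob_shift_zero (t := r') g hl,
      ← (hr.2.2 g hg).2, ← prob_shift_zero (t := r) g hl]
    refine hr'.expect_onSum_congr (fun a ha => ?_) fun b hb => ?_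
    · have had := cons_mem_interpCtx ha hd
      exact congrArg (expect · F) ((prob_append_of_mem g had hs.1).trans
        ((hs.2.2 _ had).2.trans (prob_append_of_mem g had hs.2.1).symm))
    · have hbd := cons_mem_interpCtx hb hd
      exact congrArg (expect · F) ((prob_append_of_mem g hbd ht.1).trans
        ((ht.2.2 _ hbd).2.trans (prob_append_of_mem g hbd ht.2.1).symm))

theorem valid_beta_inl {r s t : Tm} (hr : (Judgement.typ r A).Valid I Γ)
    (hs : (Judgement.typ s D).Valid I (A :: Δ)) (ht : (Judgement.typ t D).Valid I (B :: Δ)) :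
    (Judgement.eq (.caseOf (.inl (r.shift 0 Δ.length)) s t) (s.inst (r.shift 0 Δ.length))
      D).Valid I (Δ ++ Γ) := by
  have hr' : (r.shift 0 Δ.length).Scoped (Δ ++ Γ).length := hr.2.1.shift _ _ (by simp; omega)
  refine valid_eq_of_right
    (Tm.scoped_caseOf.2 ⟨hr', hs.2.1.mono (by simp), ht.2.1.mono (by simp)⟩)
    (hs.2.1.inst (by simp) hr')
    (forall_mem_interpCtx_append fun d hd g hg hl => ?_)
  have hr'' := (hr.2.2 g hg).of_prob_eq (prob_shift_zero (k := Δ.length) g hl)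
  refine ⟨hr''.inst hs.1 fun a ha => ?_, eq_of_expect_eq fun F => ?_⟩
  · have had := cons_mem_interpCtx ha hd
    exact (hs.2.2 _ had).of_prob_eq (prob_append_of_mem g had hs.2.1)
  · rw [expect_inst hs.1 hr''.expect_one]
    simp

theorem valid_beta_inr {r s t : Tm} (hr : (Judgement.typ r B).Valid I Γ)
    (hs : (Judgement.typ s D).Valid I (A :: Δ)) (ht : (Judgement.typ t D).Valid I (B :: Δ)) :
    (Judgement.eq (.caseOf (.inr (r.shift 0 Δ.length)) s t) (t.inst (r.shift 0 Δ.length))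
      D).Valid I (Δ ++ Γ) := by
  have hr' : (r.shift 0 Δ.length).Scoped (Δ ++ Γ).length := hr.2.1.shift _ _ (by simp; omega)
  refine valid_eq_of_right
    (Tm.scoped_caseOf.2 ⟨hr', hs.2.1.mono (by simp), ht.2.1.mono (by simp)⟩)
    (ht.2.1.inst (by simp) hr')
    (forall_mem_interpCtx_append fun d hd g hg hl => ?_)
  have hr'' := (hr.2.2 g hg).of_prob_eq (prob_shift_zero (k := Δ.length) g hl)
  refine ⟨hr''.inst ht.1 fun b hb => ?_, eq_of_expect_eq fun F => ?_⟩
  · have hbd := cons_mem_interpCtx hb hd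
    exact (ht.2.2 _ hbd).of_prob_eq (prob_append_of_mem g hbd ht.2.1)
  · rw [expect_inst ht.1 hr''.expect_one]
    simp

theorem valid_eta_sum {t : Tm} (ht : (Judgement.typ t (.sum A B)).Valid I Γ) :
    (Judgement.eq (.caseOf t (.inl (.var 0)) (.inr (.var 0))) t (.sum A B)).Valid I Γ :=
  valid_eq_of_right
    (Tm.scoped_caseOf.2 ⟨ht.2.1, Tm.scoped_var.2 (by omega), Tm.scoped_var.2 (by omega)⟩) ht.2.1
    fun g hg => ⟨ht.2.2 g hg, eq_of_expect_eq fun F => by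
      simp [(ht.2.2 g hg).expect_eq_onSum F]⟩

/-- In the context `Γ, Δ, Θ` of the conversions for `case`, the inner `case` sees only the inputs
for `Γ` and `Δ`. -/
theorem yields_case_shift {r s s' : Tm} (hr : (Judgement.typ r (.sum A B)).Valid I Γ)
    (hs : (Judgement.typ s D).Valid I (A :: Δ)) (hs' : (Judgement.typ s' D).Valid I (B :: Δ))
    {e d g : List (Value α)} (hd : d ∈ interpCtx I Δ) (hg : g ∈ interpCtx I Γ)
    (hle : Θ.length = e.length) (hld : Δ.length = d.length) :
    (r.shift 0 (Θ.length + Δ.length)).Yields I (e ++ (d ++ g)) (.sum A B) ∧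
      (∀ a ∈ A.interp I, (s.shift 1 Θ.length).Yields I (a :: (e ++ (d ++ g))) D) ∧
      ∀ b ∈ B.interp I, (s'.shift 1 Θ.length).Yields I (b :: (e ++ (d ++ g))) D := by
  refine ⟨(hr.2.2 g hg).of_prob_eq (prob_shift_zero₂ g hle hld), fun a ha => ?_, fun b hb => ?_⟩
  · have had := cons_mem_interpCtx ha hd
    exact (hs.2.2 _ had).of_prob_eq (prob_shift_of_mem (u := [a]) had hs.2.1 rfl hle)
  · have hbd := cons_mem_interpCtx hb hd
    exact (hs'.2.2 _ hbd).of_prob_eq (prob_shift_of_mem (u := [b]) hbd hs'.2.1 rfl hle)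

theorem scoped_case_shift {r s s' : Tm} (hr : r.Scoped Γ.length) (hs : s.Scoped (A :: Δ).length)
    (hs' : s'.Scoped (B :: Δ).length) :
    (r.shift 0 (Θ.length + Δ.length)).Scoped (Θ ++ (Δ ++ Γ)).length ∧
      (s.shift 1 Θ.length).Scoped ((Θ ++ (Δ ++ Γ)).length + 1) ∧
      (s'.shift 1 Θ.length).Scoped ((Θ ++ (Δ ++ Γ)).length + 1) :=
  ⟨hr.shift _ _ (by simp; omega), hs.shift _ _ (by simp; omega), hs'.shift _ _ (by simp; omega)⟩

theorem valid_case_case {r s s' t t' : Tm} (hr : (Judgement.typ r (.sum A B)).Valid I Γ)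
    (hs : (Judgement.typ s (.sum D E)).Valid I (A :: Δ))
    (hs' : (Judgement.typ s' (.sum D E)).Valid I (B :: Δ))
    (ht : (Judgement.typ t F).Valid I (D :: Θ)) (ht' : (Judgement.typ t' F).Valid I (E :: Θ)) :
    (Judgement.eq
      (.caseOf (r.shift 0 (Θ.length + Δ.length))
        (.caseOf (s.shift 1 Θ.length) (t.shift 1 1) (t'.shift 1 1))
        (.caseOf (s'.shift 1 Θ.length) (t.shift 1 1) (t'.shift 1 1)))
      (.caseOf
        (.caseOf (r.shift 0 (Θ.length + Δ.length)) (s.shift 1 Θ.length) (s'.shift 1 Θ.length))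
        t t') F).Valid I (Θ ++ (Δ ++ Γ)) := by
  obtain ⟨cr, cs, cs'⟩ := scoped_case_shift (Θ := Θ) hr.2.1 hs.2.1 hs'.2.1
  have ct : (t.shift 1 1).Scoped ((Θ ++ (Δ ++ Γ)).length + 1 + 1) := ht.2.1.shift _ _ (by simp)
  have ct' : (t'.shift 1 1).Scoped ((Θ ++ (Δ ++ Γ)).length + 1 + 1) := ht'.2.1.shift _ _ (by simp)
  refine valid_eq_of_right
    (Tm.scoped_caseOf.2 ⟨cr, Tm.scoped_caseOf.2 ⟨cs, ct, ct'⟩, Tm.scoped_caseOf.2 ⟨cs', ct, ct'⟩⟩)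
    (Tm.scoped_caseOf.2 ⟨Tm.scoped_caseOf.2 ⟨cr, cs, cs'⟩, ht.2.1.mono (by simp),
      ht'.2.1.mono (by simp)⟩)
    (forall_mem_interpCtx_append₂ fun e he d hd g hg hle hld => ?_)
  obtain ⟨yr, ys, ys'⟩ := yields_case_shift hr hs hs' hd hg hle hld
  have h1 : ∀ z ∈ D.interp I, prob t (z :: (e ++ (d ++ g))) = prob t (z :: e) := fun z hz =>
    prob_append_of_mem (d ++ g) (cons_mem_interpCtx hz he) ht.2.1
  have h2 : ∀ w ∈ E.interp I, prob t' (w :: (e ++ (d ++ g))) = prob t' (w :: e) := fun w hw =>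
    prob_append_of_mem (d ++ g) (cons_mem_interpCtx hw he) ht'.2.1
  have h3 : ∀ x, ∀ z ∈ D.interp I,
      prob (t.shift 1 1) (z :: x :: (e ++ (d ++ g))) = prob t (z :: e) := fun x z hz =>
    prob_shift_of_mem (u := [z]) (w := [x]) (cons_mem_interpCtx hz he) ht.2.1 rfl rfl
  have h4 : ∀ x, ∀ w ∈ E.interp I,
      prob (t'.shift 1 1) (w :: x :: (e ++ (d ++ g))) = prob t' (w :: e) := fun x w hw =>
    prob_shift_of_mem (u := [w]) (w := [x]) (cons_mem_interpCtx hw he) ht'.2.1 rfl rfl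
  refine ⟨(yr.caseOf ys ys').caseOf
    (fun z hz => (ht.2.2 _ (cons_mem_interpCtx hz he)).of_prob_eq (h1 z hz))
    fun w hw => (ht'.2.2 _ (cons_mem_interpCtx hw he)).of_prob_eq (h2 w hw),
    eq_of_expect_eq fun F => ?_⟩
  simp only [expect_prob_caseOf]
  exact yr.expect_onSum_congr
    (fun a ha => (ys a ha).expect_onSum_congr (fun z hz => by rw [h1 z hz, h3 a z hz])
      fun w hw => by rw [h2 w hw, h4 a w hw])
    fun b hb => (ys' b hb).expect_onSum_congr (fun z hz => by rw [h1 z hz, h3 b z hz])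
      fun w hw => by rw [h2 w hw, h4 b w hw]

theorem valid_case_pair {r s s' t : Tm} (hr : (Judgement.typ r (.sum A B)).Valid I Γ)
    (hs : (Judgement.typ s D).Valid I (A :: Δ)) (hs' : (Judgement.typ s' D).Valid I (B :: Δ))
    (ht : (Judgement.typ t E).Valid I Θ) :
    (Judgement.eq
      (.pair
        (.caseOf (r.shift 0 (Θ.length + Δ.length)) (s.shift 1 Θ.length) (s'.shift 1 Θ.length)) t)
      (.caseOf (r.shift 0 (Θ.length + Δ.length))
        (.pair (s.shift 1 Θ.length) (t.shift 0 1))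
        (.pair (s'.shift 1 Θ.length) (t.shift 0 1))) (.tensor D E)).Valid I
          (Θ ++ (Δ ++ Γ)) := by
  obtain ⟨cr, cs, cs'⟩ := scoped_case_shift (Θ := Θ) hr.2.1 hs.2.1 hs'.2.1
  have ct : (t.shift 0 1).Scoped ((Θ ++ (Δ ++ Γ)).length + 1) := ht.2.1.shift _ _ (by simp)
  refine valid_eq_of_left
    (Tm.scoped_pair.2 ⟨Tm.scoped_caseOf.2 ⟨cr, cs, cs'⟩, ht.2.1.mono (by simp)⟩)
    (Tm.scoped_caseOf.2 ⟨cr, Tm.scoped_pair.2 ⟨cs, ct⟩, Tm.scoped_pair.2 ⟨cs', ct⟩⟩)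
    (forall_mem_interpCtx_append₂ fun e he d hd g hg hle hld => ?_)
  obtain ⟨yr, ys, ys'⟩ := yields_case_shift hr hs hs' hd hg hle hld
  refine ⟨(yr.caseOf ys ys').pair
    ((ht.2.2 e he).of_prob_eq (prob_append_of_mem (d ++ g) he ht.2.1)),
    eq_of_expect_eq fun F => ?_⟩
  simp only [expect_prob_caseOf, expect_prob_pair, prob_shift_cons]

theorem valid_let_case {r s s' t : Tm} (hr : (Judgement.typ r (.sum A B)).Valid I Γ)
    (hs : (Judgement.typ s (.tensor D E)).Valid I (A :: Δ))
    (hs' : (Judgement.typ s' (.tensor D E)).Valid I (B :: Δ))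
    (ht : (Judgement.typ t F).Valid I (E :: D :: Θ)) :
    (Judgement.eq
      (.letPair
        (.caseOf (r.shift 0 (Θ.length + Δ.length)) (s.shift 1 Θ.length) (s'.shift 1 Θ.length)) t)
      (.caseOf (r.shift 0 (Θ.length + Δ.length))
        (.letPair (s.shift 1 Θ.length) (t.shift 2 1))
        (.letPair (s'.shift 1 Θ.length) (t.shift 2 1))) F).Valid I (Θ ++ (Δ ++ Γ)) := by
  obtain ⟨cr, cs, cs'⟩ := scoped_case_shift (Θ := Θ) hr.2.1 hs.2.1 hs'.2.1
  have ct : (t.shift 2 1).Scoped ((Θ ++ (Δ ++ Γ)).length + 1 + 2) :=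
    ht.2.1.shift _ _ (by simp)
  refine valid_eq_of_left
    (Tm.scoped_letPair.2 ⟨Tm.scoped_caseOf.2 ⟨cr, cs, cs'⟩, ht.2.1.mono (by simp)⟩)
    (Tm.scoped_caseOf.2 ⟨cr, Tm.scoped_letPair.2 ⟨cs, ct⟩, Tm.scoped_letPair.2 ⟨cs', ct⟩⟩)
    (forall_mem_interpCtx_append₂ fun e he d hd g hg hle hld => ?_)
  obtain ⟨yr, ys, ys'⟩ := yields_case_shift hr hs hs' hd hg hle hld
  have h1 : ∀ z ∈ D.interp I, ∀ w ∈ E.interp I,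
      prob t (w :: z :: (e ++ (d ++ g))) = prob t (w :: z :: e) := fun z hz w hw =>
    prob_append_of_mem (d ++ g) (cons_mem_interpCtx hw (cons_mem_interpCtx hz he)) ht.2.1
  have h2 : ∀ x, ∀ z ∈ D.interp I, ∀ w ∈ E.interp I,
      prob (t.shift 2 1) (w :: z :: x :: (e ++ (d ++ g))) = prob t (w :: z :: e) :=
    fun x z hz w hw => prob_shift_of_mem (u := [w, z]) (w := [x])
      (cons_mem_interpCtx hw (cons_mem_interpCtx hz he)) ht.2.1 rfl rfl
  refine ⟨(yr.caseOf ys ys').letPair fun z hz w hw =>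
    (ht.2.2 _ (cons_mem_interpCtx hw (cons_mem_interpCtx hz he))).of_prob_eq (h1 z hz w hw),
    eq_of_expect_eq fun F => ?_⟩
  simp only [expect_prob_caseOf, expect_prob_letPair]
  exact yr.expect_onSum_congr
    (fun a ha => (ys a ha).expect_onPair_congr fun z hz w hw => by
      rw [h1 z hz w hw, h2 a z hz w hw])
    fun b hb => (ys' b hb).expect_onPair_congr fun z hz w hw => by
      rw [h1 z hz w hw, h2 b z hz w hw]

end Soundness

section Soundness

variable {C α : Type*} {I : C → Set α} {Γ : List (Ty C)} {A B : Ty C}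

/-! #### Partial pairing, `left` and joint monicity -/

theorem valid_inlr {s t : Tm} (hs : (Judgement.typ s A.partialTy).Valid I Γ)
    (ht : (Judgement.typ t B.partialTy).Valid I Γ)
    (h : (Judgement.eq s.dom t.ker (.two : Ty C)).Valid I Γ) :
    (Judgement.typ (.inlr s t) (.sum A B)).Valid I Γ :=
  ⟨⟨hs.1, ht.1⟩, Tm.scoped_inlr.2 ⟨hs.2.1, ht.2.1⟩, fun g hg =>
    (hs.2.2 g hg).inlr (ht.2.2 g hg) (h.2.2 g hg).2⟩

theorem valid_inlr_eq {s s' t t' : Tm} (hs : (Judgement.eq s s' A.partialTy).Valid I Γ)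
    (ht : (Judgement.eq t t' B.partialTy).Valid I Γ)
    (h : (Judgement.eq s.dom t.ker (.two : Ty C)).Valid I Γ) :
    (Judgement.eq (.inlr s t) (.inlr s' t') (.sum A B)).Valid I Γ :=
  valid_eq_of_left (Tm.scoped_inlr.2 ⟨hs.1, ht.1⟩) (Tm.scoped_inlr.2 ⟨hs.2.1, ht.2.1⟩)
    fun g hg => ⟨(hs.2.2 g hg).1.inlr (ht.2.2 g hg).1 (h.2.2 g hg).2, eq_of_expect_eq fun F => by
      rw [expect_prob_inlr, expect_prob_inlr, (hs.2.2 g hg).2, (ht.2.2 g hg).2]⟩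

theorem valid_beta_inlr₁ {s t : Tm} (hs : (Judgement.typ s A.partialTy).Valid I Γ)
    (ht : (Judgement.typ t B.partialTy).Valid I Γ)
    (h : (Judgement.eq s.dom t.ker (.two : Ty C)).Valid I Γ) :
    (Judgement.eq (Tm.inlr s t).proj₁ s A.partialTy).Valid I Γ :=
  valid_eq_of_right (Tm.scoped_proj₁ (Tm.scoped_inlr.2 ⟨hs.2.1, ht.2.1⟩)) hs.2.1
    fun g hg => ⟨hs.2.2 g hg, eq_of_expect_eq fun F => by
      have h1 := expect_of_dom_eq_ker (h.2.2 g hg).2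
      have h2 := (hs.2.2 g hg).expect_inl_add_expect_inr
      have h3 := (ht.2.2 g hg).expect_inl_add_expect_inr
      rw [expect_prob_proj₁, expect_prob_inlr, (hs.2.2 g hg).expect_eq_partial F]
      simp only [onSum_inl, onSum_inr]
      rw [expect_onSum_const_left (support_prob_finite t g)]
      linear_combination F (.inr .star) * (h3 - h2 + h1)⟩

theorem valid_beta_inlr₂ {s t : Tm} (hs : (Judgement.typ s A.partialTy).Valid I Γ)
    (ht : (Judgement.typ t B.partialTy).Valid I Γ)
    (h : (Judgement.eq s.dom t.ker (.two : Ty C)).Valid I Γ) :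
    (Judgement.eq (Tm.inlr s t).proj₂ t B.partialTy).Valid I Γ :=
  valid_eq_of_right (Tm.scoped_proj₂ (Tm.scoped_inlr.2 ⟨hs.2.1, ht.2.1⟩)) ht.2.1
    fun g hg => ⟨ht.2.2 g hg, eq_of_expect_eq fun F => by
      rw [expect_prob_proj₂, expect_prob_inlr, (ht.2.2 g hg).expect_eq_partial F]
      simp only [onSum_inl, onSum_inr]
      rw [expect_onSum_const_left (support_prob_finite s g), expect_of_dom_eq_ker (h.2.2 g hg).2,
        add_comm]⟩

theorem valid_eta_inlr {t : Tm} (ht : (Judgement.typ t (.sum A B)).Valid I Γ) :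
    (Judgement.eq (.inlr t.proj₁ t.proj₂) t (.sum A B)).Valid I Γ :=
  valid_eq_of_right (Tm.scoped_inlr.2 ⟨Tm.scoped_proj₁ ht.2.1, Tm.scoped_proj₂ ht.2.1⟩) ht.2.1
    fun g hg => ⟨ht.2.2 g hg, eq_of_expect_eq fun F => by
      rw [expect_prob_inlr, expect_prob_proj₁, expect_prob_proj₂, (ht.2.2 g hg).expect_eq_onSum F]
      simp only [onSum_inl, onSum_inr]
      rw [← expect_onSum_split (support_prob_finite t g)]⟩

theorem valid_lft {t : Tm} (ht : (Judgement.typ t (.sum A B)).Valid I Γ)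
    (h : (Judgement.eq t.dom .top (.two : Ty C)).Valid I Γ) :
    (Judgement.typ (.lft t) A).Valid I Γ :=
  ⟨ht.1, ht.2.1, fun g hg => (ht.2.2 g hg).lft (h.2.2 g hg).2⟩

theorem valid_lft_eq {t t' : Tm} (ht : (Judgement.eq t t' (.sum A B)).Valid I Γ)
    (h : (Judgement.eq t.dom .top (.two : Ty C)).Valid I Γ) :
    (Judgement.eq (.lft t) (.lft t') A).Valid I Γ :=
  valid_eq_of_left ht.1 ht.2.1 fun g hg =>
    ⟨(ht.2.2 g hg).1.lft (h.2.2 g hg).2, eq_of_expect_eq fun F => by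
      rw [expect_prob_lft, expect_prob_lft, (ht.2.2 g hg).2]⟩

theorem valid_beta_lft {t : Tm} (ht : (Judgement.typ t (.sum A B)).Valid I Γ)
    (h : (Judgement.eq t.dom .top (.two : Ty C)).Valid I Γ) :
    (Judgement.eq (.inl (.lft t)) t (.sum A B)).Valid I Γ :=
  valid_eq_of_right ht.2.1 ht.2.1 fun g hg => ⟨ht.2.2 g hg, eq_of_expect_eq fun F => by
    rw [expect_prob_inl, expect_prob_lft,
      (ht.2.2 g hg).expect_of_dom_eq_top (h.2.2 g hg).2 F]⟩

theorem valid_eta_lft {t : Tm} (ht : (Judgement.typ t A).Valid I Γ) :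
    (Judgement.eq (.lft (.inl t)) t A).Valid I Γ :=
  valid_eq_of_right ht.2.1 ht.2.1 fun g hg => ⟨ht.2.2 g hg, eq_of_expect_eq fun F => by simp⟩

theorem valid_joint_mono {s t : Tm} (hs : (Judgement.typ s (Ty.sum A A).partialTy).Valid I Γ)
    (ht : (Judgement.typ t (Ty.sum A A).partialTy).Valid I Γ)
    (h₁ : (Judgement.eq (s.doIn (Tm.var 0).proj₁) (t.doIn (Tm.var 0).proj₁) A.partialTy).Valid I Γ)
    (h₂ : (Judgement.eq (s.doIn (Tm.var 0).proj₂) (t.doIn (Tm.var 0).proj₂)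
      A.partialTy).Valid I Γ) :
    (Judgement.eq s t (Ty.sum A A).partialTy).Valid I Γ :=
  valid_eq_of_left hs.2.1 ht.2.1 fun g hg => ⟨hs.2.2 g hg,
    prob_eq_of_proj_eq (hs.2.2 g hg) (ht.2.2 g hg) (h₁.2.2 g hg).2 (h₂.2.2 g hg).2⟩

/-! #### Partial sums -/

theorem valid_psum_def {s t b : Tm} (hs : (Judgement.typ s A.partialTy).Valid I Γ)
    (ht : (Judgement.typ t A.partialTy).Valid I Γ)
    (hb : (Judgement.typ b (Ty.sum A A).partialTy).Valid I Γ)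
    (h₁ : (Judgement.eq (b.doIn (Tm.var 0).proj₁) s A.partialTy).Valid I Γ)
    (h₂ : (Judgement.eq (b.doIn (Tm.var 0).proj₂) t A.partialTy).Valid I Γ) :
    (Judgement.eq (.psum s t) (b.doIn (Tm.ret ((Tm.var 0).nabla 2))) A.partialTy).Valid I Γ :=
  valid_eq_of_right (Tm.scoped_psum.2 ⟨hs.2.1, ht.2.1⟩)
    (Tm.scoped_doIn hb.2.1 (Tm.scoped_inl.2 (.nabla 2 (Tm.scoped_var.2 (by omega)))))
    fun g hg => ⟨(hb.2.2 g hg).doIn_nabla, prob_psum_eq (hs.2.2 g hg) (ht.2.2 g hg)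
      (hb.2.2 g hg) (h₁.2.2 g hg).2 (h₂.2.2 g hg).2⟩

theorem valid_psum {s t b : Tm} (hs : (Judgement.typ s A.partialTy).Valid I Γ)
    (ht : (Judgement.typ t A.partialTy).Valid I Γ)
    (hb : (Judgement.typ b (Ty.sum A A).partialTy).Valid I Γ)
    (h₁ : (Judgement.eq (b.doIn (Tm.var 0).proj₁) s A.partialTy).Valid I Γ)
    (h₂ : (Judgement.eq (b.doIn (Tm.var 0).proj₂) t A.partialTy).Valid I Γ) :
    (Judgement.typ (.psum s t) A.partialTy).Valid I Γ :=
  ⟨⟨hs.1, ht.1⟩, Tm.scoped_psum.2 ⟨hs.2.1, ht.2.1⟩, fun g hg =>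
    ((valid_psum_def hs ht hb h₁ h₂).2.2 g hg).1⟩

/-! #### Instruments -/

theorem mem_interpCtx_singleton {a : Value α} (ha : a ∈ A.interp I) : [a] ∈ interpCtx I [A] :=
  cons_mem_interpCtx ha nil_mem_interpCtx

theorem valid_instr {n : ℕ} {t s : Tm} (ht : (Judgement.typ t (.fin n : Ty C)).Valid I [A])
    (hs : (Judgement.typ s A).Valid I Γ) :
    (Judgement.typ (.instr t s) (A.copower n)).Valid I Γ :=
  ⟨⟨ht.1, hs.1, ht.2.1⟩, Tm.scoped_instr.2 ⟨ht.2.1.mono (by simp), hs.2.1⟩, fun g hg =>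
    (hs.2.2 g hg).instr fun _ ha => ht.2.2 _ (mem_interpCtx_singleton ha)⟩

theorem valid_nabla_instr {n : ℕ} {t s : Tm} (ht : (Judgement.typ t (.fin n : Ty C)).Valid I [A])
    (hs : (Judgement.typ s A).Valid I Γ) :
    (Judgement.eq ((Tm.instr t s).nabla n) s A).Valid I Γ :=
  valid_eq_of_right (.nabla n (valid_instr ht hs).2.1) hs.2.1 fun g hg => ⟨hs.2.2 g hg,
    prob_nabla_instr (hs.2.2 g hg) fun _ ha => ht.2.2 _ (mem_interpCtx_singleton ha)⟩

theorem prob_cons_of_scoped_one {t : Tm} (ht : t.Scoped 1) (a : Value α) (g : List (Value α)) :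
    prob t (a :: g) = prob t [a] := prob_append (d := [a]) g ht

theorem valid_instr_test {n : ℕ} {t s : Tm} (ht : (Judgement.typ t (.fin n : Ty C)).Valid I [A])
    (hs : (Judgement.typ s A).Valid I Γ) :
    (Judgement.eq ((Tm.instr t s).ind n) (t.inst s) (.fin n)).Valid I Γ :=
  valid_eq_of_right (.ind n (valid_instr ht hs).2.1) (ht.2.1.inst (by simp) hs.2.1)
    fun g hg => by
      refine ⟨(hs.2.2 g hg).inst ht.1 fun a ha =>
        (ht.2.2 _ (mem_interpCtx_singleton ha)).of_prob_eq (prob_cons_of_scoped_one ht.2.1 a g),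
        eq_of_expect_eq fun F => ?_⟩
      rw [expect_inst ht.1 (hs.2.2 g hg).expect_one, expect_prob_ind_instr (hs.2.2 g hg)
        fun _ ha => ht.2.2 _ (mem_interpCtx_singleton ha)]
      simp only [prob_cons_of_scoped_one ht.2.1]

theorem valid_eta_instr {n : ℕ} {t s : Tm} (ht : (Judgement.typ t (A.copower n)).Valid I [A])
    (h : (Judgement.eq (t.nabla n) (.var 0) A).Valid I [A])
    (hs : (Judgement.typ s A).Valid I Γ) :
    (Judgement.eq (.instr (t.ind n) s) (t.inst s) (A.copower n)).Valid I Γ :=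
  valid_eq_of_right (Tm.scoped_instr.2 ⟨(ht.2.1.ind n).mono (by simp), hs.2.1⟩)
    (ht.2.1.inst (by simp) hs.2.1) fun g hg => by
      refine ⟨(hs.2.2 g hg).inst ht.1 fun a ha =>
        (ht.2.2 _ (mem_interpCtx_singleton ha)).of_prob_eq (prob_cons_of_scoped_one ht.2.1 a g),
        eq_of_expect_eq fun F => ?_⟩
      rw [expect_inst ht.1 (hs.2.2 g hg).expect_one, expect_prob_instr]
      simp only [prob_cons_of_scoped_one ht.2.1]
      refine (hs.2.2 g hg).expect_congr fun a ha => ?_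
      have hmem := mem_interpCtx_singleton ha
      exact expect_ind_tag (ht.2.2 _ hmem) (h.2.2 _ hmem).2 F

theorem valid_instr_eq {n : ℕ} {t t' s s' : Tm}
    (ht : (Judgement.eq t t' (.fin n : Ty C)).Valid I [A]) (hs : (Judgement.eq s s' A).Valid I Γ) :
    (Judgement.eq (.instr t s) (.instr t' s') (A.copower n)).Valid I Γ :=
  valid_eq_of_left (Tm.scoped_instr.2 ⟨ht.1.mono (by simp), hs.1⟩)
    (Tm.scoped_instr.2 ⟨ht.2.1.mono (by simp), hs.2.1⟩) fun g hg => by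
      refine ⟨(hs.2.2 g hg).1.instr fun _ ha => (ht.2.2 _ (mem_interpCtx_singleton ha)).1,
        eq_of_expect_eq fun F => ?_⟩
      rw [expect_prob_instr, expect_prob_instr, ← (hs.2.2 g hg).2]
      refine (hs.2.2 g hg).1.expect_congr fun a ha => ?_
      rw [(ht.2.2 _ (mem_interpCtx_singleton ha)).2]

theorem valid_comm {p q t : Tm} (hp : (Judgement.typ p (.two : Ty C)).Valid I [A])
    (hq : (Judgement.typ q (.two : Ty C)).Valid I [A]) (ht : (Judgement.typ t A).Valid I Γ) :
    (Judgement.eq ((Tm.assert p t).doIn (Tm.assert q (.var 0)))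
      ((Tm.assert q t).doIn (Tm.assert p (.var 0))) A.partialTy).Valid I Γ := by
  have hv : (Tm.var 0).Scoped (Γ.length + 1) := Tm.scoped_var.2 (by omega)
  refine valid_eq_of_left
    (Tm.scoped_doIn (Tm.scoped_assert hp.2.1 ht.2.1) (Tm.scoped_assert hq.2.1 hv))
    (Tm.scoped_doIn (Tm.scoped_assert hq.2.1 ht.2.1) (Tm.scoped_assert hp.2.1 hv))
    fun g hg => ?_
  have hp' := fun a ha => hp.2.2 [a] (mem_interpCtx_singleton ha)
  have hq' := fun a ha => hq.2.2 [a] (mem_interpCtx_singleton ha)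
  exact ⟨((ht.2.2 g hg).assert hp').caseOf (fun a ha => (Tm.yields_var rfl ha).assert hq')
    fun _ _ => Tm.yields_star.inr, prob_assert_comm (ht.2.2 g hg) hp' hq'⟩

/-! #### Scalars -/

theorem valid_nsum_frac {n : ℕ} (hn : 2 ≤ n) :
    (Judgement.eq (Tm.nsum n (.frac n)) .top (.two : Ty C)).Valid I Γ :=
  valid_eq_of_right (Tm.scoped_nsum Tm.scoped_frac n) Tm.scoped_star fun g _ => by
    refine ⟨Tm.yields_top, eq_of_expect_eq fun F => ?_⟩
    have hn' : (n : ℝ) ≠ 0 := by positivity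
    rw [expect_prob_nsum (expect_prob_frac g · n), Tm.top, expect_prob_inl, expect_prob_star]
    field_simp
    ring

theorem valid_divide {n : ℕ} {t : Tm} (hn : 2 ≤ n)
    (ht : (Judgement.typ t (.two : Ty C)).Valid I Γ)
    (h : (Judgement.eq (Tm.nsum n t) .top (.two : Ty C)).Valid I Γ) :
    (Judgement.eq t (.frac n) (.two : Ty C)).Valid I Γ :=
  valid_eq_of_left ht.2.1 Tm.scoped_frac fun g hg => by
    refine ⟨ht.2.2 g hg, eq_of_expect_eq fun F => ?_⟩
    have hn' : (n : ℝ) ≠ 0 := by positivity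
    obtain ⟨p, q, hpq, hF⟩ := (ht.2.2 g hg).exists_two
    -- the probability of `⊤` under `n · t` is `n * p`
    have h1 := congrArg (fun φ => expect φ (onSum (fun _ => 1) fun _ => 0)) (h.2.2 g hg).2
    simp only [expect_prob_nsum hF, Tm.top, expect_prob_inl, expect_prob_star, onSum_inl,
      onSum_inr, mul_one, mul_zero, add_zero] at h1
    have hp : p = 1 / n := by field_simp; linarith
    have hq : q = (n - 1) / n := by
      rw [← eq_sub_iff_add_eq'] at hpq
      rw [hpq, hp]
      field_simp
    rw [hF, expect_prob_frac, hp, hq]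

theorem valid_proj₁_bound {m n : ℕ} (hn : 2 ≤ n) (hmn : m < n) :
    (Judgement.eq ((Tm.bound m n).doIn (Tm.var 0).proj₁) (Tm.nsum m (.frac n))
      (.two : Ty C)).Valid I Γ :=
  valid_eq_of_left (Tm.scoped_doIn Tm.scoped_bound (Tm.scoped_proj₁ (Tm.scoped_var.2 (by omega))))
    (Tm.scoped_nsum Tm.scoped_frac m) fun g _ => by
      refine ⟨(Tm.yields_bound hn hmn).caseOf (fun _ hx => (Tm.yields_var rfl hx).caseOf
        (fun _ ha => (Tm.yields_var rfl ha).inl) fun _ _ => Tm.yields_star.inr)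
        fun _ _ => Tm.yields_star.inr, eq_of_expect_eq fun F => ?_⟩
      have hn' : (n : ℝ) ≠ 0 := by positivity
      rw [expect_prob_nsum (expect_prob_frac g · n), expect_doIn_proj₁, expect_prob_bound]
      simp only [onSum_inl, onSum_inr]
      field_simp
      ring

theorem valid_proj₂_bound {m n : ℕ} (hn : 2 ≤ n) :
    (Judgement.eq ((Tm.bound m n).doIn (Tm.var 0).proj₂) (.frac n) (.two : Ty C)).Valid I Γ :=
  valid_eq_of_right (Tm.scoped_doIn Tm.scoped_bound (Tm.scoped_proj₂ (Tm.scoped_var.2 (by omega))))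
    Tm.scoped_frac fun g _ => by
      refine ⟨Tm.yields_frac hn, eq_of_expect_eq fun F => ?_⟩
      have hn' : (n : ℝ) ≠ 0 := by positivity
      rw [expect_prob_frac, expect_doIn_proj₂, expect_prob_bound]
      simp only [onSum_inl, onSum_inr]
      field_simp
      ring

/-! #### Normalisation -/

theorem prob_fail_lt_one_of_valid {n : ℕ} {t : Tm} (hn : 2 ≤ n)
    (ht : (Judgement.typ t A.partialTy).Valid I [])
    (hle : (Judgement.le (.frac n) t.dom (.one : Ty C)).Valid I []) (g : List (Value α)) :
    t.Yields I g A.partialTy ∧ 0 < 1 - prob t g (.inr .star) := by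
  have hp := prob_of_scoped_zero ht.2.1 g []
  refine ⟨(ht.2.2 _ nil_mem_interpCtx).of_prob_eq hp, ?_⟩
  rw [hp]
  exact (ht.2.2 _ nil_mem_interpCtx).prob_fail_lt_one hn (hle _ nil_mem_interpCtx _)

theorem valid_normal {n : ℕ} {t : Tm} (hn : 2 ≤ n)
    (ht : (Judgement.typ t A.partialTy).Valid I [])
    (hle : (Judgement.le (.frac n) t.dom (.one : Ty C)).Valid I []) :
    (Judgement.typ (.normal t) A).Valid I Γ :=
  ⟨⟨ht.1, ht.2.1⟩, ht.2.1.mono (Nat.zero_le _), fun g _ =>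
    have h := prob_fail_lt_one_of_valid hn ht hle g
    h.1.normal h.2⟩

theorem valid_beta_normal {n : ℕ} {t : Tm} (hn : 2 ≤ n)
    (ht : (Judgement.typ t A.partialTy).Valid I [])
    (hle : (Judgement.le (.frac n) t.dom (.one : Ty C)).Valid I []) :
    (Judgement.eq (t.doIn (.ret (.normal t))) t A.partialTy).Valid I Γ :=
  valid_eq_of_right (Tm.scoped_doIn (ht.2.1.mono (Nat.zero_le _)) (ht.2.1.mono (Nat.zero_le _)))
    (ht.2.1.mono (Nat.zero_le _)) fun g _ => by
      obtain ⟨h1, h2⟩ := prob_fail_lt_one_of_valid hn ht hle g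
      refine ⟨h1, eq_of_expect_eq fun F => ?_⟩
      rw [expect_doIn_ret h1 fun a => prob_of_scoped_zero (Tm.scoped_normal.2 ht.2.1) (a :: g) g,
        expect_prob_normal, h1.expect_eq_partial F, ← h1.prob_fail]
      field_simp

theorem valid_eta_normal {n : ℕ} {t ρ : Tm} (hn : 2 ≤ n)
    (ht : (Judgement.typ t A.partialTy).Valid I [])
    (hle : (Judgement.le (.frac n) t.dom (.one : Ty C)).Valid I [])
    (hρ : (Judgement.typ ρ A).Valid I Γ)
    (h : (Judgement.eq t (t.doIn (.ret (ρ.shift 0 1))) A.partialTy).Valid I Γ) :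
    (Judgement.eq ρ (.normal t) A).Valid I Γ :=
  valid_eq_of_left hρ.2.1 (ht.2.1.mono (Nat.zero_le _)) fun g hg => by
    obtain ⟨h1, h2⟩ := prob_fail_lt_one_of_valid hn ht hle g
    refine ⟨hρ.2.2 g hg, eq_of_expect_eq fun F => ?_⟩
    have h3 := congrArg (fun φ => expect φ (onSum F fun _ => 0)) (h.2.2 g hg).2
    simp only [expect_doIn_ret h1 fun a => prob_shift_cons ρ a g, onSum_inl, onSum_inr, zero_mul,
      add_zero] at h3
    rw [expect_prob_normal, h3]
    field_simp

/-! #### Induction over derivations -/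

/-- Every derivable judgement is valid. -/
theorem Derives.valid {J : Judgement C} (h : Derives Γ J) (I : C → Set α) : J.Valid I Γ := by
  induction h with
  | exch Γ Δ A B J _ ih => exact ih.exch
  | var Γ i A hi =>
    refine ⟨trivial, Tm.scoped_var.2 (List.getElem?_eq_some_iff.1 hi).1, fun g hg => ?_⟩
    obtain ⟨a, ha, hga⟩ := exists_getElem?_of_mem_interpCtx hg hi
    exact Tm.yields_var hga ha
  | refl Γ t A _ ih => exact valid_eq_of_left ih.2.1 ih.2.1 fun g hg => ⟨ih.2.2 g hg, rfl⟩
  | symm Γ s t A _ ih =>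
    exact valid_eq_of_right ih.2.1 ih.1 fun g hg => ⟨(ih.2.2 g hg).1, (ih.2.2 g hg).2.symm⟩
  | trans Γ r s t A _ _ ih₁ ih₂ =>
    exact valid_eq_of_left ih₁.1 ih₂.2.1 fun g hg =>
      ⟨(ih₁.2.2 g hg).1, (ih₁.2.2 g hg).2.trans (ih₂.2.2 g hg).2⟩
  | unit Γ => exact ⟨trivial, Tm.scoped_star, fun g _ => Tm.yields_star⟩
  | eta_one Γ t _ ih =>
    refine valid_eq_of_right ih.2.1 Tm.scoped_star fun g hg =>
      ⟨Tm.yields_star, eq_of_expect_eq fun F => ?_⟩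
    rw [expect_prob_star, ← (ih.2.2 g hg).expect_const (F .star)]
    exact (ih.2.2 g hg).expect_congr fun x hx => by rw [Ty.mem_interp_one.1 hx]
  | pair Γ Δ s t A B _ _ hs ht => exact valid_pair hs ht
  | letPair Γ Δ s t A B D _ _ hs ht => exact valid_letPair hs ht
  | pair_eq Γ Δ s s' t t' A B _ _ hs ht => exact valid_pair_eq hs ht
  | letPair_eq Γ Δ s s' t t' A B D _ _ hs ht => exact valid_letPair_eq hs ht
  | beta_tensor Γ Δ Θ r s t A B D _ _ _ hr hs ht => exact valid_beta_tensor hr hs ht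
  | eta_tensor Γ t A B _ ht => exact valid_eta_tensor ht
  | let_let Γ Δ Θ r s t A B D E F _ _ _ hr hs ht => exact valid_let_let hr hs ht
  | let_pair Γ Δ Θ r s t A B D E _ _ _ hr hs ht => exact valid_let_pair hr hs ht
  | magic Γ t A _ ht => exact valid_magic ht
  | eta_zero Γ s t A _ _ hs ht => exact valid_eta_zero hs ht
  | inl Γ t A B _ ht => exact ⟨ht.1, ht.2.1, fun g hg => (ht.2.2 g hg).inl⟩
  | inr Γ t A B _ ht => exact ⟨ht.1, ht.2.1, fun g hg => (ht.2.2 g hg).inr⟩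
  | inl_eq Γ t t' A B _ ht => exact valid_inl_eq ht
  | inr_eq Γ t t' A B _ ht => exact valid_inr_eq ht
  | caseOf Γ Δ r s t A B D _ _ _ hr hs ht => exact valid_caseOf hr hs ht
  | caseOf_eq Γ Δ r r' s s' t t' A B D _ _ _ hr hs ht => exact valid_caseOf_eq hr hs ht
  | beta_inl Γ Δ r s t A B D _ _ _ hr hs ht => exact valid_beta_inl hr hs ht
  | beta_inr Γ Δ r s t A B D _ _ _ hr hs ht => exact valid_beta_inr hr hs ht
  | eta_sum Γ t A B _ ht => exact valid_eta_sum ht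
  | case_case Γ Δ Θ r s s' t t' A B D E F _ _ _ _ _ hr hs hs' ht ht' =>
    exact valid_case_case hr hs hs' ht ht'
  | case_pair Γ Δ Θ r s s' t A B D E _ _ _ _ hr hs hs' ht => exact valid_case_pair hr hs hs' ht
  | let_case Γ Δ Θ r s s' t A B D E F _ _ _ _ hr hs hs' ht => exact valid_let_case hr hs hs' ht
  | inlr Γ s t A B _ _ _ hs ht h => exact valid_inlr hs ht h
  | inlr_eq Γ s s' t t' A B _ _ _ hs ht h => exact valid_inlr_eq hs ht h
  | beta_inlr₁ Γ s t A B _ _ _ hs ht h => exact valid_beta_inlr₁ hs ht h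
  | beta_inlr₂ Γ s t A B _ _ _ hs ht h => exact valid_beta_inlr₂ hs ht h
  | eta_inlr Γ t A B _ ht => exact valid_eta_inlr ht
  | lft Γ t A B _ _ ht h => exact valid_lft ht h
  | lft_eq Γ t t' A B _ _ ht h => exact valid_lft_eq ht h
  | beta_lft Γ t A B _ _ ht h => exact valid_beta_lft ht h
  | eta_lft Γ t A _ ht => exact valid_eta_lft ht
  | joint_mono Γ s t A _ _ _ _ hs ht h₁ h₂ => exact valid_joint_mono hs ht h₁ h₂
  | le_intro Γ s t b A _ _ _ _ _ hs ht hb h₁ h₂ =>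
    exact fun g hg => prob_inl_le_of_bound (hb.2.2 g hg) (h₁.2.2 g hg).2 (h₂.2.2 g hg).2
  | psum Γ s t b A _ _ _ _ _ hs ht hb h₁ h₂ => exact valid_psum hs ht hb h₁ h₂
  | psum_def Γ s t b A _ _ _ _ _ hs ht hb h₁ h₂ => exact valid_psum_def hs ht hb h₁ h₂
  | instr Γ n t s A _ _ ht hs => exact valid_instr ht hs
  | nabla_instr Γ n t s A _ _ ht hs => exact valid_nabla_instr ht hs
  | instr_test Γ n t s A _ _ ht hs => exact valid_instr_test ht hs
  | eta_instr Γ n t s A _ _ _ ht h hs => exact valid_eta_instr ht h hs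
  | instr_eq Γ n t t' s s' A _ _ ht hs => exact valid_instr_eq ht hs
  | comm Γ p q t A _ _ _ hp hq ht => exact valid_comm hp hq ht
  | frac Γ n hn => exact ⟨trivial, Tm.scoped_frac, fun g _ => Tm.yields_frac hn⟩
  | nsum_frac Γ n hn => exact valid_nsum_frac hn
  | divide Γ n t hn _ _ ht h => exact valid_divide hn ht h
  | bound Γ m n hn _ hmn => exact ⟨trivial, Tm.scoped_bound, fun g _ => Tm.yields_bound hn hmn⟩
  | proj₁_bound Γ m n hn _ hmn => exact valid_proj₁_bound hn hmn
  | proj₂_bound Γ m n hn _ _ => exact valid_proj₂_bound hn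
  | normal Γ n t A hn _ _ ht hle => exact valid_normal hn ht hle
  | beta_normal Γ n t A hn _ _ ht hle => exact valid_beta_normal hn ht hle
  | eta_normal Γ n t ρ A hn _ _ _ _ ht hle hρ h => exact valid_eta_normal hn ht hle hρ h

end Soundness

end COMET

theorem mainTheorem1 {C α : Type*} (I : C → Set α) :
    (∀ (Γ : List (COMET.Ty C)) (t : COMET.Tm) (A : COMET.Ty C),
      COMET.Derives Γ (.typ t A) →
        ∀ g ∈ COMET.interpCtx I Γ, COMET.IsDistributionOn (A.interp I) (COMET.prob t g)) ∧
    (∀ (Γ : List (COMET.Ty C)) (s t : COMET.Tm) (A : COMET.Ty C),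
      COMET.Derives Γ (.eq s t A) →
        ∀ g ∈ COMET.interpCtx I Γ, ∀ a ∈ A.interp I, COMET.prob s g a = COMET.prob t g a) :=
  ⟨fun _ _ _ h g hg => (h.valid I).2.2 g hg,
    fun _ _ _ _ h g hg a _ => congrFun ((h.valid I).2.2 g hg).2 a⟩
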